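/- Let $r\ge 1$ be an integer, $X$ a noetherian scheme on which $r$ is invertible (i.e. a noetherian scheme over $\operatorname{Spec}\mathbb Z[r^{-1}]$), $\mathcal L$ an invertible sheaf on $X$, and $s\in H^0(X,\mathcal L)$ a section such that $s:\mathcal O_X\to\mathcal L$ is a monomorphism, i.e. $\operatorname{Div} s$ is an effective Cartier divisor. Let $\pi:X_{(\mathcal L,s,r)}\to X$ be the stack of $r$-th roots of $(\mathcal L,s)$: its objects over a scheme $S$ are the quadruples $(f,\mathcal M,t,\phi)$ with $f:S\to X$ a morphism, $\mathcal M$ an invertible sheaf on $S$, $t\in H^0(S,\mathcal M)$ and $\phi:\mathcal M^{\otimes r}\simeq f^*\mathcal L$ an isomorphism with $\phi(t^{\otimes r})=f^*s$; a morphism from $(f,\mathcal M,t,\phi)$ over $S$ to $(g,\mathcal N,u,\psi)$ over $T$ is a pair $(h,\rho)$ with $h:S\to T$, $g\circ h=f$, and $\rho:\mathcal M\simeq h^*\mathcal N$ an isomorphism with $\rho(t)=h^*u$ and $h^*\psi\circ\rho^{\otimes r}=\phi$. A locally free sheaf on such a stack is a morphism to the stack of locally free sheaves of finite rank; that is, it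 assigns to each object over $S$ a locally free sheaf of finite rank on $S$, compatibly with inverse images along the morphisms of the stack. It is invertible if all these sheaves are invertible. Let $\mathcal F$ be a locally free sheaf on $X_{(\mathcal L,s,r)}$. Then every point $x\in X$ has a Zariski open neighbourhood $U$ such that $\mathcal F_{|\pi^{-1}U}$ is isomorphic to a finite direct sum of invertible sheaves on $\pi^{-1}U$. -/

import Mathlib

open CategoryTheory AlgebraicGeometry Opposite
open scoped TensorProduct

universe v w u

noncomputable section

namespace AlgebraicGeometry.Scheme.Modules

variable {X Y Z : Scheme.{u}}

/-- The structure sheaf `𝒪_X` as an `𝒪_X`-module. -/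
def structureSheaf (X : Scheme.{u}) : X.Modules := SheafOfModules.unit X.ringCatSheaf

/-- `M` is isomorphic to `𝒪_X ⊕ ... ⊕ 𝒪_X` (`n` copies). -/
def IsFreeOfRank (M : X.Modules) (n : ℕ) : Prop :=
  Nonempty (M ≅ ∐ fun _ : Fin n => structureSheaf X)

/-- `M` is a locally free sheaf of finite rank (the rank may vary with the point). -/
def IsLocallyFree (M : X.Modules) : Prop :=
  ∀ x : X, ∃ U : X.Opens, x ∈ U ∧ ∃ n : ℕ, (M.restrict U.ι).IsFreeOfRank n

/-- `M` is an invertible sheaf. -/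
def IsInvertible (M : X.Modules) : Prop :=
  ∀ x : X, ∃ U : X.Opens, x ∈ U ∧ Nonempty (M.restrict U.ι ≅ structureSheaf U)

/-- The morphism `𝒪_X ⟶ M`, `a ↦ a • s`, is a monomorphism. For `M` invertible this says that
the zero scheme `Div s` of the section `s` is an effective Cartier divisor. -/
def IsRegularSection {M : X.Modules} (s : Γ(M, ⊤)) : Prop :=
  ∀ U : X.Opens, Function.Injective
    (fun a : Γ(X, U) => (a • (M.presheaf.map (homOfLE le_top).op s : Γ(M, U)) : Γ(M, U)))

/-- The presheaf `U ↦ M(U)^{⊗ n}` (tensor power over `𝒪_X(U)`). -/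
def tensorPowPresheaf (M : X.Modules) : ℕ → X.PresheafOfModules
  | 0 => PresheafOfModules.unit X.ringCatSheaf.obj
  | n + 1 => PresheafOfModules.Monoidal.tensorObj (R := X.presheaf) (tensorPowPresheaf M n) M.val

/-- The tensor power `M^{⊗ n}`: the sheaf associated with `U ↦ M(U)^{⊗ n}`. -/
def tensorPow (M : X.Modules) (n : ℕ) : X.Modules :=
  (PresheafOfModules.sheafification (𝟙 X.ringCatSheaf.obj)).obj (M.tensorPowPresheaf n)

/-- The element `m₀ ⊗ ... ⊗ mₙ₋₁` of `M(U)^{⊗ n}`. -/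
def presheafTprod (M : X.Modules) (U : X.Opens) :
    (n : ℕ) → (Fin n → Γ(M, U)) → (M.tensorPowPresheaf n).obj (op U)
  | 0, _ => (1 : Γ(X, U))
  | n + 1, m =>
    letI : Module Γ(X, U) ((M.tensorPowPresheaf n).obj (op U)) :=
      ((M.tensorPowPresheaf n).obj (op U)).isModule
    letI : Module Γ(X, U) (M.val.obj (op U)) := (M.val.obj (op U)).isModule
    (M.presheafTprod U n (m ∘ Fin.castSucc) ⊗ₜ[Γ(X, U)] (m (Fin.last n) : M.val.obj (op U)) :)

/-- The section `m₀ ⊗ ... ⊗ mₙ₋₁` of `M^{⊗ n}` over `U`. -/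
def tprod (M : X.Modules) {U : X.Opens} {n : ℕ} (m : Fin n → Γ(M, U)) : Γ(M.tensorPow n, U) :=
  ((PresheafOfModules.sheafificationAdjunction (𝟙 X.ringCatSheaf.obj)).unit.app
    (M.tensorPowPresheaf n)).app (op U) (M.presheafTprod U n m)

/-- The inverse image `f^* x`, over `f⁻¹ U`, of a section `x` over `U`. -/
def pullbackSection (f : X ⟶ Y) {M : Y.Modules} {U : Y.Opens} (x : Γ(M, U)) :
    Γ((pullback f).obj M, f ⁻¹ᵁ U) :=
  ((pullbackPushforwardAdjunction f).unit.app M).app U x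

lemma pullback_map_pullbackSection (f : X ⟶ Y) {M N : Y.Modules} (α : M ⟶ N) {U : Y.Opens} (x : Γ(M, U)) :
    ((pullback f).map α).app (f ⁻¹ᵁ U) (pullbackSection f x) = pullbackSection f (α.app U x) := by
  have := (pullbackPushforwardAdjunction f).unit.naturality α
  have := congr(Hom.app $this U x)
  exact this.symm

lemma pullback_hom_ext (f : X ⟶ Y) {M : Y.Modules} {N : X.Modules} {α β : (pullback f).obj M ⟶ N}
    (h : ∀ (U : Y.Opens) (x : Γ(M, U)), α.app (f ⁻¹ᵁ U) (pullbackSection f x) =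
      β.app (f ⁻¹ᵁ U) (pullbackSection f x)) : α = β := by
  apply ((pullbackPushforwardAdjunction f).homEquiv _ _).injective
  rw [Adjunction.homEquiv_unit, Adjunction.homEquiv_unit]
  ext U x
  exact h U x

lemma pullbackComp_pullbackSection (f : X ⟶ Y) (g : Y ⟶ Z) {M : Z.Modules} {U : Z.Opens} (x : Γ(M, U)) :
    ((pullbackComp f g).hom.app M).app (f ⁻¹ᵁ (g ⁻¹ᵁ U))
      (pullbackSection f (pullbackSection g x)) = pullbackSection (f ≫ g) x := by
  have h := unit_conjugateEquiv ((pullbackPushforwardAdjunction g).comp (pullbackPushforwardAdjunction f))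
      (pullbackPushforwardAdjunction (f ≫ g)) (pullbackComp f g).inv M
  rw [conjugateEquiv_pullbackComp_inv] at h
  have h2 := congr(Hom.app $h U x)
  have h3 : pullbackSection f (pullbackSection g x) = ((pullbackComp f g).inv.app M).app _ (pullbackSection (f ≫ g) x) := h2
  rw [h3]
  have := congr(Hom.app $((pullbackComp f g).inv_hom_id_app M) ((f ≫ g) ⁻¹ᵁ U) (pullbackSection (f ≫ g) x))
  exact this

lemma pullbackId_pullbackSection {M : X.Modules} {U : X.Opens} (x : Γ(M, U)) :
    ((pullbackId X).hom.app M).app U (pullbackSection (𝟙 X) x) = x := by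
  have h := unit_conjugateEquiv .id (pullbackPushforwardAdjunction (𝟙 X)) (pullbackId X).hom M
  rw [conjugateEquiv_pullbackId_hom] at h
  have h2 := congr(Hom.app $h U x)
  exact h2.symm

lemma pullbackCongr_pullbackSection {f g : X ⟶ Y} (h : f = g) {M : Y.Modules} {U : Y.Opens} (x : Γ(M, U)) :
    ((pullbackCongr h).hom.app M).app (f ⁻¹ᵁ U) (pullbackSection f x) =
      ((pullback g).obj M).presheaf.map (eqToHom (by rw [h])).op (pullbackSection g x) := by
  subst h
  simp [pullbackCongr]


lemma pullbackComp_inv_pullbackSection (f : X ⟶ Y) (g : Y ⟶ Z) {M : Z.Modules} {U : Z.Opens}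
    (x : Γ(M, U)) :
    ((pullbackComp f g).inv.app M).app ((f ≫ g) ⁻¹ᵁ U) (pullbackSection (f ≫ g) x) =
      pullbackSection f (pullbackSection g x) := by
  rw [← pullbackComp_pullbackSection]
  exact congr(Hom.app $((pullbackComp f g).hom_inv_id_app M) ((f ≫ g) ⁻¹ᵁ U)
    (pullbackSection f (pullbackSection g x)))

lemma pullbackId_inv_apply {M : X.Modules} {U : X.Opens} (x : Γ(M, U)) :
    ((pullbackId X).inv.app M).app U x = pullbackSection (𝟙 X) x := by
  conv_lhs => rw [← pullbackId_pullbackSection x]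
  exact congr(Hom.app $((pullbackId X).hom_inv_id_app M) U (pullbackSection (𝟙 X) x))

lemma pullbackComp_assoc {W : Scheme.{u}} (h : X ⟶ Y) (k : Y ⟶ Z) (c : Z ⟶ W) {d : Y ⟶ W}
    {e : X ⟶ W} (w₁ : k ≫ c = d) (w₂ : h ≫ d = e) (w₃ : (h ≫ k) ≫ c = e) (L : W.Modules) :
    (pullbackComp h k).hom.app ((pullback c).obj L) ≫
        (pullbackComp (h ≫ k) c ≪≫ pullbackCongr w₃).hom.app L =
      (pullback h).map ((pullbackComp k c ≪≫ pullbackCongr w₁).hom.app L) ≫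
        (pullbackComp h d ≪≫ pullbackCongr w₂).hom.app L := by
  subst w₁ w₂
  have := congr(NatTrans.app $(pseudofunctor_associativity h k c) L)
  simp only [pullbackCongr, eqToIso.hom, NatTrans.comp_app, Functor.whiskerRight_app, Functor.associator_hom_app, Functor.whiskerLeft_app, Category.id_comp, Iso.trans_hom,
    eqToHom_refl, Category.comp_id] at this ⊢
  have h2 : (pullbackComp h k).hom.app ((pullback c).obj L) ≫ (pullbackComp (h ≫ k) c).hom.app L =
      ((pullback h).map ((pullbackComp k c).hom.app L) ≫ (pullbackComp h (k ≫ c)).hom.app L) ≫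
        (eqToHom (by simp) : pullback (h ≫ k ≫ c) ⟶ pullback ((h ≫ k) ≫ c)).app L := by
    rw [← this]
    simp [← Functor.map_comp_assoc]
  rw [reassoc_of% h2, ← NatTrans.comp_app, eqToHom_trans, eqToHom_refl]
  simp

lemma comp_section {f : X ⟶ Y} {g : Y ⟶ Z} {M : X.Modules} {N : Y.Modules} {P : Z.Modules}
    (α : M ⟶ (pullback f).obj N) (β : N ⟶ (pullback g).obj P) {U : Z.Opens}
    {x : Γ(M, f ⁻¹ᵁ (g ⁻¹ᵁ U))} {y : Γ(N, g ⁻¹ᵁ U)} {z : Γ(P, U)}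
    (hx : α.app _ x = pullbackSection f y) (hy : β.app _ y = pullbackSection g z) :
    (α ≫ (pullback f).map β ≫ (pullbackComp f g).hom.app P).app (f ⁻¹ᵁ (g ⁻¹ᵁ U)) x =
      pullbackSection (f ≫ g) z := by
  rw [← pullbackComp_pullbackSection, ← hy, ← pullback_map_pullbackSection, ← hx]
  rfl

lemma comp_inv_section {f : X ⟶ Y} {g : Y ⟶ Z} {M : X.Modules} {N : Y.Modules} {P : Z.Modules}
    (α : M ≅ (pullback f).obj N) (β : N ≅ (pullback g).obj P) {U : Z.Opens} (z : Γ(P, U)) :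
    (α ≪≫ (pullback f).mapIso β ≪≫ (pullbackComp f g).app P).inv.app ((f ≫ g) ⁻¹ᵁ U)
        (pullbackSection (f ≫ g) z) =
      α.inv.app (f ⁻¹ᵁ (g ⁻¹ᵁ U)) (pullbackSection f
        (β.inv.app (g ⁻¹ᵁ U) (pullbackSection g z))) := by
  rw [← pullback_map_pullbackSection, ← pullbackComp_inv_pullbackSection]
  rfl

lemma comp_coherence {W : Scheme.{u}} {h : X ⟶ Y} {k : Y ⟶ Z} {c : Z ⟶ W} {d : Y ⟶ W}
    {e : X ⟶ W} (w₁ : k ≫ c = d) (w₂ : h ≫ d = e) (w₃ : (h ≫ k) ≫ c = e) {L : W.Modules}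
    {U : Z.Opens} (y : Γ((pullback c).obj L, U)) :
    ((pullbackComp h d ≪≫ pullbackCongr w₂).hom.app L).app (h ⁻¹ᵁ (k ⁻¹ᵁ U))
      (pullbackSection h (((pullbackComp k c ≪≫ pullbackCongr w₁).hom.app L).app (k ⁻¹ᵁ U) (pullbackSection k y))) =
      ((pullbackComp (h ≫ k) c ≪≫ pullbackCongr w₃).hom.app L).app ((h ≫ k) ⁻¹ᵁ U)
        (pullbackSection (h ≫ k) y) := by
  rw [← pullback_map_pullbackSection, ← pullbackComp_pullbackSection]
  exact congr(Hom.app $((pullbackComp_assoc h k c w₁ w₂ w₃ L).symm) (h ⁻¹ᵁ (k ⁻¹ᵁ U))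
    (pullbackSection h (pullbackSection k y)))

lemma pullbackId_inv_comp (f : X ⟶ Y) (w : 𝟙 X ≫ f = f) (N : Y.Modules) :
    (pullbackId X).inv.app ((pullback f).obj N) ≫
      (pullbackComp (𝟙 X) f ≪≫ pullbackCongr w).hom.app N = 𝟙 _ := by
  have h := congr(NatTrans.app $(pseudofunctor_right_unitality f) N)
  simp only [pullbackCongr, eqToIso.hom, NatTrans.comp_app, Functor.whiskerLeft_app,
    Functor.rightUnitor_hom_app, Iso.trans_hom] at h ⊢
  have h2 : (pullbackId X).hom.app ((pullback f).obj N) =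
      (pullbackComp (𝟙 X) f).hom.app N ≫
        (eqToHom (by simp) : pullback (𝟙 X ≫ f) ⟶ pullback f).app N := by
    rw [← h]; simp
  rw [← h2]; simp

lemma pullback_map_pullbackId_inv_comp (f : X ⟶ Y) (w : f ≫ 𝟙 Y = f) (N : Y.Modules) :
    (pullback f).map ((pullbackId Y).inv.app N) ≫
      (pullbackComp f (𝟙 Y) ≪≫ pullbackCongr w).hom.app N = 𝟙 _ := by
  have h := congr(NatTrans.app $(pseudofunctor_left_unitality f) N)
  simp only [pullbackCongr, eqToIso.hom, NatTrans.comp_app, Functor.whiskerRight_app,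
    Functor.leftUnitor_hom_app, Iso.trans_hom] at h ⊢
  have h2 : (pullback f).map ((pullbackId Y).hom.app N) =
      (pullbackComp f (𝟙 Y)).hom.app N ≫
        (eqToHom (by simp) : pullback (f ≫ 𝟙 Y) ⟶ pullback f).app N := by
    rw [← h]; simp
  rw [← h2, ← Functor.map_comp]; simp

lemma id_coherence {c : X ⟶ Y} (w : 𝟙 X ≫ c = c) {L : Y.Modules} {U : X.Opens}
    (y : Γ((pullback c).obj L, U)) :
    ((pullbackComp (𝟙 X) c ≪≫ pullbackCongr w).hom.app L).app U (pullbackSection (𝟙 X) y) = y := by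
  rw [← pullbackId_inv_apply]
  exact congr(Hom.app $(pullbackId_inv_comp c w L) U y)

end AlgebraicGeometry.Scheme.Modules

namespace AlgebraicGeometry
open Scheme.Modules


/-- The objects of the stack of `r`-th roots of `(L, s)`: quadruples `(f, M, t, φ)` over a scheme `S`,
where `f : S ⟶ X`, `M` is an invertible sheaf on `S`, `t` is a global section of `M` and
`φ : M^{⊗ r} ≅ f^* L` is an isomorphism with `φ (t^{⊗ r}) = f^* s`. -/
structure RootStack {X : Scheme.{u}} (L : X.Modules) (s : Γ(L, ⊤)) (r : ℕ) where
  S : Scheme.{u}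
  f : S ⟶ X
  M : S.Modules
  isInvertible : M.IsInvertible
  t : Γ(M, ⊤)
  φ : M.tensorPow r ≅ (pullback f).obj L
  φ_t : φ.hom.app ⊤ (M.tprod fun _ : Fin r => t) = pullbackSection f s

namespace RootStack
variable {X : Scheme.{u}} {L : X.Modules} {s : Γ(L, ⊤)} {r : ℕ}

/-- Morphisms `(f, M, t, φ) ⟶ (g, N, u, ψ)` of the root stack: pairs `(h, ρ)` where `h : S ⟶ T` satisfies
`h ≫ g = f` and `ρ : M ≅ h^* N` is an isomorphism with `ρ t = h^* u` which makes the square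
`M^{⊗ r} ⟶ h^* N^{⊗ r} ⟶ h^* g^* L = f^* L` (that is, `h^* ψ ∘ ρ^{⊗ r} = φ`) commute.
The field `comm` expresses the commutativity on the sections `h^* (n₁ ⊗ ... ⊗ nᵣ)`, which
generate the `𝒪_S`-module `h^* N^{⊗ r}`. -/
structure Hom (ξ η : RootStack L s r) where
  base : ξ.S ⟶ η.S
  w : base ≫ η.f = ξ.f
  ρ : ξ.M ≅ (pullback base).obj η.M
  ρ_t : ρ.hom.app ⊤ ξ.t = pullbackSection base η.t
  comm : ∀ (V : η.S.Opens) (n : Fin r → Γ(η.M, V)),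
    ξ.φ.hom.app (base ⁻¹ᵁ V)
        (ξ.M.tprod fun i => ρ.inv.app (base ⁻¹ᵁ V) (pullbackSection base (n i))) =
      ((pullbackComp base η.f ≪≫ pullbackCongr w).hom.app L).app (base ⁻¹ᵁ V)
        (pullbackSection base (η.φ.hom.app V (η.M.tprod n)))

lemma Hom.ext' {ξ η : RootStack L s r} {a b : Hom ξ η} (h : a.base = b.base)
    (h' : a.ρ.hom ≫ (pullbackCongr h).hom.app η.M = b.ρ.hom) : a = b := by
  obtain ⟨f, w, ρ, _, _⟩ := a
  obtain ⟨f', w', ρ', _, _⟩ := b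
  obtain rfl : f = f' := h
  obtain rfl : ρ = ρ' := by
    ext1
    simpa [pullbackCongr] using h'
  rfl

def Hom.id (ξ : RootStack L s r) : Hom ξ ξ where
  base := 𝟙 ξ.S
  w := Category.id_comp _
  ρ := ((pullbackId ξ.S).app ξ.M).symm
  ρ_t := pullbackId_inv_apply ξ.t
  comm V n := by
    have h1 : (fun i => ((pullbackId ξ.S).hom.app ξ.M).app V (pullbackSection (𝟙 ξ.S) (n i))) = n :=
      funext fun i => pullbackId_pullbackSection (n i)
    exact (congrArg (fun m => ξ.φ.hom.app V (ξ.M.tprod m)) h1).trans (id_coherence _ _).symm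

def Hom.comp {ξ η ζ : RootStack L s r} (a : Hom ξ η) (b : Hom η ζ) : Hom ξ ζ where
  base := a.base ≫ b.base
  w := by rw [Category.assoc, b.w, a.w]
  ρ := a.ρ ≪≫ (pullback a.base).mapIso b.ρ ≪≫ (pullbackComp a.base b.base).app ζ.M
  ρ_t := by
    have h := comp_section (U := (⊤ : ζ.S.Opens)) (x := ξ.t) (y := η.t) (z := ζ.t) a.ρ.hom b.ρ.hom
    have h2 := h a.ρ_t b.ρ_t
    exact h2
  comm V n := by
    have h0 : ∀ i, (a.ρ ≪≫ (pullback a.base).mapIso b.ρ ≪≫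
        (pullbackComp a.base b.base).app ζ.M).inv.app ((a.base ≫ b.base) ⁻¹ᵁ V)
          (pullbackSection (a.base ≫ b.base) (n i)) =
        a.ρ.inv.app (a.base ⁻¹ᵁ (b.base ⁻¹ᵁ V)) (pullbackSection a.base
          (b.ρ.inv.app (b.base ⁻¹ᵁ V) (pullbackSection b.base (n i)))) :=
      fun i => comp_inv_section a.ρ b.ρ (n i)
    have h1 := a.comm (b.base ⁻¹ᵁ V)
      (fun i => b.ρ.inv.app (b.base ⁻¹ᵁ V) (pullbackSection b.base (n i)))
    rw [b.comm V n] at h1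
    have h2 := congrArg (fun m => ξ.φ.hom.app (a.base ⁻¹ᵁ (b.base ⁻¹ᵁ V)) (ξ.M.tprod m)) (funext h0)
    exact (h2.trans h1).trans (comp_coherence b.w a.w _ _)

instance : Category (RootStack L s r) where
  Hom ξ η := RootStack.Hom ξ η
  id ξ := RootStack.Hom.id ξ
  comp a b := RootStack.Hom.comp a b
  id_comp {ξ η} a := by
    refine Hom.ext' (Category.id_comp _) ?_
    have h := (pullbackId ξ.S).inv.naturality a.ρ.hom
    have h2 := pullbackId_inv_comp a.base (Category.id_comp _) η.M
    dsimp [Hom.comp, Hom.id] at h h2 ⊢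
    simp only [Category.assoc]
    rw [← reassoc_of% h, h2, Category.comp_id]
  comp_id {ξ η} a := by
    refine Hom.ext' (Category.comp_id _) ?_
    have h2 := pullback_map_pullbackId_inv_comp a.base (Category.comp_id _) η.M
    dsimp [Hom.comp, Hom.id] at h2 ⊢
    simp only [Category.assoc]
    rw [h2, Category.comp_id]
  assoc {ξ η ζ ω} a b c := by
    refine Hom.ext' (Category.assoc _ _ _) ?_
    have h := pullbackComp_assoc a.base b.base c.base rfl rfl (Category.assoc _ _ _) ω.M
    have h2 := (pullbackComp a.base b.base).hom.naturality c.ρ.hom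
    have e : ∀ (Y : Scheme.{u}) (f : ξ.S ⟶ Y), (pullbackCongr (rfl : f = f)).hom = 𝟙 _ := fun _ _ => rfl
    have e' : ∀ (Y : Scheme.{u}) (f : η.S ⟶ Y), (pullbackCongr (rfl : f = f)).hom = 𝟙 _ := fun _ _ => rfl
    simp only [Iso.trans_hom, e, e', Category.comp_id, NatTrans.comp_app] at h
    dsimp [Hom.comp] at h h2 ⊢
    simp only [Category.assoc, Functor.map_comp]
    rw [← reassoc_of% h2, h]

/-- The structure functor of the root stack, as a category fibred in groupoids over schemes. -/
def toScheme (L : X.Modules) (s : Γ(L, ⊤)) (r : ℕ) : RootStack L s r ⥤ Scheme.{u} where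
  obj ξ := ξ.S
  map a := RootStack.Hom.base a

/-- The open substack `π⁻¹ U` of the root stack `π : X_{(L,s,r)} ⟶ X`: the full subcategory of the
quadruples `(f, M, t, φ)` such that `f` factors through the open subscheme `U`. -/
def preimage (L : X.Modules) (s : Γ(L, ⊤)) (r : ℕ) (U : X.Opens) :
    ObjectProperty (RootStack L s r) :=
  fun ξ => ξ.f ⁻¹ᵁ U = ⊤

end RootStack

/-- A locally free sheaf (of finite rank) on a category `p : 𝒳 ⥤ Scheme` fibred in groupoids over
schemes, that is, a morphism from `𝒳` to the stack of locally free sheaves: it assigns to each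
object `ξ` over `S` a locally free sheaf on `S`, and to each arrow `a : ξ ⟶ η` over `h : S ⟶ T` an
isomorphism of the sheaf at `ξ` with the inverse image under `h` of the sheaf at `η`, compatibly
with identities and composition. -/
structure StackVect {𝒳 : Type w} [Category.{v} 𝒳] (p : 𝒳 ⥤ Scheme.{u}) where
  obj (ξ : 𝒳) : (p.obj ξ).Modules
  isLocallyFree (ξ : 𝒳) : (obj ξ).IsLocallyFree
  map {ξ η : 𝒳} (a : ξ ⟶ η) : obj ξ ≅ (pullback (p.map a)).obj (obj η)
  map_id (ξ : 𝒳) : (map (𝟙 ξ)).hom =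
    (pullbackId (p.obj ξ)).inv.app (obj ξ) ≫ (pullbackCongr (p.map_id ξ).symm).hom.app (obj ξ)
  map_comp {ξ η ζ : 𝒳} (a : ξ ⟶ η) (b : η ⟶ ζ) : (map (a ≫ b)).hom =
    (map a).hom ≫ (pullback (p.map a)).map (map b).hom ≫
      (pullbackComp (p.map a) (p.map b)).hom.app (obj ζ) ≫
        (pullbackCongr (p.map_comp a b).symm).hom.app (obj ζ)

namespace StackVect

variable {𝒳 : Type w} [Category.{v} 𝒳] {p : 𝒳 ⥤ Scheme.{u}}

/-- The restriction of a locally free sheaf to a full subcategory, e.g. to an open substack. -/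
def restrict (F : StackVect p) (P : ObjectProperty 𝒳) : StackVect (P.ι ⋙ p) where
  obj ξ := F.obj ξ.obj
  isLocallyFree ξ := F.isLocallyFree ξ.obj
  map a := F.map a.hom
  map_id ξ := F.map_id ξ.obj
  map_comp a b := F.map_comp a.hom b.hom

/-- A locally free sheaf on a stack is invertible if all its values are invertible sheaves. -/
def IsInvertible (F : StackVect p) : Prop :=
  ∀ ξ : 𝒳, (F.obj ξ).IsInvertible

/-- `F` is isomorphic to the direct sum of the `G i`: there are morphisms of sheaves
`G i ⟶ F` (families of morphisms `G i ξ ⟶ F ξ` compatible with the inverse image isomorphisms)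
which, for every `ξ`, exhibit `F ξ` as the direct sum of the sheaves of modules `G i ξ`. -/
def IsDirectSum (F : StackVect p) {n : ℕ} (G : Fin n → StackVect p) : Prop :=
  ∃ inj : ∀ (i : Fin n) (ξ : 𝒳), (G i).obj ξ ⟶ F.obj ξ,
    (∀ (i : Fin n) {ξ η : 𝒳} (a : ξ ⟶ η),
      inj i ξ ≫ (F.map a).hom = ((G i).map a).hom ≫ (pullback (p.map a)).map (inj i η)) ∧
    ∀ ξ : 𝒳, Nonempty (Limits.IsColimit (Limits.Cofan.mk (F.obj ξ) fun i => inj i ξ))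

end StackVect

end AlgebraicGeometry

end

/-!
Sheaves of modules are handled through sections. A *frame* of a sheaf over an open subset is a finite
family of sections which is a basis over every smaller open subset (`IsFrame`); frames are stable
under inverse image, and a locally free sheaf has frames locally. On a stack, a system of frames which
is stable under inverse image, and in which the line spanned by the `i`-th member of a frame does not
depend on the frame, defines orthogonal idempotents which split the sheaf into a direct sum of
invertible sheaves (`FrameSystem.exists_isDirectSum`). It remains to find such a system on the part of
the root stack over a neighbourhood of a given point `x`. Choose an affine neighbourhood `U = Spec A`
of `x` and a generator `ℓ` of `L` over `U`, and write `s = s₀ ℓ`.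

If `s₀` does not vanish at `x`, the root stack is isomorphic to the base near `x`: the object given
by the inclusion of `U`, with the section `1` of the trivial sheaf, is terminal over `U`. The inverse
images of a frame of the value of `F` at this object form the system
(`exists_frameSystem_of_isUnit`).

If `s₀` vanishes at `x`, the root stack over `U` is the quotient of the *atlas*
`Spec A[T] / (T ^ r - s₀)` by the group of `r`-th roots of unity, and the decomposition of `F` comes
from that of representations of this diagonalisable group into weights. Neither the group nor the
quotient is needed. The fibre product of the atlas with an object `ξ` trivialised by a generator `m`,
with `φ (m^{⊗ r}) = d f^* ℓ`, is the cyclic cover `w ^ r = d` of the base of `ξ`, on which `w` is the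
ratio of the two generators (`IsAtlas.exists_isCover`, `IsAtlas.exists_factor`). On this cover the
sections of `F` are uniquely of the form `∑ i < r, w ^ i σ i` with sections `σ i` of `F ξ`
(`bijective_sum_pow_smul_pull`). Hence a section of `F` over the atlas has a component `σ i` of each
weight `i` on every trivialised object; it is unique, commutes with inverse images, and is multiplied
by a power of a unit when `m` is multiplied by a unit (`IsWeightDecomposition`).

The atlas has a single point over `x`, because `T` vanishes there. So, after shrinking `U`, the sheaf
`F` has a frame over the whole atlas. The components of its members on the atlas generate `F`, and
therefore contain a basis at that point and a frame over a neighbourhood of `x`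
(`IsAtlas.exists_isFrame_component`). The same components give a frame on every object, as one sees
on the fibre product with the atlas (`IsAtlas.isFrame_of_isWeightDecomposition`), and these frames
form the system (`exists_frameSystem_of_notMem`).
-/

noncomputable section

/-! ### Sections of sheaves of modules -/

namespace AlgebraicGeometry.Scheme.Modules

variable {X Y Z : Scheme.{u}}

/-- Restriction of sections of a module to a smaller open subset. -/
def res (M : X.Modules) {V W : X.Opens} (h : W ≤ V) : Γ(M, V) →+ Γ(M, W) :=
  (M.presheaf.map (homOfLE h).op).hom

/-- Restriction of functions to a smaller open subset. -/
def fres {V W : X.Opens} (h : W ≤ V) : Γ(X, V) →+* Γ(X, W) :=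
  (X.presheaf.map (homOfLE h).op).hom

lemma res_smul {M : X.Modules} {V W : X.Opens} (h : W ≤ V) (c : Γ(X, V)) (x : Γ(M, V)) :
    M.res h (c • x) = fres h c • M.res h x :=
  map_smul M (homOfLE h) c x

@[simp] lemma res_res {M : X.Modules} {V W T : X.Opens} (h : W ≤ V) (h' : T ≤ W) (x : Γ(M, V)) :
    M.res h' (M.res h x) = M.res (h'.trans h) x := by
  simp only [res]
  rw [← ConcreteCategory.comp_apply, ← Functor.map_comp]
  rfl

@[simp] lemma fres_fres {V W T : X.Opens} (h : W ≤ V) (h' : T ≤ W) (x : Γ(X, V)) :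
    fres h' (fres h x) = fres (h'.trans h) x := by
  simp only [fres]
  rw [← RingHom.comp_apply, ← CommRingCat.hom_comp, ← Functor.map_comp]
  rfl

@[simp] lemma res_self {M : X.Modules} {V : X.Opens} (h : V ≤ V) (x : Γ(M, V)) :
    M.res h x = x := by
  simp only [res]
  rw [show (homOfLE h).op = 𝟙 (op V) from rfl, M.presheaf.map_id]
  rfl

@[simp] lemma fres_self {V : X.Opens} (h : V ≤ V) (x : Γ(X, V)) :
    fres h x = x := by
  simp only [fres]
  rw [show (homOfLE h).op = 𝟙 (op V) from rfl, X.presheaf.map_id]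
  rfl

lemma app_res {M N : X.Modules} (φ : M ⟶ N) {V W : X.Opens} (h : W ≤ V) (x : Γ(M, V)) :
    φ.app W (M.res h x) = N.res h (φ.app V x) :=
  congr($(φ.mapPresheaf.naturality (homOfLE h).op) x)

lemma comp_app_apply {M N P : X.Modules} (φ : M ⟶ N) (ψ : N ⟶ P) {V : X.Opens} (x : Γ(M, V)) :
    (φ ≫ ψ).app V x = ψ.app V (φ.app V x) := rfl

/-- Sections of a sheaf of modules which agree locally are equal. -/
lemma sec_ext (M : X.Modules) {V : X.Opens} {x y : Γ(M, V)}
    (h : ∀ p ∈ V, ∃ W : X.Opens, p ∈ W ∧ ∃ hW : W ≤ V, M.res hW x = M.res hW y) : x = y := by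
  choose W hpW hW hxy using h
  refine TopCat.Sheaf.eq_of_locally_eq' ⟨M.presheaf, M.isSheaf⟩ (fun p : V => W p.1 p.2) V
    (fun p => homOfLE (hW p.1 p.2)) ?_ x y fun p => hxy p.1 p.2
  intro p hp
  exact TopologicalSpace.Opens.mem_iSup.mpr ⟨⟨p, hp⟩, hpW p hp⟩

lemma fun_ext {V : X.Opens} {x y : Γ(X, V)}
    (h : ∀ p ∈ V, ∃ W : X.Opens, p ∈ W ∧ ∃ hW : W ≤ V, fres hW x = fres hW y) : x = y := by
  choose W hpW hW hxy using h
  refine TopCat.Sheaf.eq_of_locally_eq' X.sheaf (fun p : V => W p.1 p.2) V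
    (fun p => homOfLE (hW p.1 p.2)) ?_ x y fun p => hxy p.1 p.2
  intro p hp
  exact TopologicalSpace.Opens.mem_iSup.mpr ⟨⟨p, hp⟩, hpW p hp⟩

/-- Gluing of sections that are uniquely characterised by a property that is local. -/
lemma exists_section_of_local (M : X.Modules) {V : X.Opens}
    (P : ∀ W : X.Opens, W ≤ V → Γ(M, W) → Prop)
    (hex : ∀ p ∈ V, ∃ W : X.Opens, p ∈ W ∧ ∃ (hW : W ≤ V) (y : Γ(M, W)), P W hW y)
    (hres : ∀ W hW W' (h : W' ≤ W) y, P W hW y → P W' (h.trans hW) (M.res h y))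
    (huniq : ∀ W hW y y', P W hW y → P W hW y' → y = y') :
    ∃ y : Γ(M, V), ∀ p ∈ V, ∃ W : X.Opens, p ∈ W ∧ ∃ hW : W ≤ V, P W hW (M.res hW y) := by
  choose W hpW hW y hy using hex
  obtain ⟨s, hs, -⟩ := TopCat.Sheaf.existsUnique_gluing' ⟨M.presheaf, M.isSheaf⟩
    (fun p : V => W p.1 p.2) V (fun p => homOfLE (hW p.1 p.2))
    (fun p hp => TopologicalSpace.Opens.mem_iSup.mpr ⟨⟨p, hp⟩, hpW p hp⟩)
    (fun p => y p.1 p.2) (by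
      intro p q
      exact huniq _ (inf_le_left.trans (hW p.1 p.2)) _ _
        (hres _ _ _ inf_le_left _ (hy p.1 p.2)) (hres _ _ _ inf_le_right _ (hy q.1 q.2)))
  refine ⟨s, fun p hp => ⟨W p hp, hpW p hp, hW p hp, ?_⟩⟩
  have : M.res (hW p hp) s = y p hp := hs ⟨p, hp⟩
  rw [this]
  exact hy p hp

/-- A morphism of sheaves of modules from compatible linear maps on sections. -/
def homMk {M N : X.Modules} (f : ∀ V : X.Opens, Γ(M, V) → Γ(N, V))
    (hadd : ∀ V x y, f V (x + y) = f V x + f V y)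
    (hsmul : ∀ (V) (c : Γ(X, V)) (x), f V (c • x) = c • f V x)
    (hres : ∀ {V W : X.Opens} (h : W ≤ V) (x), f W (M.res h x) = N.res h (f V x)) : M ⟶ N :=
  SheafOfModules.Hom.mk
    { app := fun V => ModuleCat.ofHom (X := M.val.obj V) (Y := N.val.obj V)
        { toFun := f V.unop
          map_add' := hadd V.unop
          map_smul' := hsmul V.unop }
      naturality := by
        intro V W g
        ext x
        exact hres (leOfHom g.unop) x }

lemma isIso_of_bijective {M N : X.Modules} (φ : M ⟶ N)
    (h : ∀ V, Function.Bijective (φ.app V)) : IsIso φ := by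
  rw [Hom.isIso_iff_isIso_app]
  intro U
  exact (ConcreteCategory.isIso_iff_bijective _).mpr (h U)

lemma hom_ext_apply {M N : X.Modules} {φ ψ : M ⟶ N} (h : ∀ V x, φ.app V x = ψ.app V x) :
    φ = ψ := by
  ext V x
  exact h V x

end AlgebraicGeometry.Scheme.Modules

/-! ### Localisation at an open subset, inverse images of sections -/

namespace AlgebraicGeometry.Scheme.Modules

variable {X Y Z : Scheme.{u}}

/-- The module `j_* j^* M` for the inclusion `j` of an open subset `W`. -/
def localize (M : X.Modules) (W : X.Opens) : X.Modules :=
  (pushforward W.ι).obj (M.restrict W.ι)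

lemma ι_image_preimage_le_left (W V : X.Opens) : W.ι ''ᵁ (W.ι ⁻¹ᵁ V) ≤ V :=
  W.ι.image_preimage_le V

lemma ι_image_preimage_le_right (W V : X.Opens) : W.ι ''ᵁ (W.ι ⁻¹ᵁ V) ≤ W := by
  rintro _ ⟨x, -, rfl⟩
  exact x.2

lemma le_ι_image_preimage {W V V' : X.Opens} (h : V' ≤ V) (h' : V' ≤ W) :
    V' ≤ W.ι ''ᵁ (W.ι ⁻¹ᵁ V) :=
  fun x hx => ⟨⟨x, h' hx⟩, h hx, rfl⟩

/-- The sections of `j_* j^* M` over `V` are the sections of `M` over `V ∩ W`. -/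
def locEquiv (M : X.Modules) (W V : X.Opens) :
    Γ(M.localize W, V) ≃+ Γ(M, W.ι ''ᵁ (W.ι ⁻¹ᵁ V)) :=
  AddEquiv.refl Γ(M, W.ι ''ᵁ (W.ι ⁻¹ᵁ V))

lemma locEquiv_smul (M : X.Modules) (W V : X.Opens) (c : Γ(X, V)) (x : Γ(M.localize W, V)) :
    locEquiv M W V (c • x) = fres (ι_image_preimage_le_left W V) c • locEquiv M W V x := by
  have h : (W.ι.appIso _).inv (W.ι.app V c) = fres (ι_image_preimage_le_left W V) c := by
    rw [Opens.ι_appIso, Opens.ι_app]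
    rfl
  rw [← h]
  rfl

lemma locEquiv_symm_smul (M : X.Modules) (W V : X.Opens) (c : Γ(X, V))
    (x : Γ(M, W.ι ''ᵁ (W.ι ⁻¹ᵁ V))) :
    (locEquiv M W V).symm (fres (ι_image_preimage_le_left W V) c • x) =
      c • (locEquiv M W V).symm x := by
  apply (locEquiv M W V).injective
  rw [locEquiv_smul, AddEquiv.apply_symm_apply, AddEquiv.apply_symm_apply]

lemma locEquiv_res (M : X.Modules) (W : X.Opens) {V V' : X.Opens} (h : V' ≤ V)
    (x : Γ(M.localize W, V)) :
    locEquiv M W V' ((M.localize W).res h x) =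
      M.res (W.ι.image_mono (W.ι.preimage_mono h)) (locEquiv M W V x) := rfl

/-- A section of `j_* j^* M` over `V`, seen as a section of `M` over a subset of `V ∩ W`. -/
def ofLoc {M : X.Modules} {W V V' : X.Opens} (h : V' ≤ V) (h' : V' ≤ W) :
    Γ(M.localize W, V) →+ Γ(M, V') :=
  (M.res (le_ι_image_preimage h h')).comp (locEquiv M W V).toAddMonoidHom

lemma ofLoc_apply {M : X.Modules} {W V V' : X.Opens} (h : V' ≤ V) (h' : V' ≤ W)
    (x : Γ(M.localize W, V)) :
    ofLoc h h' x = M.res (le_ι_image_preimage h h') (locEquiv M W V x) := rfl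

lemma ofLoc_smul {M : X.Modules} {W V V' : X.Opens} (h : V' ≤ V) (h' : V' ≤ W)
    (c : Γ(X, V)) (x : Γ(M.localize W, V)) :
    ofLoc h h' (c • x) = fres h c • ofLoc (M := M) h h' x := by
  rw [ofLoc_apply, locEquiv_smul, res_smul, fres_fres, ofLoc_apply]

lemma ofLoc_res {M : X.Modules} {W V V' V'' : X.Opens} (h : V' ≤ V) (h' : V'' ≤ V') (h'' : V'' ≤ W)
    (x : Γ(M.localize W, V)) :
    ofLoc h' h'' ((M.localize W).res h x) = ofLoc (h'.trans h) h'' x := by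
  rw [ofLoc_apply, ofLoc_apply, locEquiv_res, res_res]

/-- A section of `M` over `V ∩ W`, seen as a section of `j_* j^* M` over `V`. -/
def toLoc (M : X.Modules) (W V : X.Opens) : Γ(M, V ⊓ W) →+ Γ(M.localize W, V) :=
  (locEquiv M W V).symm.toAddMonoidHom.comp
    (M.res (le_inf (ι_image_preimage_le_left W V) (ι_image_preimage_le_right W V)))

lemma toLoc_apply (M : X.Modules) (W V : X.Opens) (x : Γ(M, V ⊓ W)) :
    toLoc M W V x = (locEquiv M W V).symm
      (M.res (le_inf (ι_image_preimage_le_left W V) (ι_image_preimage_le_right W V)) x) := rfl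

lemma ofLoc_toLoc {M : X.Modules} {W V V' : X.Opens} (h : V' ≤ V) (h' : V' ≤ W)
    (x : Γ(M, V ⊓ W)) : ofLoc h h' (toLoc M W V x) = M.res (le_inf h h') x := by
  rw [toLoc_apply, ofLoc_apply, AddEquiv.apply_symm_apply, res_res]

/-- Morphisms to `j_* j^* N` from compatible maps to sections of `N` on `V ∩ W`. -/
def homLocMk {M N : X.Modules} {W : X.Opens} (f : ∀ V : X.Opens, Γ(M, V) → Γ(N, V ⊓ W))
    (hadd : ∀ V x y, f V (x + y) = f V x + f V y)
    (hsmul : ∀ (V) (c : Γ(X, V)) (x),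
      f V (c • x) = fres (inf_le_left : V ⊓ W ≤ V) c • f V x)
    (hres : ∀ {V V' : X.Opens} (h : V' ≤ V) (x),
      f V' (M.res h x) = N.res (inf_le_inf_right W h) (f V x)) : M ⟶ N.localize W :=
  homMk (fun V x => toLoc N W V (f V x))
    (fun V x y => by rw [hadd, map_add])
    (fun V c x => by
      rw [hsmul, toLoc_apply, res_smul, fres_fres, locEquiv_symm_smul, toLoc_apply])
    (fun h x => by
      apply (locEquiv N W _).injective
      rw [hres, locEquiv_res, toLoc_apply, toLoc_apply, AddEquiv.apply_symm_apply,
        AddEquiv.apply_symm_apply, res_res, res_res])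

lemma ofLoc_homLocMk {M N : X.Modules} {W : X.Opens} (f : ∀ V : X.Opens, Γ(M, V) → Γ(N, V ⊓ W))
    (hadd) (hsmul) (hres) {V V' : X.Opens} (h : V' ≤ V) (h' : V' ≤ W) (x : Γ(M, V)) :
    ofLoc h h' ((homLocMk f hadd hsmul hres).app V x) =
      N.res (le_inf h h') (f V x) :=
  ofLoc_toLoc _ _ _

lemma localize_ext {M : X.Modules} {W V : X.Opens} {x y : Γ(M.localize W, V)}
    (h : ofLoc (M := M) (inf_le_left : V ⊓ W ≤ V) inf_le_right x =
      ofLoc inf_le_left inf_le_right y) :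
    x = y := by
  have := congrArg (M.res (le_inf (ι_image_preimage_le_left W V) (ι_image_preimage_le_right W V))) h
  simp only [ofLoc_apply, res_res, res_self] at this
  exact (locEquiv M W V).injective this

lemma pullbackSection_add (f : X ⟶ Y) {M : Y.Modules} {U : Y.Opens} (x y : Γ(M, U)) :
    pullbackSection f (x + y) = pullbackSection f x + pullbackSection f y :=
  map_add (((pullbackPushforwardAdjunction f).unit.app M).app U).hom x y

lemma pullbackSection_smul (f : X ⟶ Y) {M : Y.Modules} {U : Y.Opens} (c : Γ(Y, U)) (x : Γ(M, U)) :
    pullbackSection f (c • x) = (f.app U c) • pullbackSection f x :=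
  Hom.app_smul ((pullbackPushforwardAdjunction f).unit.app M) c x

lemma pullbackSection_res (f : X ⟶ Y) {M : Y.Modules} {U V : Y.Opens} (h : V ≤ U) (x : Γ(M, U)) :
    pullbackSection f (M.res h x) =
      ((pullback f).obj M).res (f.preimage_mono h) (pullbackSection f x) :=
  app_res ((pullbackPushforwardAdjunction f).unit.app M) h x

/-- The inverse image of a section, restricted to a given open subset of the inverse image. -/
def pullLE (f : X ⟶ Y) {M : Y.Modules} {V : Y.Opens} {W : X.Opens} (h : W ≤ f ⁻¹ᵁ V) :
    Γ(M, V) →+ Γ((pullback f).obj M, W) where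
  toFun x := ((pullback f).obj M).res h (pullbackSection f x)
  map_zero' := by
    have : pullbackSection f (0 : Γ(M, V)) = 0 :=
      map_zero (((pullbackPushforwardAdjunction f).unit.app M).app V).hom
    rw [this, map_zero]
  map_add' x y := by rw [pullbackSection_add, map_add]

lemma pullLE_apply (f : X ⟶ Y) {M : Y.Modules} {V : Y.Opens} {W : X.Opens} (h : W ≤ f ⁻¹ᵁ V)
    (x : Γ(M, V)) : pullLE f h x = ((pullback f).obj M).res h (pullbackSection f x) := rfl

lemma pullLE_smul (f : X ⟶ Y) {M : Y.Modules} {V : Y.Opens} {W : X.Opens} (h : W ≤ f ⁻¹ᵁ V)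
    (c : Γ(Y, V)) (x : Γ(M, V)) : pullLE f h (c • x) = f.appLE V W h c • pullLE f h x := by
  rw [pullLE_apply, pullLE_apply, pullbackSection_smul, res_smul]
  rfl

lemma pullLE_res (f : X ⟶ Y) {M : Y.Modules} {V V' : Y.Opens} {W : X.Opens} (h : W ≤ f ⁻¹ᵁ V')
    (h' : V' ≤ V) (x : Γ(M, V)) :
    pullLE f h (M.res h' x) = pullLE f (h.trans (f.preimage_mono h')) x := by
  rw [pullLE_apply, pullLE_apply, pullbackSection_res, res_res]

lemma res_pullLE (f : X ⟶ Y) {M : Y.Modules} {V : Y.Opens} {W W' : X.Opens} (h : W ≤ f ⁻¹ᵁ V)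
    (h' : W' ≤ W) (x : Γ(M, V)) :
    ((pullback f).obj M).res h' (pullLE f h x) = pullLE f (h'.trans h) x := by
  rw [pullLE_apply, pullLE_apply, res_res]

lemma fres_appLE (f : X ⟶ Y) {V : Y.Opens} {W W' : X.Opens} (h : W ≤ f ⁻¹ᵁ V)
    (h' : W' ≤ W) (c : Γ(Y, V)) :
    fres h' (f.appLE V W h c) = f.appLE V W' (h'.trans h) c := by
  rw [← Scheme.Hom.appLE_map f h (homOfLE h').op]
  rfl

lemma appLE_fres (f : X ⟶ Y) {V V' : Y.Opens} {W : X.Opens} (h : W ≤ f ⁻¹ᵁ V')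
    (h' : V' ≤ V) (c : Γ(Y, V)) :
    f.appLE V' W h (fres h' c) = f.appLE V W (h.trans (f.preimage_mono h')) c := by
  rw [← Scheme.Hom.map_appLE f h (homOfLE h').op]
  rfl

/-- The morphism `f^* M ⟶ N` adjoint to a morphism `M ⟶ f_* N`. -/
def transpose (f : X ⟶ Y) {M : Y.Modules} {N : X.Modules} (g : M ⟶ (pushforward f).obj N) :
    (pullback f).obj M ⟶ N :=
  ((pullbackPushforwardAdjunction f).homEquiv _ _).symm g

lemma transpose_pullbackSection (f : X ⟶ Y) {M : Y.Modules} {N : X.Modules}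
    (g : M ⟶ (pushforward f).obj N) {V : Y.Opens} (x : Γ(M, V)) :
    (transpose f g).app (f ⁻¹ᵁ V) (pullbackSection f x) = g.app V x := by
  have : ((pullbackPushforwardAdjunction f).homEquiv _ _) (transpose f g) = g :=
    Equiv.apply_symm_apply _ _
  rw [Adjunction.homEquiv_unit] at this
  exact congr(Hom.app $this V x)

end AlgebraicGeometry.Scheme.Modules

/-! ### Frames -/

namespace AlgebraicGeometry.Scheme.Modules

variable {X Y Z : Scheme.{u}}

lemma inf_preimage_le (f : X ⟶ Y) (V W : Y.Opens) : f ⁻¹ᵁ V ⊓ f ⁻¹ᵁ W ≤ f ⁻¹ᵁ (V ⊓ W) :=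
  fun _ h => h

/-- Functions as sections of the structure sheaf. -/
def strEquiv (X : Scheme.{u}) (V : X.Opens) : Γ(X, V) ≃+ Γ(structureSheaf X, V) :=
  AddEquiv.refl Γ(X, V)

lemma strEquiv_mul (V : X.Opens) (c x : Γ(X, V)) :
    strEquiv X V (c * x) = c • strEquiv X V x := rfl

lemma strEquiv_symm_smul (V : X.Opens) (c : Γ(X, V)) (x : Γ(structureSheaf X, V)) :
    (strEquiv X V).symm (c • x) = c * (strEquiv X V).symm x := rfl

lemma res_strEquiv {V V' : X.Opens} (h : V' ≤ V) (x : Γ(X, V)) :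
    (structureSheaf X).res h (strEquiv X V x) = strEquiv X V' (fres h x) := rfl

/-- The sections of `f_* M` over `V` are the sections of `M` over `f⁻¹ V`. -/
def pushEquiv (f : X ⟶ Y) (M : X.Modules) (V : Y.Opens) :
    Γ((pushforward f).obj M, V) ≃+ Γ(M, f ⁻¹ᵁ V) :=
  AddEquiv.refl Γ(M, f ⁻¹ᵁ V)

lemma pushEquiv_smul (f : X ⟶ Y) (M : X.Modules) (V : Y.Opens) (c : Γ(Y, V))
    (x : Γ((pushforward f).obj M, V)) :
    pushEquiv f M V (c • x) = f.appLE V (f ⁻¹ᵁ V) le_rfl c • pushEquiv f M V x := by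
  have : f.appLE V (f ⁻¹ᵁ V) le_rfl c = f.app V c := by rw [Scheme.Hom.appLE]; simp
  rw [this]
  rfl

lemma pushEquiv_res (f : X ⟶ Y) (M : X.Modules) {V V' : Y.Opens} (h : V' ≤ V)
    (x : Γ((pushforward f).obj M, V)) :
    pushEquiv f M V' (((pushforward f).obj M).res h x) =
      M.res (f.preimage_mono h) (pushEquiv f M V x) := rfl

/-- Morphisms to `f_* j_* j^* N` from compatible maps to sections of `N` on `f⁻¹ V ∩ W`. -/
def homPushLocMk (f : X ⟶ Y) {M : Y.Modules} {N : X.Modules} {W : X.Opens}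
    (g : ∀ V : Y.Opens, Γ(M, V) → Γ(N, f ⁻¹ᵁ V ⊓ W))
    (hadd : ∀ V x y, g V (x + y) = g V x + g V y)
    (hsmul : ∀ (V) (c : Γ(Y, V)) (x),
      g V (c • x) = f.appLE V (f ⁻¹ᵁ V ⊓ W) inf_le_left c • g V x)
    (hres : ∀ {V V' : Y.Opens} (h : V' ≤ V) (x),
      g V' (M.res h x) = N.res (inf_le_inf_right W (f.preimage_mono h)) (g V x)) :
    M ⟶ (pushforward f).obj (N.localize W) :=
  homMk (fun V x => (pushEquiv f _ V).symm (toLoc N W (f ⁻¹ᵁ V) (g V x)))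
    (fun V x y => by rw [hadd, map_add, map_add])
    (fun V c x => by
      apply (pushEquiv f _ V).injective
      rw [pushEquiv_smul, AddEquiv.apply_symm_apply, AddEquiv.apply_symm_apply,
        hsmul, toLoc_apply, res_smul, toLoc_apply, ← locEquiv_symm_smul, fres_appLE, fres_appLE])
    (fun {V V'} h x => by
      apply (pushEquiv f _ V').injective
      rw [pushEquiv_res, AddEquiv.apply_symm_apply, AddEquiv.apply_symm_apply]
      apply (locEquiv N W _).injective
      rw [hres, locEquiv_res, toLoc_apply, toLoc_apply, AddEquiv.apply_symm_apply,
        AddEquiv.apply_symm_apply, res_res, res_res])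

lemma ofLoc_homPushLocMk (f : X ⟶ Y) {M : Y.Modules} {N : X.Modules} {W : X.Opens}
    (g : ∀ V : Y.Opens, Γ(M, V) → Γ(N, f ⁻¹ᵁ V ⊓ W)) (hadd) (hsmul) (hres)
    {V : Y.Opens} {V' : X.Opens} (h : V' ≤ f ⁻¹ᵁ V) (h' : V' ≤ W) (x : Γ(M, V)) :
    ofLoc h h' (pushEquiv f _ V ((homPushLocMk f g hadd hsmul hres).app V x)) =
      N.res (le_inf h h') (g V x) :=
  ofLoc_toLoc _ _ _

/-- A frame of `M` over `W`: finitely many sections over `W` whose restrictions to every open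
`V ⊆ W` form a basis of the `𝒪(V)`-module `M(V)`. -/
def IsFrame {M : X.Modules} {W : X.Opens} {ι : Type*} [Fintype ι] (τ : ι → Γ(M, W)) : Prop :=
  ∀ (V : X.Opens) (h : V ≤ W),
    Function.Bijective (fun c : ι → Γ(X, V) => ∑ i, c i • M.res h (τ i))

/-- A section over `W` which is a basis of `M` over `W`. -/
def IsGen {M : X.Modules} {W : X.Opens} (m : Γ(M, W)) : Prop :=
  IsFrame (fun _ : Unit => m)

namespace IsFrame

variable {M N : X.Modules} {W : X.Opens} {ι κ : Type*} [Fintype ι] [Fintype κ] {τ : ι → Γ(M, W)}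

lemma res (hτ : IsFrame τ) {V : X.Opens} (h : V ≤ W) : IsFrame (fun i => M.res h (τ i)) := by
  intro V' h'
  simpa using hτ V' (h'.trans h)

/-- The coordinates of a section over `V ⊆ W` with respect to a frame over `W`. -/
def coord (hτ : IsFrame τ) {V : X.Opens} (h : V ≤ W) (x : Γ(M, V)) : ι → Γ(X, V) :=
  (Equiv.ofBijective _ (hτ V h)).symm x

lemma sum_coord (hτ : IsFrame τ) {V : X.Opens} (h : V ≤ W) (x : Γ(M, V)) :
    ∑ i, hτ.coord h x i • M.res h (τ i) = x :=
  (Equiv.ofBijective _ (hτ V h)).apply_symm_apply x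

lemma coord_unique (hτ : IsFrame τ) {V : X.Opens} (h : V ≤ W) {x : Γ(M, V)} {c : ι → Γ(X, V)}
    (hc : ∑ i, c i • M.res h (τ i) = x) : c = hτ.coord h x :=
  ((Equiv.ofBijective _ (hτ V h)).eq_symm_apply).mpr hc

lemma ext (hτ : IsFrame τ) {V : X.Opens} (h : V ≤ W) {c d : ι → Γ(X, V)}
    (hc : ∑ i, c i • M.res h (τ i) = ∑ i, d i • M.res h (τ i)) : c = d :=
  (hτ V h).1 hc

lemma coord_add (hτ : IsFrame τ) {V : X.Opens} (h : V ≤ W) (x y : Γ(M, V)) :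
    hτ.coord h (x + y) = hτ.coord h x + hτ.coord h y := by
  symm
  apply hτ.coord_unique
  simp only [Pi.add_apply, add_smul, Finset.sum_add_distrib, sum_coord]

lemma coord_smul (hτ : IsFrame τ) {V : X.Opens} (h : V ≤ W) (c : Γ(X, V)) (x : Γ(M, V)) :
    hτ.coord h (c • x) = c • hτ.coord h x := by
  symm
  apply hτ.coord_unique
  simp only [Pi.smul_apply, smul_eq_mul, mul_smul, ← Finset.smul_sum, sum_coord]

lemma coord_res (hτ : IsFrame τ) {V V' : X.Opens} (h : V ≤ W) (h' : V' ≤ V) (x : Γ(M, V)) (i : ι) :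
    hτ.coord (h'.trans h) (M.res h' x) i = fres h' (hτ.coord h x i) := by
  symm
  refine congrFun (hτ.coord_unique (c := fun i => fres h' (hτ.coord h x i)) _ ?_) i
  conv_rhs => rw [← hτ.sum_coord h x]
  simp [res_smul]

lemma coord_self [DecidableEq ι] (hτ : IsFrame τ) {V : X.Opens} (h : V ≤ W) (k : ι) :
    hτ.coord h (M.res h (τ k)) = Pi.single k 1 := by
  symm
  apply hτ.coord_unique
  simp [Pi.single_apply]

/-- A change of basis: a family with invertible matrix of coordinates is a frame. -/
lemma of_matrix [DecidableEq ι] [DecidableEq κ] (hτ : IsFrame τ) {σ : κ → Γ(M, W)}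
    (D : κ → ι → Γ(X, W)) (E : ι → κ → Γ(X, W))
    (hσ : ∀ k, σ k = ∑ i, D k i • τ i) (hE : ∀ i, τ i = ∑ k, E i k • σ k)
    (hDE : ∀ k l, ∑ i, D k i * E i l = if k = l then 1 else 0) : IsFrame σ := by
  intro V h
  have hτV : ∀ i, M.res h (τ i) = ∑ k, fres h (E i k) • M.res h (σ k) := by
    intro i; conv_lhs => rw [hE i]
    simp [res_smul]
  have hσV : ∀ i, M.res h (σ i) = ∑ k, fres h (D i k) • M.res h (τ k) := by
    intro i; conv_lhs => rw [hσ i]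
    simp [res_smul]
  refine Function.bijective_iff_has_inverse.mpr
    ⟨fun x k => ∑ i, hτ.coord h x i * fres h (E i k), fun c => ?_, fun x => ?_⟩
  · have : hτ.coord h (∑ k, c k • M.res h (σ k)) = fun i => ∑ k, c k * fres h (D k i) := by
      symm
      apply hτ.coord_unique
      simp_rw [hσV, Finset.smul_sum, Finset.sum_smul]
      rw [Finset.sum_comm]
      simp_rw [mul_smul]
    funext l
    simp only [this, Finset.sum_mul]
    rw [Finset.sum_comm]
    simp_rw [mul_assoc, ← Finset.mul_sum, ← map_mul, ← map_sum, hDE]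
    simp
  · conv_rhs => rw [← hτ.sum_coord h x]
    simp_rw [hτV, Finset.smul_sum, Finset.sum_smul]
    rw [Finset.sum_comm]
    simp_rw [mul_smul]

/-- If `τ` is a frame over `W`, then every basis of the module of sections over `W` is a frame. -/
lemma of_bijective (hτ : IsFrame τ) {σ : κ → Γ(M, W)}
    (hσ : Function.Bijective (fun c : κ → Γ(X, W) => ∑ i, c i • σ i)) : IsFrame σ := by
  classical
  choose E hE using fun i => hσ.2 (τ i)
  have hD : ∀ k, σ k = ∑ i, hτ.coord le_rfl (σ k) i • τ i := by
    intro k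
    conv_lhs => rw [← hτ.sum_coord le_rfl (σ k)]
    simp
  refine hτ.of_matrix (fun k => hτ.coord le_rfl (σ k)) E hD (fun i => (hE i).symm) ?_
  intro k l
  have : (fun l => ∑ i, hτ.coord le_rfl (σ k) i * E i l) = fun l => if k = l then 1 else 0 := by
    apply hσ.1
    simp only [Finset.sum_smul, ite_smul, one_smul, zero_smul, Finset.sum_ite_eq, Finset.mem_univ,
      if_true]
    rw [Finset.sum_comm]
    simp_rw [mul_smul, ← Finset.smul_sum]
    conv_rhs => rw [hD k]
    refine Finset.sum_congr rfl fun i _ => ?_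
    rw [← hE i]
  exact congrFun this l

/-- A square family whose matrix of coordinates has invertible determinant is a frame. -/
lemma of_isUnit_det [DecidableEq ι] (hτ : IsFrame τ) {σ : ι → Γ(M, W)} (D : Matrix ι ι Γ(X, W))
    (hσ : ∀ k, σ k = ∑ i, D k i • τ i) (hD : IsUnit D.det) : IsFrame σ := by
  refine hτ.of_matrix D (D⁻¹ : Matrix ι ι Γ(X, W)) hσ ?_ ?_
  · intro i
    simp_rw [hσ, Finset.smul_sum]
    rw [Finset.sum_comm]
    simp_rw [← mul_smul, ← Finset.sum_smul]
    have : ∀ l, ∑ k, (D⁻¹ : Matrix ι ι Γ(X, W)) i k * D k l = if i = l then 1 else 0 := fun l => by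
      rw [← Matrix.mul_apply, Matrix.nonsing_inv_mul _ hD, Matrix.one_apply]
    simp [this]
  · intro k l
    rw [← Matrix.mul_apply, Matrix.mul_nonsing_inv _ hD, Matrix.one_apply]

/-- Multiplying the members of a frame by units gives a frame. -/
lemma unit_smul (hτ : IsFrame τ) {u : ι → Γ(X, W)} (hu : ∀ i, IsUnit (u i)) :
    IsFrame (fun i => u i • τ i) := by
  intro V h
  have : (fun c : ι → Γ(X, V) => ∑ i, c i • M.res h (u i • τ i)) =
      (fun c : ι → Γ(X, V) => ∑ i, c i • M.res h (τ i)) ∘ (fun c i => c i * fres h (u i)) := by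
    funext c
    simp [res_smul, mul_smul]
  rw [this]
  refine (hτ V h).comp (Function.bijective_iff_has_inverse.mpr
    ⟨fun c i => c i * ↑((hu i).map (fres h)).unit⁻¹, fun c => ?_, fun c => ?_⟩)
  · funext i; simp [mul_assoc]
  · funext i; simp [mul_assoc]

lemma map_iso (hτ : IsFrame τ) (φ : M ≅ N) : IsFrame (fun i => φ.hom.app W (τ i)) := by
  intro V h
  have : (fun c : ι → Γ(X, V) => ∑ i, c i • N.res h (φ.hom.app W (τ i))) =
      (φ.hom.app V) ∘ (fun c : ι → Γ(X, V) => ∑ i, c i • M.res h (τ i)) := by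
    funext c
    simp [app_res, map_sum]
  rw [this]
  exact ((ConcreteCategory.isIso_iff_bijective (φ.hom.app V)).mp inferInstance).comp (hτ V h)

/-- The coordinate function of a frame over `W`, as a morphism `M ⟶ j_* j^* 𝒪`, composed with
the inverse image of functions: a morphism `M ⟶ f_* j_* j^* 𝒪`. -/
def coordHom {M : Y.Modules} {W : Y.Opens} {τ : ι → Γ(M, W)} (hτ : IsFrame τ) (f : X ⟶ Y) (i : ι) :
    M ⟶ (pushforward f).obj ((structureSheaf X).localize (f ⁻¹ᵁ W)) :=
  homPushLocMk f (fun V x => strEquiv X _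
      (f.appLE (V ⊓ W) (f ⁻¹ᵁ V ⊓ f ⁻¹ᵁ W) (inf_preimage_le f V W)
        (hτ.coord inf_le_right (M.res inf_le_left x) i)))
    (fun V x y => by rw [map_add, coord_add, Pi.add_apply, map_add, map_add])
    (fun V c x => by
      rw [res_smul, coord_smul, Pi.smul_apply, smul_eq_mul, map_mul, appLE_fres, strEquiv_mul])
    (fun {V V'} h x => by
      have h1 := hτ.coord_res (V' := V' ⊓ W) inf_le_right (inf_le_inf_right W h)
        (M.res inf_le_left x) i
      rw [res_res] at h1
      rw [res_res, h1, appLE_fres, res_strEquiv, fres_appLE])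

lemma ofLoc_coordHom {M : Y.Modules} {W : Y.Opens} {τ : ι → Γ(M, W)} (hτ : IsFrame τ)
    (f : X ⟶ Y) (i : ι) {V : Y.Opens} {V' : X.Opens} (h : V' ≤ f ⁻¹ᵁ V) (h' : V' ≤ f ⁻¹ᵁ W)
    (x : Γ(M, V)) :
    ofLoc (M := structureSheaf X) h h' (pushEquiv f _ _ ((hτ.coordHom f i).app V x)) =
      strEquiv X V' (f.appLE (V ⊓ W) V' ((le_inf h h').trans (inf_preimage_le f V W))
        (hτ.coord inf_le_right (M.res inf_le_left x) i)) := by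
  rw [coordHom, ofLoc_homPushLocMk, res_strEquiv, fres_appLE]

end IsFrame
end AlgebraicGeometry.Scheme.Modules

/-! ### Inverse images of frames; generators -/

namespace AlgebraicGeometry.Scheme.Modules

variable {X Y Z : Scheme.{u}}

namespace IsFrame

variable {ι κ : Type*} [Fintype ι] [Fintype κ]
variable {M : Y.Modules} {W : Y.Opens} {τ : ι → Γ(M, W)}

/-- The coordinates, with respect to the inverse image of a frame, of sections of `f^* M`. -/
def pullCoord (hτ : IsFrame τ) (f : X ⟶ Y) (i : ι) {V : X.Opens} (h : V ≤ f ⁻¹ᵁ W)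
    (y : Γ((pullback f).obj M, V)) : Γ(X, V) :=
  (strEquiv X V).symm (ofLoc (M := structureSheaf X) le_rfl h
    ((transpose f (hτ.coordHom f i)).app V y))

lemma pullCoord_add (hτ : IsFrame τ) (f : X ⟶ Y) (i : ι) {V : X.Opens} (h : V ≤ f ⁻¹ᵁ W)
    (y z : Γ((pullback f).obj M, V)) :
    hτ.pullCoord f i h (y + z) = hτ.pullCoord f i h y + hτ.pullCoord f i h z := by
  simp only [pullCoord, map_add]

lemma pullCoord_smul (hτ : IsFrame τ) (f : X ⟶ Y) (i : ι) {V : X.Opens} (h : V ≤ f ⁻¹ᵁ W)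
    (c : Γ(X, V)) (y : Γ((pullback f).obj M, V)) :
    hτ.pullCoord f i h (c • y) = c * hτ.pullCoord f i h y := by
  simp only [pullCoord, Hom.app_smul, ofLoc_smul, fres_self, strEquiv_symm_smul]

lemma pullCoord_res (hτ : IsFrame τ) (f : X ⟶ Y) (i : ι) {V V' : X.Opens} (h : V ≤ f ⁻¹ᵁ W)
    (h' : V' ≤ V) (y : Γ((pullback f).obj M, V)) :
    hτ.pullCoord f i (h'.trans h) (((pullback f).obj M).res h' y) =
      fres h' (hτ.pullCoord f i h y) := by
  apply (strEquiv X V').injective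
  rw [← res_strEquiv, pullCoord, pullCoord, AddEquiv.apply_symm_apply, AddEquiv.apply_symm_apply,
    app_res, ofLoc_res, ofLoc_apply, ofLoc_apply, res_res]

lemma pullCoord_pullLE (hτ : IsFrame τ) (f : X ⟶ Y) (i : ι) {V : Y.Opens} {V' : X.Opens}
    (h : V' ≤ f ⁻¹ᵁ W) (h' : V' ≤ f ⁻¹ᵁ V) (x : Γ(M, V)) :
    hτ.pullCoord f i h (pullLE f h' x) =
      f.appLE (V ⊓ W) V' ((le_inf h' h).trans (inf_preimage_le f V W))
        (hτ.coord inf_le_right (M.res inf_le_left x) i) := by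
  apply (strEquiv X V').injective
  rw [pullCoord, AddEquiv.apply_symm_apply, pullLE_apply, app_res, ofLoc_res,
    transpose_pullbackSection]
  exact hτ.ofLoc_coordHom f i h' h x

/-- The inverse image of a frame spans. The coordinates `pullCoord` are transposes, so that the two
sides are the values of two morphisms from `f^* M` to `j_* j^* f^* M`, where `j` is the inclusion of
`f⁻¹ W`; such morphisms agree as soon as they agree on inverse images of sections. -/
lemma sum_pullCoord (hτ : IsFrame τ) (f : X ⟶ Y) {V : X.Opens} (h : V ≤ f ⁻¹ᵁ W)
    (y : Γ((pullback f).obj M, V)) :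
    ∑ i, hτ.pullCoord f i h y • pullLE f h (τ i) = y := by
  let Φ : (pullback f).obj M ⟶ ((pullback f).obj M).localize (f ⁻¹ᵁ W) :=
    homLocMk (fun V y => ∑ i, hτ.pullCoord f i (inf_le_right : V ⊓ f ⁻¹ᵁ W ≤ _)
        (((pullback f).obj M).res inf_le_left y) • pullLE f inf_le_right (τ i))
      (fun V x y => by simp only [map_add, pullCoord_add, add_smul, Finset.sum_add_distrib])
      (fun V c x => by simp only [res_smul, pullCoord_smul, mul_smul, Finset.smul_sum])
      (fun {V V'} h x => by
        rw [map_sum]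
        refine Finset.sum_congr rfl fun i _ => ?_
        rw [res_smul, res_pullLE, res_res, ← hτ.pullCoord_res f i inf_le_right
          (inf_le_inf_right _ h), res_res])
  let Ψ : (pullback f).obj M ⟶ ((pullback f).obj M).localize (f ⁻¹ᵁ W) :=
    homLocMk (fun V y => ((pullback f).obj M).res inf_le_left y)
      (fun V x y => map_add _ _ _)
      (fun V c x => res_smul _ _ _)
      (fun {V V'} h x => by rw [res_res, res_res])
  have key : Φ = Ψ := by
    apply pullback_hom_ext
    intro U x
    apply localize_ext
    rw [ofLoc_homLocMk, ofLoc_homLocMk, map_sum]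
    simp only [res_smul, res_pullLE, res_res]
    have h1 : ((pullback f).obj M).res (inf_le_left : f ⁻¹ᵁ U ⊓ f ⁻¹ᵁ W ≤ _) (pullbackSection f x) =
        pullLE f ((inf_preimage_le f U W).trans (f.preimage_mono inf_le_left)) x := rfl
    rw [h1]
    simp only [hτ.pullCoord_pullLE, fres_appLE]
    have h2 := congrArg (pullLE f (inf_preimage_le f U W))
      (hτ.sum_coord inf_le_right (M.res (inf_le_left : U ⊓ W ≤ U) x))
    rw [pullLE_res, map_sum] at h2
    rw [← h2]
    refine Finset.sum_congr rfl fun i _ => ?_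
    rw [pullLE_smul, pullLE_res]
  have h1 := congrArg (ofLoc le_rfl h) (congr(Hom.app $key V y))
  rw [ofLoc_homLocMk, ofLoc_homLocMk, map_sum] at h1
  simp only [res_smul, res_pullLE, res_res, res_self] at h1
  refine Eq.trans (Finset.sum_congr rfl fun i _ => ?_) h1
  congr 1
  rw [← hτ.pullCoord_res f i inf_le_right (le_inf le_rfl h), res_res, res_self]

/-- Frames are stable under inverse image. -/
lemma pullLE (hτ : IsFrame τ) (f : X ⟶ Y) {W' : X.Opens} (h : W' ≤ f ⁻¹ᵁ W) :
    IsFrame (fun i => Modules.pullLE f h (τ i)) := by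
  classical
  intro V h'
  simp only [res_pullLE]
  refine Function.bijective_iff_has_inverse.mpr
    ⟨fun y i => hτ.pullCoord f i (h'.trans h) y, fun c => ?_,
      fun y => hτ.sum_pullCoord f (h'.trans h) y⟩
  funext i
  have hadd : ∀ (s : Finset ι) (g : ι → Γ((pullback f).obj M, V)),
      hτ.pullCoord f i (h'.trans h) (∑ k ∈ s, g k) =
        ∑ k ∈ s, hτ.pullCoord f i (h'.trans h) (g k) := fun s g =>
    map_sum (AddMonoidHom.mk' (hτ.pullCoord f i (h'.trans h)) (hτ.pullCoord_add f i _)) g s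
  have h1 : ∀ k, hτ.pullCoord f i (h'.trans h) (Modules.pullLE f (h'.trans h) (τ k)) =
      if k = i then 1 else 0 := by
    intro k
    rw [hτ.pullCoord_pullLE, hτ.coord_self, Pi.single_apply]
    simp only [eq_comm (a := i)]
    split_ifs <;> simp
  simp only [hadd, pullCoord_smul, h1]
  simp

end IsFrame

lemma IsGen.bijective {M : X.Modules} {W : X.Opens} {m : Γ(M, W)} (hm : IsGen m) {V : X.Opens}
    (h : V ≤ W) : Function.Bijective (fun c : Γ(X, V) => c • M.res h m) := by
  have := (hm V h).comp (Equiv.funUnique Unit Γ(X, V)).symm.bijective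
  convert this using 2
  simp

lemma isGen_of_bijective {M : X.Modules} {W : X.Opens} {m : Γ(M, W)}
    (hm : ∀ (V : X.Opens) (h : V ≤ W), Function.Bijective (fun c : Γ(X, V) => c • M.res h m)) :
    IsGen m := by
  intro V h
  have := (hm V h).comp (Equiv.funUnique Unit Γ(X, V)).bijective
  convert this using 2
  simp

lemma IsGen.res {M : X.Modules} {W V : X.Opens} {m : Γ(M, W)} (hm : IsGen m) (h : V ≤ W) :
    IsGen (M.res h m) := IsFrame.res hm h

lemma IsGen.pullLE {M : Y.Modules} {W : Y.Opens} {m : Γ(M, W)} (hm : IsGen m) (f : X ⟶ Y)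
    {V : X.Opens} (h : V ≤ f ⁻¹ᵁ W) : IsGen (Modules.pullLE f h m) := IsFrame.pullLE hm f h

lemma IsGen.map_iso {M N : X.Modules} {W : X.Opens} {m : Γ(M, W)} (hm : IsGen m) (φ : M ≅ N) :
    IsGen (φ.hom.app W m) := IsFrame.map_iso hm φ

lemma IsGen.exists_smul {M : X.Modules} {W V : X.Opens} {m : Γ(M, W)} (hm : IsGen m) (h : V ≤ W)
    (x : Γ(M, V)) : ∃ c : Γ(X, V), x = c • M.res h m := by
  obtain ⟨c, hc⟩ := (hm.bijective h).2 x
  exact ⟨c, hc.symm⟩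

lemma IsGen.smul_inj {M : X.Modules} {W : X.Opens} {m : Γ(M, W)} (hm : IsGen m)
    {c d : Γ(X, W)} (h : c • m = d • m) : c = d := by
  apply (hm.bijective le_rfl).1
  simpa using h

lemma IsGen.unit_smul {M : X.Modules} {W : X.Opens} {m : Γ(M, W)} (hm : IsGen m)
    {c : Γ(X, W)} (hc : IsUnit c) : IsGen (c • m) := IsFrame.unit_smul hm fun _ => hc

lemma IsGen.isUnit {M : X.Modules} {W : X.Opens} {m : Γ(M, W)} (hm : IsGen m)
    {c : Γ(X, W)} (hc : IsGen (c • m)) : IsUnit c := by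
  obtain ⟨d, hd⟩ := hc.exists_smul le_rfl m
  rw [res_self, ← mul_smul] at hd
  have : (1 : Γ(X, W)) = d * c := hm.smul_inj (by rw [one_smul]; exact hd)
  exact IsUnit.of_mul_eq_one d (by rw [mul_comm]; exact this.symm)

lemma isGen_one (V : X.Opens) : IsGen (strEquiv X V 1) := by
  apply isGen_of_bijective
  intro V' h
  have : (fun c : Γ(X, V') => c • (structureSheaf X).res h (strEquiv X V 1)) = strEquiv X V' := by
    funext c
    rw [res_strEquiv, map_one, ← strEquiv_mul, mul_one]
  rw [this]
  exact (strEquiv X V').bijective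

/-- The morphism `𝒪 ⟶ M`, `a ↦ a m`. -/
def smulHom {M : X.Modules} (m : Γ(M, ⊤)) : structureSheaf X ⟶ M :=
  homMk (fun V x => (strEquiv X V).symm x • M.res le_top m)
    (fun V x y => by rw [map_add, add_smul])
    (fun V c x => by rw [strEquiv_symm_smul, mul_smul])
    (fun h x => by
      rw [res_smul, res_res]
      rfl)

lemma smulHom_app {M : X.Modules} (m : Γ(M, ⊤)) {V : X.Opens} (x : Γ(structureSheaf X, V)) :
    (smulHom m).app V x = (strEquiv X V).symm x • M.res le_top m := rfl

/-- Two modules with global generators are isomorphic. -/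
lemma IsGen.exists_iso {M N : X.Modules} {m : Γ(M, ⊤)} {n : Γ(N, ⊤)} (hm : IsGen m)
    (hn : IsGen n) : ∃ φ : M ≅ N, φ.hom.app ⊤ m = n := by
  have key : ∀ {N : X.Modules} {n : Γ(N, ⊤)}, IsGen n → IsIso (smulHom n) := by
    intro N n hn
    apply isIso_of_bijective
    intro V
    exact (hn.bijective (le_top : V ≤ ⊤)).comp (strEquiv X V).symm.bijective
  have := key hm
  have := key hn
  refine ⟨(asIso (smulHom m)).symm ≪≫ asIso (smulHom n), ?_⟩
  have h1 : (smulHom m).app ⊤ (strEquiv X ⊤ 1) = m := by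
    rw [smulHom_app, AddEquiv.symm_apply_apply, one_smul, res_self]
  have h2 : (smulHom n).app ⊤ (strEquiv X ⊤ 1) = n := by
    rw [smulHom_app, AddEquiv.symm_apply_apply, one_smul, res_self]
  have h3 : (inv (smulHom m)).app ⊤ m = strEquiv X ⊤ 1 :=
    (congrArg ((inv (smulHom m)).app ⊤) h1.symm).trans
      congr(Hom.app $(IsIso.hom_inv_id (smulHom m)) ⊤ (strEquiv X ⊤ 1))
  change (smulHom n).app ⊤ ((inv (smulHom m)).app ⊤ m) = n
  rw [h3, h2]

/-- Two morphisms agree if they agree on a generator. -/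
lemma IsGen.hom_ext {M N : X.Modules} {m : Γ(M, ⊤)} (hm : IsGen m) {φ ψ : M ⟶ N}
    (h : φ.app ⊤ m = ψ.app ⊤ m) : φ = ψ := by
  apply hom_ext_apply
  intro V x
  obtain ⟨c, rfl⟩ := hm.exists_smul le_top x
  rw [Hom.app_smul, Hom.app_smul, app_res, app_res, h]

end AlgebraicGeometry.Scheme.Modules

/-! ### Locally free and invertible sheaves in terms of frames -/

namespace AlgebraicGeometry.Scheme.Modules

variable {X Y Z : Scheme.{u}}

/-- The sections of the restriction of `M` to an open subscheme. -/
def restrictEquiv (M : X.Modules) (U : X.Opens) (V : (U : Scheme.{u}).Opens) :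
    Γ(M.restrict U.ι, V) ≃+ Γ(M, U.ι ''ᵁ V) :=
  AddEquiv.refl Γ(M, U.ι ''ᵁ V)

lemma restrictEquiv_smul (M : X.Modules) (U : X.Opens) (V : (U : Scheme.{u}).Opens)
    (c : Γ(X, U.ι ''ᵁ V)) (x : Γ(M.restrict U.ι, V)) :
    restrictEquiv M U V ((show Γ(U, V) from c) • x) = c • restrictEquiv M U V x := by
  have h : (U.ι.appIso V).inv c = c := by
    rw [Opens.ι_appIso]
    rfl
  conv_rhs => rw [← h]
  rfl

lemma restrictEquiv_res (M : X.Modules) (U : X.Opens) {V V' : (U : Scheme.{u}).Opens} (h : V' ≤ V)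
    (x : Γ(M.restrict U.ι, V)) :
    restrictEquiv M U V' ((M.restrict U.ι).res h x) =
      M.res (U.ι.image_mono h) (restrictEquiv M U V x) := rfl

lemma le_ι_image_top (U : X.Opens) : U ≤ U.ι ''ᵁ ⊤ := fun x hx => ⟨⟨x, hx⟩, trivial, rfl⟩

lemma ι_image_le (U : X.Opens) (V : (U : Scheme.{u}).Opens) : U.ι ''ᵁ V ≤ U := by
  rintro _ ⟨x, -, rfl⟩
  exact x.2

lemma bijective_congr {α β : Type*} {f g : α → β} (h : ∀ a, f a = g a)
    (hg : Function.Bijective g) : Function.Bijective f := by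
  rwa [funext h]

/-- A frame of the restriction of `M` to the open subscheme `U` is a frame of `M` over `U`. -/
lemma isFrame_of_restrict {M : X.Modules} {U : X.Opens} {ι : Type*} [Fintype ι]
    {τ : ι → Γ(M.restrict U.ι, ⊤)} (hτ : IsFrame τ) :
    IsFrame (fun i => M.res (le_ι_image_top U) (restrictEquiv M U ⊤ (τ i))) := by
  intro V h
  have hV : U.ι ''ᵁ (U.ι ⁻¹ᵁ V) = V := le_antisymm (ι_image_preimage_le_left U V)
    (le_ι_image_preimage le_rfl h)
  have := (restrictEquiv M U _).bijective.comp (hτ (U.ι ⁻¹ᵁ V) le_top)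
  have h2 : ∀ (V' : X.Opens) (_ : V' = V) (h' : V' ≤ U.ι ''ᵁ ⊤),
      Function.Bijective (fun c : ι → Γ(X, V') =>
        ∑ i, c i • M.res h' (restrictEquiv M U ⊤ (τ i))) →
      Function.Bijective (fun c : ι → Γ(X, V) =>
        ∑ i, c i • M.res h (M.res (le_ι_image_top U) (restrictEquiv M U ⊤ (τ i)))) := by
    rintro _ rfl h' hb
    simpa using hb
  refine h2 _ hV (U.ι.image_mono le_top) ?_
  refine bijective_congr (fun c => ?_) this
  refine Eq.trans ?_ (map_sum (restrictEquiv M U (U.ι ⁻¹ᵁ V)) _ _).symm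
  refine Finset.sum_congr rfl fun i _ => ?_
  exact (restrictEquiv_smul M U _ _ _).symm

/-- A frame of `M` over `U` is a frame of the restriction of `M` to the open subscheme `U`. -/
lemma isFrame_restrict {M : X.Modules} {U : X.Opens} {ι : Type*} [Fintype ι]
    {τ : ι → Γ(M, U)} (hτ : IsFrame τ) :
    IsFrame (fun i => (restrictEquiv M U ⊤).symm (M.res (ι_image_le U ⊤) (τ i))) := by
  intro V h
  have := (restrictEquiv M U V).symm.bijective.comp (hτ (U.ι ''ᵁ V) (ι_image_le U V))
  refine bijective_congr (fun c => ?_) this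
  apply (restrictEquiv M U V).injective
  refine Eq.trans ?_ ((restrictEquiv M U V).apply_symm_apply _).symm
  rw [map_sum]
  refine Finset.sum_congr rfl fun i _ => ?_
  refine (restrictEquiv_smul M U _ _ _).trans ?_
  rw [restrictEquiv_res, AddEquiv.apply_symm_apply, res_res]

lemma isGen_structureSheaf_iso {M : X.Modules} (φ : structureSheaf X ≅ M) :
    IsGen (φ.hom.app ⊤ (strEquiv X ⊤ 1)) := (isGen_one ⊤).map_iso φ

/-- A decomposition of `M` as a direct sum of copies of `𝒪`, given by injections `q` and
projections `p`, yields a frame of `M`. -/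
lemma isFrame_of_biproduct {M : X.Modules} {ι : Type*} [Fintype ι] [DecidableEq ι]
    (p : ι → (M ⟶ structureSheaf X)) (q : ι → (structureSheaf X ⟶ M))
    (hqp : ∀ i j, q i ≫ p j = if i = j then 𝟙 _ else 0) (hsum : ∑ i, p i ≫ q i = 𝟙 M) :
    IsFrame (fun i => (q i).app ⊤ (strEquiv X ⊤ 1)) := by
  intro V h
  have hq : ∀ i (c : Γ(X, V)), c • M.res h ((q i).app ⊤ (strEquiv X ⊤ 1)) =
      (q i).app V (strEquiv X V c) := by
    intro i c
    rw [← app_res, res_strEquiv, map_one, ← Hom.app_smul, ← strEquiv_mul, mul_one]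
  simp only [hq]
  refine Function.bijective_iff_has_inverse.mpr
    ⟨fun y i => (strEquiv X V).symm ((p i).app V y), fun c => ?_, fun y => ?_⟩
  · funext j
    have h1 : ∀ i, (p j).app V ((q i).app V (strEquiv X V (c i))) =
        if i = j then strEquiv X V (c i) else 0 := by
      intro i
      have := congr(Hom.app $(hqp i j) V (strEquiv X V (c i)))
      refine Eq.trans this ?_
      split_ifs <;> rfl
    have h2 : (p j).app V (∑ i, (q i).app V (strEquiv X V (c i))) =
        ∑ i, (p j).app V ((q i).app V (strEquiv X V (c i))) :=
      map_sum ((p j).app V).hom _ _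
    refine (congrArg (strEquiv X V).symm (h2.trans (Finset.sum_congr rfl fun i _ => h1 i))).trans ?_
    simp
  · have h1 : ∀ (s : Finset ι), ∑ i ∈ s, (q i).app V ((p i).app V y) =
        (∑ i ∈ s, p i ≫ q i).app V y := by
      intro s
      induction s using Finset.induction_on with
      | empty => rfl
      | insert a s ha ih =>
        rw [Finset.sum_insert ha, Finset.sum_insert ha, ih]
        rfl
    simp only [AddEquiv.apply_symm_apply, h1, hsum]
    rfl

lemma IsFreeOfRank.exists_isFrame {M : X.Modules} {n : ℕ} (h : M.IsFreeOfRank n) :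
    ∃ τ : Fin n → Γ(M, ⊤), IsFrame τ := by
  obtain ⟨e⟩ := h
  have : Limits.HasFiniteBiproducts X.Modules := Abelian.hasFiniteBiproducts
  let e' : M ≅ ⨁ fun _ : Fin n => structureSheaf X :=
    e ≪≫ (Limits.biproduct.isoCoproduct _).symm
  refine ⟨_, isFrame_of_biproduct (fun i => e'.hom ≫ Limits.biproduct.π _ i)
    (fun i => Limits.biproduct.ι (fun _ : Fin n => structureSheaf X) i ≫ e'.inv) ?_ ?_⟩
  · intro i j
    simp only [Category.assoc, e'.inv_hom_id_assoc, Limits.biproduct.ι_π]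
    split_ifs <;> simp
  · simp only [Category.assoc]
    rw [← Preadditive.comp_sum]
    simp only [← Category.assoc, ← Preadditive.sum_comp]
    rw [Limits.biproduct.total]
    simp

lemma IsLocallyFree.exists_isFrame {M : X.Modules} (h : M.IsLocallyFree) (x : X) :
    ∃ U : X.Opens, x ∈ U ∧ ∃ (n : ℕ) (τ : Fin n → Γ(M, U)), IsFrame τ := by
  obtain ⟨U, hx, n, hU⟩ := h x
  obtain ⟨τ, hτ⟩ := hU.exists_isFrame
  exact ⟨U, hx, n, _, isFrame_of_restrict hτ⟩

lemma IsInvertible.exists_isGen {M : X.Modules} (h : M.IsInvertible) (x : X) :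
    ∃ U : X.Opens, x ∈ U ∧ ∃ m : Γ(M, U), IsGen m := by
  obtain ⟨U, hx, ⟨e⟩⟩ := h x
  exact ⟨U, hx, _, isFrame_of_restrict (isGen_structureSheaf_iso e.symm)⟩

lemma isInvertible_of_exists_isGen {M : X.Modules}
    (h : ∀ x, ∃ U : X.Opens, x ∈ U ∧ ∃ m : Γ(M, U), IsGen m) : M.IsInvertible := by
  intro x
  obtain ⟨U, hx, m, hm⟩ := h x
  refine ⟨U, hx, ?_⟩
  have h1 : IsGen ((restrictEquiv M U ⊤).symm (M.res (ι_image_le U ⊤) m)) := isFrame_restrict hm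
  obtain ⟨φ, -⟩ := h1.exists_iso (isGen_one (X := (U : Scheme.{u})) ⊤)
  exact ⟨φ⟩

lemma IsInvertible.isLocallyFree {M : X.Modules} (h : M.IsInvertible) : M.IsLocallyFree := by
  intro x
  obtain ⟨U, hx, ⟨e⟩⟩ := h x
  exact ⟨U, hx, 1, ⟨e ≪≫ (Limits.coproductUniqueIso fun _ : Fin 1 => structureSheaf U).symm⟩⟩

end AlgebraicGeometry.Scheme.Modules

/-! ### Inverse images of sections on a stack, images of idempotents -/

namespace AlgebraicGeometry.Scheme.Modules

variable {X Y Z : Scheme.{u}}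

lemma map_pullLE (f : X ⟶ Y) {M N : Y.Modules} (α : M ⟶ N) {V : Y.Opens} {W : X.Opens}
    (h : W ≤ f ⁻¹ᵁ V) (x : Γ(M, V)) :
    ((pullback f).map α).app W (pullLE f h x) = pullLE f h (α.app V x) := by
  rw [pullLE_apply, pullLE_apply, app_res, pullback_map_pullbackSection]

lemma pullbackComp_pullLE (f : X ⟶ Y) (g : Y ⟶ Z) {M : Z.Modules} {V : Z.Opens} {V' : Y.Opens}
    {W : X.Opens} (h : W ≤ f ⁻¹ᵁ V') (h' : V' ≤ g ⁻¹ᵁ V) (h'' : W ≤ (f ≫ g) ⁻¹ᵁ V) (x : Γ(M, V)) :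
    ((pullbackComp f g).hom.app M).app W (pullLE f h (pullLE g h' x)) = pullLE (f ≫ g) h'' x := by
  rw [pullLE_apply g, pullLE_res, pullLE_apply, pullLE_apply]
  refine (app_res ((pullbackComp f g).hom.app M) h'' _).trans ?_
  exact congrArg _ (pullbackComp_pullbackSection f g x)

lemma pullbackCongr_pullLE {f g : X ⟶ Y} (e : f = g) {M : Y.Modules} {V : Y.Opens} {W : X.Opens}
    (h : W ≤ f ⁻¹ᵁ V) (h' : W ≤ g ⁻¹ᵁ V) (x : Γ(M, V)) :
    ((pullbackCongr e).hom.app M).app W (pullLE f h x) = pullLE g h' x := by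
  subst e
  rfl

lemma pullbackId_pullLE {M : X.Modules} {V W : X.Opens} (h : W ≤ (𝟙 X : X ⟶ X) ⁻¹ᵁ V)
    (h' : W ≤ V) (x : Γ(M, V)) :
    ((pullbackId X).hom.app M).app W (pullLE (𝟙 X) h x) = M.res h' x := by
  rw [pullLE_apply, app_res]
  exact congrArg (M.res h') (pullbackId_pullbackSection x)

/-- The projection of a section onto a member of a frame only depends on the line spanned by
this member, and on the complementary lines. -/
lemma IsFrame.coord_smul_eq {M : X.Modules} {W V : X.Opens} {ι : Type*} [Fintype ι]
    {τ τ' : ι → Γ(M, W)} (hτ : IsFrame τ) (hτ' : IsFrame τ')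
    (hc : ∀ i, ∃ c : Γ(X, W), τ' i = c • τ i)
    (h : V ≤ W) (x : Γ(M, V)) (i : ι) :
    hτ'.coord h x i • M.res h (τ' i) = hτ.coord h x i • M.res h (τ i) := by
  choose c hc using hc
  have : (fun i => hτ'.coord h x i * fres h (c i)) = hτ.coord h x := by
    apply hτ.coord_unique
    conv_rhs => rw [← hτ'.sum_coord h x]
    refine Finset.sum_congr rfl fun i _ => ?_
    rw [hc i, res_smul, mul_smul]
  rw [← this, hc i, res_smul, mul_smul]

end AlgebraicGeometry.Scheme.Modules

namespace AlgebraicGeometry.StackVect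
open Scheme.Modules

variable {𝒳 : Type w} [Category.{v} 𝒳] {p : 𝒳 ⥤ Scheme.{u}} (F : StackVect p)

/-- The inverse image of sections of `F η` under an arrow `ξ ⟶ η`, as sections of `F ξ`. -/
def pull {ξ η : 𝒳} (a : ξ ⟶ η) {V : (p.obj η).Opens} {W : (p.obj ξ).Opens}
    (h : W ≤ p.map a ⁻¹ᵁ V) : Γ(F.obj η, V) →+ Γ(F.obj ξ, W) :=
  ((F.map a).inv.app W).hom.comp (pullLE (p.map a) h)

variable {ξ η ζ : 𝒳}

lemma pull_apply (a : ξ ⟶ η) {V : (p.obj η).Opens} {W : (p.obj ξ).Opens}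
    (h : W ≤ p.map a ⁻¹ᵁ V) (x : Γ(F.obj η, V)) :
    F.pull a h x = (F.map a).inv.app W (pullLE (p.map a) h x) := rfl

lemma map_hom_pull (a : ξ ⟶ η) {V : (p.obj η).Opens} {W : (p.obj ξ).Opens}
    (h : W ≤ p.map a ⁻¹ᵁ V) (x : Γ(F.obj η, V)) :
    (F.map a).hom.app W (F.pull a h x) = pullLE (p.map a) h x :=
  congr(Hom.app $((F.map a).inv_hom_id) W (pullLE (p.map a) h x))

lemma map_hom_injective (a : ξ ⟶ η) (W : (p.obj ξ).Opens) :
    Function.Injective ((F.map a).hom.app W) :=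
  ((ConcreteCategory.isIso_iff_bijective _).mp inferInstance).1

lemma pull_smul (a : ξ ⟶ η) {V : (p.obj η).Opens} {W : (p.obj ξ).Opens}
    (h : W ≤ p.map a ⁻¹ᵁ V) (c : Γ(p.obj η, V)) (x : Γ(F.obj η, V)) :
    F.pull a h (c • x) = (p.map a).appLE V W h c • F.pull a h x := by
  rw [pull_apply, pullLE_smul, Hom.app_smul, pull_apply]

lemma res_pull (a : ξ ⟶ η) {V : (p.obj η).Opens} {W W' : (p.obj ξ).Opens}
    (h : W ≤ p.map a ⁻¹ᵁ V) (h' : W' ≤ W) (x : Γ(F.obj η, V)) :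
    (F.obj ξ).res h' (F.pull a h x) = F.pull a (h'.trans h) x := by
  rw [pull_apply, ← app_res, res_pullLE, pull_apply]

lemma pull_res (a : ξ ⟶ η) {V V' : (p.obj η).Opens} {W : (p.obj ξ).Opens}
    (h : W ≤ p.map a ⁻¹ᵁ V') (h' : V' ≤ V) (x : Γ(F.obj η, V)) :
    F.pull a h ((F.obj η).res h' x) = F.pull a (h.trans ((p.map a).preimage_mono h')) x := by
  rw [pull_apply, pullLE_res, pull_apply]

lemma pull_pull (a : ξ ⟶ η) (b : η ⟶ ζ) {V : (p.obj ζ).Opens} {V' : (p.obj η).Opens}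
    {W : (p.obj ξ).Opens} (h : W ≤ p.map a ⁻¹ᵁ V') (h' : V' ≤ p.map b ⁻¹ᵁ V)
    (h'' : W ≤ p.map (a ≫ b) ⁻¹ᵁ V) (x : Γ(F.obj ζ, V)) :
    F.pull a h (F.pull b h' x) = F.pull (a ≫ b) h'' x := by
  apply F.map_hom_injective (a ≫ b)
  rw [map_hom_pull, F.map_comp]
  have h3 : W ≤ (p.map a ≫ p.map b) ⁻¹ᵁ V := h.trans ((p.map a).preimage_mono h')
  rw [comp_app_apply, comp_app_apply, comp_app_apply, map_hom_pull, map_pullLE, map_hom_pull,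
    pullbackComp_pullLE _ _ _ _ h3,
    pullbackCongr_pullLE]

lemma pull_id {V W : (p.obj ξ).Opens} (h : W ≤ V) (h' : W ≤ p.map (𝟙 ξ) ⁻¹ᵁ V)
    (x : Γ(F.obj ξ, V)) : F.pull (𝟙 ξ) h' x = (F.obj ξ).res h x := by
  apply F.map_hom_injective (𝟙 ξ)
  have h3 : W ≤ (𝟙 (p.obj ξ) : p.obj ξ ⟶ p.obj ξ) ⁻¹ᵁ V := h
  rw [map_hom_pull, F.map_id, ← pullbackId_pullLE h3]
  refine Eq.trans ?_ (congrArg (((pullbackCongr (p.map_id ξ).symm).hom.app (F.obj ξ)).app W)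
    (congr(Hom.app $((pullbackId (p.obj ξ)).hom_inv_id_app (F.obj ξ)) W
      (pullLE (𝟙 _) h3 x)))).symm
  exact (pullbackCongr_pullLE (p.map_id ξ).symm h3 h' x).symm

lemma isFrame_pull {ι : Type*} [Fintype ι] (a : ξ ⟶ η) {V : (p.obj η).Opens} {W : (p.obj ξ).Opens}
    (h : W ≤ p.map a ⁻¹ᵁ V) {τ : ι → Γ(F.obj η, V)} (hτ : IsFrame τ) :
    IsFrame (fun i => F.pull a h (τ i)) :=
  (hτ.pullLE (p.map a) h).map_iso (F.map a).symm

section Splitting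

/-- The sheaf of images of an idempotent endomorphism of a locally free sheaf on a stack; the
images, split by `inc` and `ret`, are assumed to be locally free. -/
def splitting (Q : ∀ ξ, (p.obj ξ).Modules) (inc : ∀ ξ, Q ξ ⟶ F.obj ξ) (ret : ∀ ξ, F.obj ξ ⟶ Q ξ)
    (hir : ∀ ξ, inc ξ ≫ ret ξ = 𝟙 _) (hQ : ∀ ξ, (Q ξ).IsLocallyFree)
    (he : ∀ {ξ η : 𝒳} (a : ξ ⟶ η), (ret ξ ≫ inc ξ) ≫ (F.map a).hom =
      (F.map a).hom ≫ (pullback (p.map a)).map (ret η ≫ inc η)) : StackVect p where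
  obj := Q
  isLocallyFree := hQ
  map {ξ η} a :=
    { hom := inc ξ ≫ (F.map a).hom ≫ (pullback (p.map a)).map (ret η)
      inv := (pullback (p.map a)).map (inc η) ≫ (F.map a).inv ≫ ret ξ
      hom_inv_id := by
        have h := he a
        simp only [Category.assoc]
        rw [← Functor.map_comp_assoc, ← reassoc_of% h]
        simp [hir]
      inv_hom_id := by
        have h := he a
        simp only [Category.assoc] at h ⊢
        rw [reassoc_of% h]
        simp only [Iso.inv_hom_id_assoc, ← Functor.map_comp, Category.assoc, hir,
          Category.comp_id, CategoryTheory.Functor.map_id] }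
  map_id ξ := by
    have h1 := (pullbackId (p.obj ξ)).inv.naturality (ret ξ)
    have h2 := (pullbackCongr (p.map_id ξ).symm).hom.naturality (ret ξ)
    dsimp at h1 h2 ⊢
    rw [F.map_id]
    simp only [Category.assoc]
    rw [← h2, ← reassoc_of% h1, reassoc_of% hir]
  map_comp {ξ η ζ} a b := by
    have h1 := (pullbackComp (p.map a) (p.map b)).hom.naturality (ret ζ)
    have h2 := (pullbackCongr (p.map_comp a b).symm).hom.naturality (ret ζ)
    have h := he a
    dsimp at h1 h2 ⊢
    rw [F.map_comp]
    simp only [Category.assoc, Functor.map_comp] at h ⊢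
    rw [← h2, ← reassoc_of% h1, ← reassoc_of% h, reassoc_of% hir]

end Splitting

end AlgebraicGeometry.StackVect

/-! ### Frame systems and direct sums -/

namespace AlgebraicGeometry.StackVect
open Scheme.Modules

variable {𝒳 : Type w} [Category.{v} 𝒳] {p : 𝒳 ⥤ Scheme.{u}}

/-- A family of split monomorphisms with orthogonal retractions of sum `1` is a direct sum. -/
def isColimitOfSplitting {C : Type*} [Category C] [Preadditive C] {A : C} {ι : Type*} [Fintype ι]
    {Q : ι → C} (inc : ∀ i, Q i ⟶ A) (ret : ∀ i, A ⟶ Q i) (hir : ∀ i, inc i ≫ ret i = 𝟙 _)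
    (hort : ∀ i j, j ≠ i → inc j ≫ ret i = 0) (hsum : ∑ i, ret i ≫ inc i = 𝟙 A) :
    Limits.IsColimit (Limits.Cofan.mk A inc) :=
  Limits.Cofan.IsColimit.mk _ (fun s => ∑ i, ret i ≫ s.inj i)
    (fun s j => by
      change inc j ≫ ∑ i, ret i ≫ s.inj i = s.inj j
      rw [Preadditive.comp_sum, Finset.sum_eq_single j]
      · rw [← Category.assoc, hir, Category.id_comp]
      · intro i _ hi
        rw [← Category.assoc, hort i j hi.symm, Limits.zero_comp]
      · simp)
    (fun s m hm => by
      change A ⟶ s.pt at m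
      have h1 : (∑ i, ret i ≫ inc i) ≫ m = m := by rw [hsum, Category.id_comp]
      refine h1.symm.trans ?_
      rw [Preadditive.sum_comp]
      refine Finset.sum_congr rfl fun i _ => ?_
      rw [Category.assoc]
      exact congrArg (ret i ≫ ·) (hm i))

/-- A system of local frames of a locally free sheaf on a stack, stable under inverse image and
such that the lines spanned by the members of the frames do not depend on the frame. -/
structure FrameSystem (F : StackVect p) (ι : Type*) [Fintype ι] where
  /-- the frames of `F ξ` over `W` belonging to the system -/
  frames (ξ : 𝒳) (W : (p.obj ξ).Opens) : Set (ι → Γ(F.obj ξ, W))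
  isFrame {ξ W τ} (h : τ ∈ frames ξ W) : IsFrame τ
  exists_mem (ξ : 𝒳) (x : p.obj ξ) : ∃ W : (p.obj ξ).Opens, x ∈ W ∧ (frames ξ W).Nonempty
  exists_smul {ξ W τ τ'} (h : τ ∈ frames ξ W) (h' : τ' ∈ frames ξ W) (i : ι) :
    ∃ c : Γ(p.obj ξ, W), τ' i = c • τ i
  pull_mem {ξ η : 𝒳} (a : ξ ⟶ η) {V : (p.obj η).Opens} {W : (p.obj ξ).Opens}
    (h : W ≤ p.map a ⁻¹ᵁ V) {τ} (hτ : τ ∈ frames η V) : (fun i => F.pull a h (τ i)) ∈ frames ξ W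

namespace FrameSystem

variable {F : StackVect p} {ι : Type*} [Fintype ι] (S : FrameSystem F ι) {ξ η : 𝒳}

lemma res_mem {V W : (p.obj ξ).Opens} (h : W ≤ V) {τ} (hτ : τ ∈ S.frames ξ V) :
    (fun i => (F.obj ξ).res h (τ i)) ∈ S.frames ξ W := by
  have h' : W ≤ p.map (𝟙 ξ) ⁻¹ᵁ V := by
    rw [p.map_id]
    exact h
  have := S.pull_mem (𝟙 ξ) h' hτ
  simpa only [F.pull_id h h'] using this

/-- The section `y` is the `i`-th component of `x` with respect to the frames of the system. -/
def IsComponent (i : ι) {V : (p.obj ξ).Opens} (x y : Γ(F.obj ξ, V)) : Prop :=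
  ∀ (W : (p.obj ξ).Opens) (hW : W ≤ V) (τ) (hτ : τ ∈ S.frames ξ W),
    (F.obj ξ).res hW y = (S.isFrame hτ).coord le_rfl ((F.obj ξ).res hW x) i • τ i

/-- It suffices to test components on one frame near each point, since two frames of the system
span the same lines. -/
lemma isComponent_of_local (i : ι) {V : (p.obj ξ).Opens} {x y : Γ(F.obj ξ, V)}
    (h : ∀ q ∈ V, ∃ W : (p.obj ξ).Opens, q ∈ W ∧ ∃ (hW : W ≤ V) (τ : _) (hτ : τ ∈ S.frames ξ W),
      (F.obj ξ).res hW y = (S.isFrame hτ).coord le_rfl ((F.obj ξ).res hW x) i • τ i) :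
    S.IsComponent i x y := by
  intro W' hW' τ' hτ'
  apply sec_ext
  intro q hq
  obtain ⟨W, hqW, hW, τ, hτ, he⟩ := h q (hW' hq)
  refine ⟨W ⊓ W', ⟨hqW, hq⟩, inf_le_right, ?_⟩
  have h1 := congrArg ((F.obj ξ).res (inf_le_left : W ⊓ W' ≤ W)) he
  have h2 := S.res_mem (inf_le_left : W ⊓ W' ≤ W) hτ
  have h3 := S.res_mem (inf_le_right : W ⊓ W' ≤ W') hτ'
  have h4 := ((S.isFrame h2).coord_smul_eq (S.isFrame h3) (S.exists_smul h2 h3) le_rfl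
    ((F.obj ξ).res (inf_le_left.trans hW : W ⊓ W' ≤ V) x) i).symm
  have key : ∀ {W W₁ : (p.obj ξ).Opens} (h : W₁ ≤ W) (hW : W ≤ V) {τ} (hτ : τ ∈ S.frames ξ W),
      (F.obj ξ).res h ((S.isFrame hτ).coord le_rfl ((F.obj ξ).res hW x) i • τ i) =
      (S.isFrame (S.res_mem h hτ)).coord le_rfl ((F.obj ξ).res (h.trans hW) x) i •
        (F.obj ξ).res le_rfl ((F.obj ξ).res h (τ i)) := by
    intro W W₁ h hW τ hτ
    rw [res_smul, res_self]
    congr 1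
    have h5 := (S.isFrame hτ).coord_res le_rfl h ((F.obj ξ).res hW x) i
    rw [res_res] at h5
    rw [← h5]
    refine congrFun ((S.isFrame (S.res_mem h hτ)).coord_unique le_rfl ?_) i
    simp only [res_res]
    exact (S.isFrame hτ).sum_coord _ _
  rw [res_res, key _ hW hτ] at h1
  rw [res_res, key _ hW' hτ', h1]
  exact h4

lemma IsComponent.add {i : ι} {V : (p.obj ξ).Opens} {x y x' y' : Γ(F.obj ξ, V)}
    (h : S.IsComponent i x y) (h' : S.IsComponent i x' y') :
    S.IsComponent i (x + x') (y + y') := by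
  intro W hW τ hτ
  rw [map_add, map_add, h W hW τ hτ, h' W hW τ hτ, IsFrame.coord_add, Pi.add_apply, add_smul]

lemma IsComponent.smul {i : ι} {V : (p.obj ξ).Opens} {x y : Γ(F.obj ξ, V)}
    (h : S.IsComponent i x y) (c : Γ(p.obj ξ, V)) :
    S.IsComponent i (c • x) (c • y) := by
  intro W hW τ hτ
  rw [res_smul, res_smul, h W hW τ hτ, IsFrame.coord_smul, Pi.smul_apply, smul_eq_mul, mul_smul]

lemma IsComponent.res {i : ι} {V V' : (p.obj ξ).Opens} {x y : Γ(F.obj ξ, V)}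
    (h : S.IsComponent i x y) (hV : V' ≤ V) :
    S.IsComponent i ((F.obj ξ).res hV x) ((F.obj ξ).res hV y) := by
  intro W hW τ hτ
  rw [res_res, res_res, h W (hW.trans hV) τ hτ]

lemma IsComponent.unique {i : ι} {V : (p.obj ξ).Opens} {x y y' : Γ(F.obj ξ, V)}
    (h : S.IsComponent i x y) (h' : S.IsComponent i x y') : y = y' := by
  apply sec_ext
  intro q hq
  obtain ⟨W, hqW, τ, hτ⟩ := S.exists_mem ξ q
  refine ⟨W ⊓ V, ⟨hqW, hq⟩, inf_le_right, ?_⟩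
  rw [h _ _ _ (S.res_mem inf_le_left hτ), h' _ _ _ (S.res_mem inf_le_left hτ)]

lemma exists_isComponent (i : ι) {V : (p.obj ξ).Opens} (x : Γ(F.obj ξ, V)) :
    ∃ y, S.IsComponent i x y := by
  obtain ⟨y, hy⟩ := exists_section_of_local (F.obj ξ) (V := V)
    (fun W hW y => S.IsComponent i ((F.obj ξ).res hW x) y)
    (by
      intro q hq
      obtain ⟨W, hqW, τ, hτ⟩ := S.exists_mem ξ q
      have h2 := S.res_mem (inf_le_left : W ⊓ V ≤ W) hτ
      refine ⟨W ⊓ V, ⟨hqW, hq⟩, inf_le_right,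
        (S.isFrame h2).coord le_rfl ((F.obj ξ).res inf_le_right x) i •
          (F.obj ξ).res inf_le_left (τ i), ?_⟩
      apply S.isComponent_of_local
      intro q' hq'
      refine ⟨W ⊓ V, hq', le_rfl, _, h2, ?_⟩
      rw [res_self, res_self])
    (fun W hW W' h y hy => by
      have := hy.res S h
      rwa [res_res] at this)
    (fun W hW y y' hy hy' => hy.unique S hy')
  refine ⟨y, S.isComponent_of_local i fun q hq => ?_⟩
  obtain ⟨W, hqW, hW, h⟩ := hy q hq
  obtain ⟨W', hqW', τ, hτ⟩ := S.exists_mem ξ q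
  refine ⟨W' ⊓ W, ⟨hqW', hqW⟩, inf_le_right.trans hW, _, S.res_mem inf_le_left hτ, ?_⟩
  have := h (W' ⊓ W) inf_le_right _ (S.res_mem inf_le_left hτ)
  rw [res_res, res_res] at this
  exact this

/-- The projection onto the `i`-th lines of the frames. -/
def proj (i : ι) (ξ : 𝒳) : F.obj ξ ⟶ F.obj ξ :=
  homMk (fun _ x => (S.exists_isComponent i x).choose)
    (fun _ x y => (S.exists_isComponent i (x + y)).choose_spec.unique S
      ((S.exists_isComponent i x).choose_spec.add S (S.exists_isComponent i y).choose_spec))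
    (fun _ c x => (S.exists_isComponent i (c • x)).choose_spec.unique S
      ((S.exists_isComponent i x).choose_spec.smul S c))
    (fun h x => (S.exists_isComponent i _).choose_spec.unique S
      ((S.exists_isComponent i x).choose_spec.res S h))

lemma isComponent_proj (i : ι) {V : (p.obj ξ).Opens} (x : Γ(F.obj ξ, V)) :
    S.IsComponent i x ((S.proj i ξ).app V x) :=
  (S.exists_isComponent i x).choose_spec

/-- Morphisms from `F ξ` are determined by their values on the frames of the system. -/
lemma hom_ext {M : (p.obj ξ).Modules} {φ ψ : F.obj ξ ⟶ M}
    (h : ∀ (W : (p.obj ξ).Opens) (τ) (_ : τ ∈ S.frames ξ W) (i : ι),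
      φ.app W (τ i) = ψ.app W (τ i)) : φ = ψ := by
  apply hom_ext_apply
  intro V x
  apply sec_ext
  intro q hq
  obtain ⟨W, hqW, τ, hτ⟩ := S.exists_mem ξ q
  refine ⟨W ⊓ V, ⟨hqW, hq⟩, inf_le_right, ?_⟩
  rw [← app_res, ← app_res, ← (S.isFrame hτ).sum_coord inf_le_left ((F.obj ξ).res _ x)]
  simp only [map_sum, Hom.app_smul, app_res, h W τ hτ]

lemma proj_frame [DecidableEq ι] (i j : ι) {W : (p.obj ξ).Opens} {τ} (hτ : τ ∈ S.frames ξ W) :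
    (S.proj i ξ).app W (τ j) = if j = i then τ j else 0 := by
  have h1 := S.isComponent_proj i (τ j) W le_rfl τ hτ
  rw [res_self] at h1
  rw [h1, (S.isFrame hτ).coord_self, Pi.single_apply]
  by_cases h : j = i
  · subst h; simp
  · simp [h, Ne.symm h]

lemma proj_comp_proj [DecidableEq ι] (i j : ι) :
    S.proj i ξ ≫ S.proj j ξ = if i = j then S.proj i ξ else 0 := by
  apply S.hom_ext
  intro W τ hτ k
  rw [Hom.comp_app, ConcreteCategory.comp_apply, S.proj_frame _ _ hτ]
  by_cases h : i = j
  · subst h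
    simp only [if_true]
    split_ifs with h
    · rfl
    · rw [map_zero, S.proj_frame _ _ hτ, if_neg h]
  · rw [if_neg h]
    split_ifs with h'
    · subst h'
      rw [S.proj_frame _ _ hτ, if_neg h]
      rfl
    · rw [map_zero]; rfl

lemma sum_app {X : Scheme.{u}} {M N : X.Modules} {κ : Type*} (s : Finset κ) (φ : κ → (M ⟶ N))
    {V : X.Opens} (x : Γ(M, V)) : (∑ i ∈ s, φ i).app V x = ∑ i ∈ s, (φ i).app V x := by
  classical
  induction s using Finset.induction_on with
  | empty => rfl
  | insert a s ha ih =>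
    rw [Finset.sum_insert ha, Finset.sum_insert ha, ← ih]
    rfl

lemma sum_proj : ∑ i, S.proj i ξ = 𝟙 (F.obj ξ) := by
  classical
  apply S.hom_ext
  intro W τ hτ k
  rw [sum_app]
  simp [S.proj_frame _ _ hτ]

/-- The projections commute with inverse images, because the frames are stable under inverse
image. -/
lemma proj_map (i : ι) (a : ξ ⟶ η) :
    S.proj i ξ ≫ (F.map a).hom = (F.map a).hom ≫ (pullback (p.map a)).map (S.proj i η) := by
  classical
  rw [← Iso.inv_comp_eq]
  apply pullback_hom_ext
  intro U x
  have h0 : pullbackSection (p.map a) x = pullLE (p.map a) le_rfl x := by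
    rw [pullLE_apply, res_self]
  rw [h0, map_pullLE]
  change (F.map a).hom.app _ ((S.proj i ξ).app _ (F.pull a le_rfl x)) = _
  rw [← map_hom_pull]
  congr 1
  refine (S.isComponent_proj i _).unique S (S.isComponent_of_local i ?_)
  intro q hq
  obtain ⟨W, hqW, τ, hτ⟩ := S.exists_mem η (p.map a q)
  have h1 := S.res_mem (inf_le_left : W ⊓ U ≤ W) hτ
  refine ⟨p.map a ⁻¹ᵁ (W ⊓ U), ⟨hqW, hq⟩, (p.map a).preimage_mono inf_le_right, _,
    S.pull_mem a le_rfl h1, ?_⟩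
  have h2 := S.isComponent_proj i x (W ⊓ U) inf_le_right _ h1
  rw [res_pull, res_pull, ← F.pull_res a le_rfl inf_le_right, h2, pull_smul]
  congr 1
  refine congrFun (IsFrame.coord_unique _ le_rfl
    (c := fun k => (p.map a).appLE _ _ le_rfl ((S.isFrame h1).coord le_rfl
      ((F.obj η).res inf_le_right x) k)) ?_) i
  rw [← F.pull_res a le_rfl inf_le_right, ← (S.isFrame h1).sum_coord le_rfl
    ((F.obj η).res (inf_le_right : W ⊓ U ≤ U) x), map_sum]
  refine Finset.sum_congr rfl fun k _ => ?_
  rw [(S.isFrame h1).sum_coord, res_self, res_self, pull_smul]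

/-- A locally free sheaf with a system of frames is a direct sum of invertible sheaves. -/
theorem exists_isDirectSum {n : ℕ} (S : FrameSystem F (Fin n)) :
    ∃ G : Fin n → StackVect p, (∀ i, (G i).IsInvertible) ∧ F.IsDirectSum G := by
  classical
  have hsplit : ∀ i ξ, ∃ (Q : (p.obj ξ).Modules) (inc : Q ⟶ F.obj ξ) (ret : F.obj ξ ⟶ Q),
      inc ≫ ret = 𝟙 Q ∧ ret ≫ inc = S.proj i ξ := fun i ξ =>
    IsIdempotentComplete.idempotents_split (F.obj ξ) (S.proj i ξ)
      ((S.proj_comp_proj i i).trans (if_pos rfl))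
  choose Q inc ret hir hri using hsplit
  -- near each point the image of the `i`-th projection is generated by the `i`-th member of a frame
  have hinv : ∀ i ξ, (Q i ξ).IsInvertible := by
    intro i ξ
    apply isInvertible_of_exists_isGen
    intro x
    obtain ⟨W, hxW, τ, hτ⟩ := S.exists_mem ξ x
    refine ⟨W, hxW, (ret i ξ).app W (τ i), isGen_of_bijective fun V h => ⟨fun c d hcd => ?_,
      fun y => ?_⟩⟩
    · have h1 : ∀ c : Γ(p.obj ξ, V), (inc i ξ).app V (c • (Q i ξ).res h ((ret i ξ).app W (τ i))) =
          ∑ k, (Pi.single i c : Fin n → Γ(p.obj ξ, V)) k • (F.obj ξ).res h (τ k) := by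
        intro c
        rw [Hom.app_smul, app_res]
        have : (inc i ξ).app W ((ret i ξ).app W (τ i)) = τ i := by
          refine (congr(Hom.app $(hri i ξ) W (τ i))).trans ?_
          rw [S.proj_frame _ _ hτ, if_pos rfl]
        rw [this]
        simp [Pi.single_apply]
      have h2 := congrArg ((inc i ξ).app V) hcd
      simp only [h1] at h2
      have h3 := (S.isFrame hτ).ext h h2
      simpa using congrFun h3 i
    · refine ⟨(S.isFrame (S.res_mem h hτ)).coord le_rfl ((inc i ξ).app V y) i, ?_⟩
      have h1 := S.isComponent_proj i ((inc i ξ).app V y) V le_rfl _ (S.res_mem h hτ)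
      rw [res_self, res_self] at h1
      have h2 : (S.proj i ξ).app V ((inc i ξ).app V y) = (inc i ξ).app V y := by
        rw [← hri]
        exact congrArg ((inc i ξ).app V) congr(Hom.app $(hir i ξ) V y)
      have h3 := congrArg ((ret i ξ).app V) (h2.symm.trans h1)
      have h4 : (ret i ξ).app V ((inc i ξ).app V y) = y := congr(Hom.app $(hir i ξ) V y)
      rw [h4, Hom.app_smul, app_res] at h3
      exact h3.symm
  have he : ∀ i {ξ η : 𝒳} (a : ξ ⟶ η), (ret i ξ ≫ inc i ξ) ≫ (F.map a).hom =
      (F.map a).hom ≫ (pullback (p.map a)).map (ret i η ≫ inc i η) := by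
    intro i ξ η a
    rw [hri, hri]
    exact S.proj_map i a
  have hort : ∀ i j ξ, j ≠ i → inc j ξ ≫ ret i ξ = 0 := by
    intro i j ξ h
    have h3 := S.proj_comp_proj (ξ := ξ) j i
    rw [if_neg h, ← hri, ← hri] at h3
    have h4 := congr(inc j ξ ≫ $h3 ≫ ret i ξ)
    simpa [hir, reassoc_of% hir] using h4
  have hsum : ∀ ξ, ∑ i, ret i ξ ≫ inc i ξ = 𝟙 (F.obj ξ) := by
    intro ξ
    rw [← S.sum_proj]
    exact Finset.sum_congr rfl fun i _ => hri i ξ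
  have hmap : ∀ i {ξ η : 𝒳} (a : ξ ⟶ η), inc i ξ ≫ (F.map a).hom =
      (inc i ξ ≫ (F.map a).hom ≫ (pullback (p.map a)).map (ret i η)) ≫
        (pullback (p.map a)).map (inc i η) := by
    intro i ξ η a
    have h1 := he i a
    simp only [Category.assoc, Functor.map_comp] at h1 ⊢
    rw [← h1, reassoc_of% hir]
  exact ⟨fun i => F.splitting (Q i) (inc i) (ret i) (hir i) (fun ξ => (hinv i ξ).isLocallyFree)
    (he i), hinv, inc, fun i ξ η a => hmap i a, fun ξ => ⟨isColimitOfSplitting (fun i => inc i ξ)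
      (fun i => ret i ξ) (fun i => hir i ξ) (fun i j => hort i j ξ) (hsum ξ)⟩⟩

end FrameSystem

end AlgebraicGeometry.StackVect

/-! ### Tensor powers -/

namespace AlgebraicGeometry.Scheme.Modules

variable {X Y Z : Scheme.{u}}

/-- The sections over `V` of the presheaf `U ↦ M(U)^{⊗ n}`. -/
def TensSec (M : X.Modules) (n : ℕ) (V : X.Opens) : Type u := (M.tensorPowPresheaf n).obj (op V)

instance (M : X.Modules) (n : ℕ) (V : X.Opens) : AddCommGroup (M.TensSec n V) :=
  inferInstanceAs (AddCommGroup ((M.tensorPowPresheaf n).obj (op V)))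

instance (M : X.Modules) (n : ℕ) (V : X.Opens) : Module Γ(X, V) (M.TensSec n V) :=
  ((M.tensorPowPresheaf n).obj (op V)).isModule

variable (M : X.Modules)

/-- The element `m₀ ⊗ ... ⊗ mₙ₋₁` of `M(V)^{⊗ n}`. -/
def tens {n : ℕ} {V : X.Opens} (m : Fin n → Γ(M, V)) : M.TensSec n V := M.presheafTprod V n m

/-- The module `M(V)^{⊗ (n + 1)}` as a tensor product. -/
def tensSuccEquiv (n : ℕ) (V : X.Opens) :
    M.TensSec (n + 1) V ≃ₗ[Γ(X, V)] M.TensSec n V ⊗[Γ(X, V)] Γ(M, V) :=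
  LinearEquiv.refl Γ(X, V) (M.TensSec n V ⊗[Γ(X, V)] Γ(M, V))

lemma tensSuccEquiv_tens {n : ℕ} {V : X.Opens} (m : Fin (n + 1) → Γ(M, V)) :
    M.tensSuccEquiv n V (M.tens m) = M.tens (m ∘ Fin.castSucc) ⊗ₜ m (Fin.last n) := rfl

/-- The module `M(V)^{⊗ 0}` is the ring of functions. -/
def tensZeroEquiv (V : X.Opens) : M.TensSec 0 V ≃ₗ[Γ(X, V)] Γ(X, V) :=
  LinearEquiv.refl Γ(X, V) Γ(X, V)

lemma tensZeroEquiv_tens {V : X.Opens} (m : Fin 0 → Γ(M, V)) :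
    M.tensZeroEquiv V (M.tens m) = 1 := rfl

/-- Restriction of sections of the presheaf `U ↦ M(U)^{⊗ n}`. -/
def tensRes (n : ℕ) {V W : X.Opens} (h : W ≤ V) : M.TensSec n V →+ M.TensSec n W :=
  ((M.tensorPowPresheaf n).map (homOfLE h).op).hom.toAddMonoidHom

lemma tensRes_tens {n : ℕ} {V W : X.Opens} (h : W ≤ V) (m : Fin n → Γ(M, V)) :
    M.tensRes n h (M.tens m) = M.tens (fun i => M.res h (m i)) := by
  induction n with
  | zero => exact map_one (fres h)
  | succ n ih =>
    have h1 := ih (m ∘ Fin.castSucc)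
    apply (M.tensSuccEquiv n W).injective
    rw [tensSuccEquiv_tens]
    refine Eq.trans ?_ (congrArg (· ⊗ₜ[Γ(X, W)] M.res h (m (Fin.last n))) h1)
    rfl

lemma tens_smul {n : ℕ} {V : X.Opens} (c : Fin n → Γ(X, V)) (m : Fin n → Γ(M, V)) :
    M.tens (fun i => c i • m i) = (∏ i, c i) • M.tens m := by
  induction n with
  | zero =>
    apply (M.tensZeroEquiv V).injective
    rw [_root_.map_smul, tensZeroEquiv_tens, tensZeroEquiv_tens]
    simp
  | succ n ih =>
    apply (M.tensSuccEquiv n V).injective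
    rw [_root_.map_smul, tensSuccEquiv_tens, tensSuccEquiv_tens, Fin.prod_univ_castSucc]
    have := ih (c ∘ Fin.castSucc) (m ∘ Fin.castSucc)
    change M.tens (fun i => c (Fin.castSucc i) • m (Fin.castSucc i)) ⊗ₜ
      (c (Fin.last n) • m (Fin.last n)) = _
    simp only [Function.comp_def] at this ⊢
    rw [this, TensorProduct.smul_tmul_smul]

lemma tensRes_smul {n : ℕ} {V W : X.Opens} (h : W ≤ V) (c : Γ(X, V)) (x : M.TensSec n V) :
    M.tensRes n h (c • x) = fres h c • M.tensRes n h x :=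
  (M.tensorPowPresheaf n).map_smul (homOfLE h).op c x

/-- The map from `M(V)^{⊗ n}` to the sections of the sheaf `M^{⊗ n}`. -/
def ofTens (n : ℕ) (V : X.Opens) : M.TensSec n V →ₗ[Γ(X, V)] Γ(M.tensorPow n, V) where
  toFun x := ((PresheafOfModules.sheafificationAdjunction (𝟙 X.ringCatSheaf.obj)).unit.app
    (M.tensorPowPresheaf n)).app (op V) x
  map_add' x y := map_add (((PresheafOfModules.sheafificationAdjunction
    (𝟙 X.ringCatSheaf.obj)).unit.app (M.tensorPowPresheaf n)).app (op V)).hom x y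
  map_smul' c x := (((PresheafOfModules.sheafificationAdjunction
    (𝟙 X.ringCatSheaf.obj)).unit.app (M.tensorPowPresheaf n)).app (op V)).hom.map_smul c x

lemma ofTens_tens {n : ℕ} {V : X.Opens} (m : Fin n → Γ(M, V)) :
    M.ofTens n V (M.tens m) = M.tprod m := rfl

lemma res_ofTens {n : ℕ} {V W : X.Opens} (h : W ≤ V) (x : M.TensSec n V) :
    (M.tensorPow n).res h (M.ofTens n V x) = M.ofTens n W (M.tensRes n h x) :=
  (PresheafOfModules.naturality_apply ((PresheafOfModules.sheafificationAdjunction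
    (𝟙 X.ringCatSheaf.obj)).unit.app (M.tensorPowPresheaf n)) (homOfLE h).op x).symm

/-- Every section of the sheafification `M^{⊗ n}` comes locally from the presheaf of
tensor powers. -/
lemma ofTens_locally_surjective (n : ℕ) {V : X.Opens} (y : Γ(M.tensorPow n, V)) :
    ∀ q ∈ V, ∃ W : X.Opens, q ∈ W ∧ ∃ (h : W ≤ V) (x : M.TensSec n W),
      M.ofTens n W x = (M.tensorPow n).res h y := by
  intro q hq
  obtain ⟨W, f, ⟨x, hx⟩, hqW⟩ := Presheaf.imageSieve_mem (Opens.grothendieckTopology X)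
    (CategoryTheory.toSheafify (Opens.grothendieckTopology X)
      (M.tensorPowPresheaf n).presheaf) (U := op V) y q hq
  exact ⟨W, hqW, leOfHom f, x, hx⟩

lemma ofTens_locally_injective (n : ℕ) {V : X.Opens} (x y : M.TensSec n V)
    (hxy : M.ofTens n V x = M.ofTens n V y) :
    ∀ q ∈ V, ∃ W : X.Opens, q ∈ W ∧ ∃ (h : W ≤ V), M.tensRes n h x = M.tensRes n h y := by
  intro q hq
  obtain ⟨W, f, hx, hqW⟩ := Presheaf.equalizerSieve_mem (Opens.grothendieckTopology X)
    (CategoryTheory.toSheafify (Opens.grothendieckTopology X)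
      (M.tensorPowPresheaf n).presheaf) (X := op V) x y hxy q hq
  exact ⟨W, hqW, leOfHom f, hx⟩

lemma tprod_smul {n : ℕ} {V : X.Opens} (c : Fin n → Γ(X, V)) (m : Fin n → Γ(M, V)) :
    M.tprod (fun i => c i • m i) = (∏ i, c i) • M.tprod m := by
  rw [← ofTens_tens, tens_smul, _root_.map_smul, ofTens_tens]

lemma res_tprod {n : ℕ} {V W : X.Opens} (h : W ≤ V) (m : Fin n → Γ(M, V)) :
    (M.tensorPow n).res h (M.tprod m) = M.tprod (fun i => M.res h (m i)) := by
  rw [← ofTens_tens, res_ofTens, tensRes_tens, ofTens_tens]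

variable {M}

/-- If `m` is a basis of `M(V)`, then `m ⊗ ... ⊗ m` is a basis of `M(V)^{⊗ n}`. -/
lemma IsGen.exists_tensEquiv {W : X.Opens} {m : Γ(M, W)} (hm : IsGen m) (n : ℕ) {V : X.Opens}
    (h : V ≤ W) : ∃ e : Γ(X, V) ≃ₗ[Γ(X, V)] M.TensSec n V,
      e 1 = M.tens (fun _ => M.res h m) := by
  induction n with
  | zero => exact ⟨(M.tensZeroEquiv V).symm, rfl⟩
  | succ n ih =>
    obtain ⟨e, he⟩ := ih
    let f : Γ(X, V) ≃ₗ[Γ(X, V)] Γ(M, V) :=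
      LinearEquiv.ofBijective (LinearMap.toSpanSingleton Γ(X, V) Γ(M, V) (M.res h m))
        (hm.bijective h)
    refine ⟨(TensorProduct.lid Γ(X, V) Γ(X, V)).symm ≪≫ₗ TensorProduct.congr e f ≪≫ₗ
      (M.tensSuccEquiv n V).symm, ?_⟩
    apply (M.tensSuccEquiv n V).injective
    rw [tensSuccEquiv_tens]
    simp only [LinearEquiv.trans_apply, LinearEquiv.apply_symm_apply, TensorProduct.lid_symm_apply,
      TensorProduct.congr_tmul, he]
    congr 1
    exact one_smul _ _

/-- The tensor powers of a generator generate the tensor powers. -/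
lemma IsGen.tprod {W : X.Opens} {m : Γ(M, W)} (hm : IsGen m) (n : ℕ) :
    IsGen (M.tprod (fun _ : Fin n => m)) := by
  have key : ∀ {V : X.Opens} (h : V ≤ W) (c : Γ(X, V)),
      c • (M.tensorPow n).res h (M.tprod (fun _ : Fin n => m)) =
        M.ofTens n V (c • M.tens (fun _ => M.res h m)) := by
    intro V h c
    rw [res_tprod, _root_.map_smul, ofTens_tens]
  have hb : ∀ {V : X.Opens} (h : V ≤ W), Function.Bijective
      (fun c : Γ(X, V) => c • M.tens (fun _ : Fin n => M.res h m)) := by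
    intro V h
    obtain ⟨e, he⟩ := hm.exists_tensEquiv n h
    refine bijective_congr (fun c => ?_) e.bijective
    rw [← he, ← _root_.map_smul, smul_eq_mul, mul_one]
  have hinj : ∀ {V : X.Opens} (h : V ≤ W), Function.Injective
      (fun c : Γ(X, V) => c • (M.tensorPow n).res h (M.tprod (fun _ : Fin n => m))) := by
    intro V h c d hcd
    simp only [key] at hcd
    apply fun_ext
    intro q hq
    obtain ⟨V', hqV', h', hc⟩ := M.ofTens_locally_injective n _ _ hcd q hq
    refine ⟨V', hqV', h', (hb (h'.trans h)).1 ?_⟩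
    simpa only [tensRes_smul, tensRes_tens, res_res] using hc
  apply isGen_of_bijective
  intro V h
  refine ⟨hinj h, fun y => ?_⟩
  obtain ⟨c, hc⟩ := exists_section_of_local (structureSheaf X) (V := V)
    (fun V' h' c => (strEquiv X V').symm c •
      (M.tensorPow n).res (h'.trans h) (M.tprod (fun _ : Fin n => m)) = (M.tensorPow n).res h' y)
    (fun q hq => by
      obtain ⟨V', hqV', h', x, hx⟩ := M.ofTens_locally_surjective n y q hq
      obtain ⟨c, hc⟩ := (hb (h'.trans h)).2 x
      refine ⟨V', hqV', h', strEquiv X V' c, ?_⟩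
      rw [AddEquiv.symm_apply_apply, key, ← hx, ← hc])
    (fun V₁ h₁ V₂ h₂ c hc => by
      have := congrArg ((M.tensorPow n).res h₂) hc
      rwa [res_smul, res_res, res_res] at this)
    (fun V₁ h₁ c d hc hd => (strEquiv X V₁).symm.injective (hinj (h₁.trans h) (hc.trans hd.symm)))
  refine ⟨(strEquiv X V).symm c, sec_ext _ fun q hq => ?_⟩
  obtain ⟨V', hqV', h', hc'⟩ := hc q hq
  refine ⟨V', hqV', h', ?_⟩
  rw [res_smul, res_res, ← hc']
  rfl

end AlgebraicGeometry.Scheme.Modules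

/-! ### Trivialisations of objects of the root stack -/

namespace AlgebraicGeometry.RootStack
open Scheme.Modules

variable {X : Scheme.{u}} {L : X.Modules} {s : Γ(L, ⊤)} {r : ℕ}

/-- The tautological invertible sheaf `(f, M, t, φ) ↦ M` on the root stack. -/
def taut (L : X.Modules) (s : Γ(L, ⊤)) (r : ℕ) : StackVect (toScheme L s r) where
  obj ξ := ξ.M
  isLocallyFree ξ := ξ.isInvertible.isLocallyFree
  map a := RootStack.Hom.ρ a
  map_id ξ := (Category.comp_id _).symm
  map_comp {ξ η ζ} a b := by
    change (RootStack.Hom.comp a b).ρ.hom = _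
    dsimp only [RootStack.Hom.comp]
    simp only [Iso.trans_hom, Functor.mapIso_hom, Iso.app_hom]
    congr 2

variable {ξ η ζ : RootStack L s r} {U : X.Opens} {ℓ : Γ(L, U)}

/-- The scheme morphism underlying a morphism of the root stack. -/
abbrev base (a : ξ ⟶ η) : ξ.S ⟶ η.S := (toScheme L s r).map a

lemma base_f (a : ξ ⟶ η) : base a ≫ η.f = ξ.f := RootStack.Hom.w a

lemma base_comp (a : ξ ⟶ η) (b : η ⟶ ζ) : base (a ≫ b) = base a ≫ base b := rfl

lemma preimage_f_eq (a : ξ ⟶ η) (U : X.Opens) : ξ.f ⁻¹ᵁ U = base a ⁻¹ᵁ (η.f ⁻¹ᵁ U) := by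
  rw [← base_f a]
  rfl

/-- The inverse image, under an arrow of the root stack, of sections of the tautological sheaf. -/
def tautPull (a : ξ ⟶ η) {V : η.S.Opens} {W : ξ.S.Opens} (h : W ≤ base a ⁻¹ᵁ V) :
    Γ(η.M, V) →+ Γ(ξ.M, W) := (taut L s r).pull a h

lemma ρ_tautPull (a : ξ ⟶ η) {V : η.S.Opens} {W : ξ.S.Opens} (h : W ≤ base a ⁻¹ᵁ V)
    (m : Γ(η.M, V)) : (RootStack.Hom.ρ a).hom.app W (tautPull a h m) = pullLE (base a) h m :=
  (taut L s r).map_hom_pull a h m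

lemma tautPull_smul (a : ξ ⟶ η) {V : η.S.Opens} {W : ξ.S.Opens} (h : W ≤ base a ⁻¹ᵁ V)
    (c : Γ(η.S, V)) (m : Γ(η.M, V)) :
    tautPull a h (c • m) = (base a).appLE V W h c • tautPull a h m :=
  (taut L s r).pull_smul a h c m

lemma res_tautPull (a : ξ ⟶ η) {V : η.S.Opens} {W W' : ξ.S.Opens} (h : W ≤ base a ⁻¹ᵁ V)
    (h' : W' ≤ W) (m : Γ(η.M, V)) :
    ξ.M.res h' (tautPull a h m) = tautPull a (h'.trans h) m :=
  (taut L s r).res_pull a h h' m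

lemma tautPull_res (a : ξ ⟶ η) {V V' : η.S.Opens} {W : ξ.S.Opens} (h : W ≤ base a ⁻¹ᵁ V')
    (h' : V' ≤ V) (m : Γ(η.M, V)) :
    tautPull a h (η.M.res h' m) = tautPull a (h.trans ((base a).preimage_mono h')) m :=
  (taut L s r).pull_res a h h' m

lemma tautPull_tautPull (a : ξ ⟶ η) (b : η ⟶ ζ) {V : ζ.S.Opens} {V' : η.S.Opens} {W : ξ.S.Opens}
    (h : W ≤ base a ⁻¹ᵁ V') (h' : V' ≤ base b ⁻¹ᵁ V) (h'' : W ≤ base (a ≫ b) ⁻¹ᵁ V)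
    (m : Γ(ζ.M, V)) : tautPull a h (tautPull b h' m) = tautPull (a ≫ b) h'' m :=
  (taut L s r).pull_pull a b h h' h'' m

lemma isGen_tautPull (a : ξ ⟶ η) {V : η.S.Opens} {W : ξ.S.Opens} (h : W ≤ base a ⁻¹ᵁ V)
    {m : Γ(η.M, V)} (hm : IsGen m) : IsGen (tautPull a h m) :=
  (taut L s r).isFrame_pull a h hm

lemma le_preimage_top {S T : Scheme.{u}} (h : S ⟶ T) (W : S.Opens) : W ≤ h ⁻¹ᵁ ⊤ :=
  fun _ _ => trivial

/-- The section `t` of an object is the inverse image of the section `t` of the target. -/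
lemma tautPull_t (a : ξ ⟶ η) {W : ξ.S.Opens} :
    tautPull a (le_preimage_top (base a) W) η.t = ξ.M.res le_top ξ.t := by
  apply (taut L s r).map_hom_injective a
  refine (ρ_tautPull a _ η.t).trans ?_
  refine Eq.trans ?_ (app_res (RootStack.Hom.ρ a).hom le_top ξ.t).symm
  rw [pullLE_apply]
  exact congrArg _ (RootStack.Hom.ρ_t a).symm

/-- The canonical isomorphism from `h^* g^* L` to `f^* L` respects the inverse images of
sections. -/
lemma canonical_pullLE {S T : Scheme.{u}} {h : S ⟶ T} {g : T ⟶ X} {f : S ⟶ X} (w : h ≫ g = f)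
    {V : T.Opens} {W : S.Opens} (h₁ : W ≤ h ⁻¹ᵁ V) (h₂ : V ≤ g ⁻¹ᵁ U) (h₃ : W ≤ f ⁻¹ᵁ U)
    (x : Γ(L, U)) :
    ((pullbackComp h g ≪≫ pullbackCongr w).hom.app L).app W (pullLE h h₁ (pullLE g h₂ x)) =
      pullLE f h₃ x := by
  have h₄ : W ≤ (h ≫ g) ⁻¹ᵁ U := h₁.trans (h.preimage_mono h₂)
  change ((pullbackCongr w).hom.app L).app W (((pullbackComp h g).hom.app L).app W _) = _
  refine (congrArg _ (pullbackComp_pullLE h g h₁ h₂ h₄ x)).trans ?_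
  exact pullbackCongr_pullLE w h₄ h₃ x

/-- The compatibility of an arrow with the isomorphisms `φ`, in terms of inverse images of
sections. -/
lemma comm_tautPull (a : ξ ⟶ η) (V : η.S.Opens) (n : Fin r → Γ(η.M, V)) :
    ξ.φ.hom.app (base a ⁻¹ᵁ V) (ξ.M.tprod fun i => tautPull a le_rfl (n i)) =
      ((pullbackComp (base a) η.f ≪≫ pullbackCongr (base_f a)).hom.app L).app (base a ⁻¹ᵁ V)
        (pullLE (base a) le_rfl (η.φ.hom.app V (η.M.tprod n))) := by
  have h1 : ∀ i, tautPull a le_rfl (n i) = (RootStack.Hom.ρ a).inv.app (base a ⁻¹ᵁ V)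
      (pullbackSection (base a) (n i)) := fun i => congrArg _ (res_self _ _)
  have h2 : ∀ x : Γ((pullback η.f).obj L, V),
      pullLE (base a) le_rfl x = pullbackSection (base a) x := fun x => res_self _ _
  simp only [h1, h2]
  exact RootStack.Hom.comm a V n

/-- A trivialisation of the object `ξ = (f, M, t, φ)` over an open set `W` which `f` maps to `U`,
where `ℓ` generates `L` over `U`: a generator `m` of `M` over `W`, with the functions `a` and `b`
such that `t = a m` and `φ (m^{⊗ r}) = b f^* ℓ`. -/
structure IsTriv (ℓ : Γ(L, U)) (ξ : RootStack L s r) {W : ξ.S.Opens} (hW : W ≤ ξ.f ⁻¹ᵁ U)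
    (m : Γ(ξ.M, W)) (a b : Γ(ξ.S, W)) : Prop where
  isGen : IsGen m
  t_eq : ξ.M.res le_top ξ.t = a • m
  φ_eq : ξ.φ.hom.app W (ξ.M.tprod fun _ : Fin r => m) = b • pullLE ξ.f hW ℓ

lemma exists_isTriv (hℓ : IsGen ℓ) {W : ξ.S.Opens} (hW : W ≤ ξ.f ⁻¹ᵁ U) {m : Γ(ξ.M, W)}
    (hm : IsGen m) : ∃ a b, IsTriv ℓ ξ hW m a b := by
  obtain ⟨a, ha⟩ := hm.exists_smul le_rfl (ξ.M.res le_top ξ.t)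
  obtain ⟨b, hb⟩ := (hℓ.pullLE ξ.f hW).exists_smul le_rfl
    (ξ.φ.hom.app W (ξ.M.tprod fun _ : Fin r => m))
  rw [res_self] at ha hb
  exact ⟨a, b, hm, ha, hb⟩

lemma IsTriv.isUnit (hℓ : IsGen ℓ) {W : ξ.S.Opens} {hW : W ≤ ξ.f ⁻¹ᵁ U} {m : Γ(ξ.M, W)}
    {a b : Γ(ξ.S, W)} (h : IsTriv ℓ ξ hW m a b) : IsUnit b := by
  have h1 := (h.isGen.tprod r).map_iso ξ.φ
  rw [h.φ_eq] at h1
  exact (hℓ.pullLE ξ.f hW).isUnit h1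

/-- The equation `φ (t^{⊗ r}) = f^* s` in a trivialisation, where `s = s₀ ℓ`. -/
lemma IsTriv.rel (hℓ : IsGen ℓ) {s₀ : Γ(X, U)} (hs₀ : L.res le_top s = s₀ • ℓ) {W : ξ.S.Opens}
    {hW : W ≤ ξ.f ⁻¹ᵁ U} {m : Γ(ξ.M, W)} {a b : Γ(ξ.S, W)} (h : IsTriv ℓ ξ hW m a b) :
    b * a ^ r = ξ.f.appLE U W hW s₀ := by
  have h1 := congrArg (((pullback ξ.f).obj L).res (le_top : W ≤ ⊤)) ξ.φ_t
  rw [← app_res, res_tprod] at h1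
  simp only [h.t_eq] at h1
  rw [tprod_smul ξ.M (fun _ => a) (fun _ => m), Hom.app_smul, h.φ_eq, Finset.prod_const,
    Finset.card_univ, Fintype.card_fin, ← mul_smul] at h1
  have h2 : ((pullback ξ.f).obj L).res (le_top : W ≤ ⊤) (pullbackSection ξ.f s) =
      ξ.f.appLE U W hW s₀ • pullLE ξ.f hW ℓ := by
    rw [← pullLE_smul, ← hs₀, pullLE_res, pullLE_apply]
    rfl
  rw [h2] at h1
  rw [mul_comm]
  exact (hℓ.pullLE ξ.f hW).smul_inj h1

lemma IsTriv.pull (a : ξ ⟶ η) {V : η.S.Opens} {W : ξ.S.Opens} {hV : V ≤ η.f ⁻¹ᵁ U}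
    (hW : W ≤ ξ.f ⁻¹ᵁ U) {m : Γ(η.M, V)} {c d : Γ(η.S, V)} (H : IsTriv ℓ η hV m c d)
    (h : W ≤ base a ⁻¹ᵁ V) :
    IsTriv ℓ ξ hW (tautPull a h m) ((base a).appLE V W h c) ((base a).appLE V W h d) where
  isGen := isGen_tautPull a h H.isGen
  t_eq := by
    rw [← tautPull_smul, ← H.t_eq, tautPull_res, ← tautPull_t a]
  φ_eq := by
    have h1 := congrArg (((pullback ξ.f).obj L).res h) (comm_tautPull a V (fun _ => m))
    rw [← app_res, res_tprod, ← app_res, H.φ_eq] at h1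
    simp only [res_tautPull] at h1
    refine h1.trans ((congrArg _ (res_pullLE (base a) le_rfl h _)).trans ?_)
    rw [pullLE_smul]
    refine (Hom.app_smul _ _ _).trans ?_
    rw [canonical_pullLE _ _ _ hW]

lemma IsTriv.res {V W : ξ.S.Opens} {hV : V ≤ ξ.f ⁻¹ᵁ U} {m : Γ(ξ.M, V)} {c d : Γ(ξ.S, V)}
    (H : IsTriv ℓ ξ hV m c d) (h : W ≤ V) :
    IsTriv ℓ ξ (h.trans hV) (ξ.M.res h m) (fres h c) (fres h d) where
  isGen := H.isGen.res h
  t_eq := by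
    rw [← res_smul, ← H.t_eq, res_res]
  φ_eq := by
    have h1 := congrArg (((pullback ξ.f).obj L).res h) H.φ_eq
    rwa [← app_res, res_tprod, res_smul, res_pullLE] at h1

/-- A morphism `ζ ⟶ η` over a given morphism of schemes, from trivialisations with
the same functions. -/
lemma exists_hom {V : η.S.Opens} {hV : V ≤ η.f ⁻¹ᵁ U} {m : Γ(η.M, V)} {c d : Γ(η.S, V)}
    (H : IsTriv ℓ η hV m c d) {hζ : (⊤ : ζ.S.Opens) ≤ ζ.f ⁻¹ᵁ U} {μ : Γ(ζ.M, ⊤)}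
    (h : ζ.S ⟶ η.S) (w : h ≫ η.f = ζ.f) (e : ⊤ ≤ h ⁻¹ᵁ V)
    (Hζ : IsTriv ℓ ζ hζ μ (h.appLE V ⊤ e c) (h.appLE V ⊤ e d)) :
    ∃ a : ζ ⟶ η, base a = h ∧ ∀ e', tautPull a e' m = μ := by
  obtain ⟨ρ, hρ⟩ := Hζ.isGen.exists_iso (H.isGen.pullLE h e)
  have hρ' : ∀ W : ζ.S.Opens, ρ.inv.app W (pullLE h (le_top.trans e) m) = ζ.M.res le_top μ := by
    intro W
    have : pullLE h (le_top.trans e : W ≤ _) m = ρ.hom.app W (ζ.M.res le_top μ) := by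
      rw [app_res, hρ, res_pullLE]
    rw [this]
    exact congr(Hom.app $(ρ.hom_inv_id) W (ζ.M.res le_top μ))
  let a : RootStack.Hom ζ η :=
    { base := h
      w := w
      ρ := ρ
      ρ_t := by
        have h1 := Hζ.t_eq
        rw [res_self] at h1
        rw [h1, Hom.app_smul, hρ, ← pullLE_smul, ← H.t_eq, pullLE_res, pullLE_apply]
        exact res_self _ _
      comm := by
        intro V' n
        have hW : h ⁻¹ᵁ V' ≤ h ⁻¹ᵁ (V' ⊓ V) := fun x hx => ⟨hx, e trivial⟩
        choose k hk using fun i => H.isGen.exists_smul (inf_le_right : V' ⊓ V ≤ V)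
          (η.M.res inf_le_left (n i))
        have h1 : ∀ i, pullbackSection h (n i) =
            h.appLE (V' ⊓ V) (h ⁻¹ᵁ V') hW (k i) • pullLE h (le_top.trans e) m := by
          intro i
          have h2 : pullbackSection h (n i) = pullLE h hW (η.M.res inf_le_left (n i)) := by
            rw [pullLE_res, pullLE_apply]
            exact (res_self _ _).symm
          rw [h2, hk i, pullLE_smul, pullLE_res]
        simp only [h1, Hom.app_smul, hρ']
        rw [tprod_smul ζ.M (fun i => h.appLE (V' ⊓ V) (h ⁻¹ᵁ V') hW (k i))
          (fun _ => ζ.M.res le_top μ), Hom.app_smul,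
          (Hζ.res (le_top : h ⁻¹ᵁ V' ≤ ⊤)).φ_eq]
        have h3 : pullbackSection h (η.φ.hom.app V' (η.M.tprod n)) =
            pullLE h hW (((pullback η.f).obj L).res inf_le_left
              (η.φ.hom.app V' (η.M.tprod n))) := by
          rw [pullLE_res, pullLE_apply]
          exact (res_self _ _).symm
        rw [h3, ← app_res, res_tprod]
        simp only [hk]
        rw [tprod_smul η.M k (fun _ => η.M.res inf_le_right m), Hom.app_smul,
          (H.res (inf_le_right : V' ⊓ V ≤ V)).φ_eq, pullLE_smul, pullLE_smul, Hom.app_smul,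
          Hom.app_smul, canonical_pullLE w hW _ (le_top.trans hζ), map_prod, appLE_fres,
          fres_appLE] }
  refine ⟨a, rfl, fun e' => ?_⟩
  refine (hρ' ⊤).trans (res_self _ _)

/-- A morphism of the root stack is determined by its underlying morphism of schemes and by the
inverse image of a generator. -/
lemma hom_ext_of_isGen {a b : ζ ⟶ η} (h : base a = base b) {V : η.S.Opens} {m : Γ(η.M, V)}
    (hm : IsGen m) (e : ⊤ ≤ base a ⁻¹ᵁ V) (e' : ⊤ ≤ base b ⁻¹ᵁ V)
    (hab : tautPull a e m = tautPull b e' m) : a = b := by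
  refine Hom.ext' h ((isGen_tautPull a e hm).hom_ext ?_)
  have h1 := ρ_tautPull a e m
  have h2 := ρ_tautPull b e' m
  rw [← hab] at h2
  refine (comp_app_apply _ _ _).trans (Eq.trans ?_ h2.symm)
  refine (congrArg (((pullbackCongr h).hom.app η.M).app ⊤) h1).trans ?_
  exact pullbackCongr_pullLE h e e' m

/-- The object `(f, 𝒪, a, φ)` of the root stack with `φ (1^{⊗ r}) = b f^* ℓ`. -/
def ofFunctions (hℓ : IsGen ℓ) {s₀ : Γ(X, U)} (hs₀ : L.res le_top s = s₀ • ℓ) {S : Scheme.{u}}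
    (f : S ⟶ X) (hf : ⊤ ≤ f ⁻¹ᵁ U) (a b : Γ(S, ⊤)) (hb : IsUnit b)
    (hab : b * a ^ r = f.appLE U ⊤ hf s₀) : RootStack L s r :=
  have h := ((isGen_one (X := S) ⊤).tprod r).exists_iso ((hℓ.pullLE f hf).unit_smul hb)
  { S := S
    f := f
    M := structureSheaf S
    isInvertible := isInvertible_of_exists_isGen fun x => ⟨⊤, trivial, _, isGen_one ⊤⟩
    t := strEquiv S ⊤ a
    φ := h.choose
    φ_t := by
      have h1 : (fun _ : Fin r => strEquiv S ⊤ a) =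
          fun i : Fin r => (fun _ => a) i • (fun _ => strEquiv S ⊤ 1) i := by
        funext i
        rw [← strEquiv_mul, mul_one]
      rw [h1, tprod_smul, Hom.app_smul, h.choose_spec, Finset.prod_const, Finset.card_univ,
        Fintype.card_fin, ← mul_smul, mul_comm, hab, ← pullLE_smul, ← hs₀, pullLE_res, pullLE_apply]
      exact res_self _ _ }

lemma isTriv_ofFunctions (hℓ : IsGen ℓ) {s₀ : Γ(X, U)} (hs₀ : L.res le_top s = s₀ • ℓ)
    {S : Scheme.{u}} (f : S ⟶ X) (hf : ⊤ ≤ f ⁻¹ᵁ U) (a b : Γ(S, ⊤)) (hb : IsUnit b)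
    (hab : b * a ^ r = f.appLE U ⊤ hf s₀) :
    IsTriv ℓ (ofFunctions hℓ hs₀ f hf a b hb hab) (W := (⊤ : S.Opens)) hf (strEquiv S ⊤ 1) a b where
  isGen := isGen_one ⊤
  t_eq := (res_self _ _).trans (by
    change strEquiv S ⊤ a = a • strEquiv S ⊤ 1
    rw [← strEquiv_mul, mul_one])
  φ_eq := (((isGen_one (X := S) ⊤).tprod r).exists_iso
    ((hℓ.pullLE f hf).unit_smul hb)).choose_spec

end AlgebraicGeometry.RootStack

/-! ### Cyclic covers -/

namespace AlgebraicGeometry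
open Scheme.Modules _root_.Polynomial

variable {S T : Scheme.{u}} {W : S.Opens} {r : ℕ}

/-- The morphism `h : S' ⟶ S` is the cyclic cover `Spec A[w] / (w ^ r - v)` of the affine open
subscheme `W = Spec A` of `S`. -/
structure IsCyclicCover {S' : Scheme.{u}} (h : S' ⟶ S) (v : Γ(S, W)) (r : ℕ) (w : Γ(S', ⊤)) :
    Prop where
  isAffine : IsAffine S'
  le : ⊤ ≤ h ⁻¹ᵁ W
  pow_eq : w ^ r = h.appLE W ⊤ le v
  bijective : Function.Bijective fun k : Fin r → Γ(S, W) =>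
    ∑ i : Fin r, w ^ (i : ℕ) * h.appLE W ⊤ le (k i)
  exists_lift {T : Scheme.{u}} (g : T ⟶ S) (e : ⊤ ≤ g ⁻¹ᵁ W) (z : Γ(T, ⊤))
    (hz : z ^ r = g.appLE W ⊤ e v) :
      ∃ q : T ⟶ S', q ≫ h = g ∧ q.appLE ⊤ ⊤ (RootStack.le_preimage_top q ⊤) w = z
  hom_ext {T : Scheme.{u}} {q q' : T ⟶ S'} (hq : q ≫ h = q' ≫ h)
    (hw : q.appLE ⊤ ⊤ (RootStack.le_preimage_top q ⊤) w =
      q'.appLE ⊤ ⊤ (RootStack.le_preimage_top q' ⊤) w) : q = q'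
  exists_preimage_le (O : S'.Opens) (x : S) (hx : x ∈ W) (hO : ∀ y, h y = x → y ∈ O) :
    ∃ U : S.Opens, x ∈ U ∧ h ⁻¹ᵁ U ≤ O

lemma appLE_top_top (f : T ⟶ S) (e) : f.appLE ⊤ ⊤ e = f.appTop := Scheme.Hom.appLE_eq_app ..

lemma appLE_appLE {T' : Scheme.{u}} (f : T' ⟶ T) (g : T ⟶ S) {V : T.Opens} {O : T'.Opens}
    (h : O ≤ f ⁻¹ᵁ V) (h' : V ≤ g ⁻¹ᵁ W) (h'' : O ≤ (f ≫ g) ⁻¹ᵁ W) (c : Γ(S, W)) :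
    f.appLE V O h (g.appLE W V h' c) = (f ≫ g).appLE W O h'' c := by
  rw [← Scheme.Hom.appLE_comp_appLE f g W V O h' h]
  rfl

/-- A morphism which lands in an affine open subset `W` is recovered from the induced homomorphism
on the ring of functions on `W`. -/
lemma toSpecΓ_SpecMap_appLE_fromSpec (hW : IsAffineOpen W) (g : T ⟶ S) (e : ⊤ ≤ g ⁻¹ᵁ W) :
    T.toSpecΓ ≫ Spec.map (g.appLE W ⊤ e) ≫ hW.fromSpec = g := by
  have : IsIso (⊤ : T.Opens).ι := inferInstanceAs (IsIso T.topIso.hom)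
  rw [← cancel_epi (⊤ : T.Opens).ι, ← Category.assoc, ← Scheme.Opens.toSpecΓ_top,
    ← Category.assoc, Scheme.Opens.toSpecΓ_SpecMap_appLE, Category.assoc, hW.toSpecΓ_fromSpec,
    Scheme.Hom.resLE_comp_ι]

/-- The powers `w ^ i` with `i < r` are a basis of `A[w] / (w ^ r - v)`. -/
lemma bijective_adjoinRoot {A : Type*} [CommRing A] (v : A) (hr : 1 ≤ r) :
    Function.Bijective fun k : Fin r → A =>
      ∑ i : Fin r, AdjoinRoot.root (X ^ r - C v) ^ (i : ℕ) * AdjoinRoot.of (X ^ r - C v) (k i) := by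
  obtain hA | hA := subsingleton_or_nontrivial A
  · have : Subsingleton (AdjoinRoot (X ^ r - C v)) := AdjoinRoot.mk_surjective.subsingleton
    exact ⟨fun _ _ _ => Subsingleton.elim _ _, fun _ => ⟨0, Subsingleton.elim _ _⟩⟩
  have hm : (X ^ r - C v).Monic := monic_X_pow_sub_C v (by omega)
  let pb := AdjoinRoot.powerBasis' hm
  have hd : pb.dim = r := by
    rw [AdjoinRoot.powerBasis'_dim, natDegree_X_pow_sub_C]
  let b := pb.basis.reindex (finCongr hd)
  have := b.equivFun.symm.bijective
  convert this using 2 with k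
  rw [Module.Basis.equivFun_symm_apply]
  refine Finset.sum_congr rfl fun i _ => ?_
  simp only [b, Module.Basis.reindex_apply, PowerBasis.coe_basis, pb, AdjoinRoot.powerBasis'_gen,
    Algebra.smul_def]
  exact mul_comm _ _

lemma exists_isCyclicCover (hW : IsAffineOpen W) (v : Γ(S, W)) (hr : 1 ≤ r) :
    ∃ (S' : Scheme.{u}) (h : S' ⟶ S) (w : Γ(S', ⊤)), IsCyclicCover h v r w := by
  let P : Γ(S, W)[X] := X ^ r - C v
  let B : CommRingCat.{u} := .of (AdjoinRoot P)
  let φ : Γ(S, W) ⟶ B := CommRingCat.ofHom (AdjoinRoot.of P)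
  let h : Spec B ⟶ S := Spec.map φ ≫ hW.fromSpec
  let w : Γ(Spec B, ⊤) := (Scheme.ΓSpecIso B).inv (AdjoinRoot.root P)
  have le : ⊤ ≤ h ⁻¹ᵁ W := by
    rintro y -
    change hW.fromSpec (Spec.map φ y) ∈ W
    have : hW.fromSpec (Spec.map φ y) ∈ Set.range hW.fromSpec := ⟨_, rfl⟩
    rw [hW.range_fromSpec] at this
    exact this
  have happ : h.appLE W ⊤ le = φ ≫ (Scheme.ΓSpecIso B).inv := by
    have le' : ⊤ ≤ Spec.map φ ⁻¹ᵁ (hW.fromSpec ⁻¹ᵁ W) := fun y hy => le hy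
    refine (Scheme.Hom.comp_appLE (Spec.map φ) hW.fromSpec W ⊤ le).trans ?_
    change _ ≫ (Spec.map φ).appLE _ ⊤ le' = _
    rw [hW.fromSpec_app_self, Category.assoc, Scheme.Hom.map_appLE, Scheme.ΓSpecIso_inv_naturality,
      appLE_top_top]
  have hmonic : P.Monic := monic_X_pow_sub_C v (by omega)
  have hroot : AdjoinRoot.root P ^ r = AdjoinRoot.of P v := by
    have := AdjoinRoot.eval₂_root P
    simpa [P, sub_eq_zero] using this
  have happ' : ∀ a, h.appLE W ⊤ le a = (Scheme.ΓSpecIso B).inv (AdjoinRoot.of P a) := by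
    intro a
    rw [happ]
    rfl
  refine ⟨Spec B, h, w, inferInstance, le, ?_, ?_, ?_, ?_, ?_⟩
  · rw [happ', ← hroot, map_pow]
  · have h1 : Function.Bijective (Scheme.ΓSpecIso B).inv :=
      (ConcreteCategory.isIso_iff_bijective _).mp inferInstance
    have := h1.comp (bijective_adjoinRoot v hr)
    convert this using 2 with k
    simp only [happ', Function.comp_apply, map_sum, map_mul, map_pow]
    rfl
  · intro T g e z hz
    have hev : P.eval₂ (g.appLE W ⊤ e).hom z = 0 := by simp [P, hz]
    let ψ : B ⟶ Γ(T, ⊤) := CommRingCat.ofHom (AdjoinRoot.lift (g.appLE W ⊤ e).hom z hev)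
    have hψ : φ ≫ ψ = g.appLE W ⊤ e := by
      ext a
      exact AdjoinRoot.lift_of hev
    refine ⟨T.toSpecΓ ≫ Spec.map ψ, ?_, ?_⟩
    · simp only [h, Category.assoc, ← Spec.map_comp_assoc, hψ]
      exact toSpecΓ_SpecMap_appLE_fromSpec hW g e
    · have h1 : (T.toSpecΓ ≫ Spec.map ψ).appTop = (Scheme.ΓSpecIso B).hom ≫ ψ := by
        rw [Scheme.Hom.comp_appTop, Scheme.toSpecΓ_appTop, Scheme.ΓSpecIso_naturality]
      rw [appLE_top_top, h1]
      change ψ ((Scheme.ΓSpecIso B).hom ((Scheme.ΓSpecIso B).inv (AdjoinRoot.root P))) = z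
      rw [Iso.inv_hom_id_apply]
      exact AdjoinRoot.lift_root hev
  · intro T q q' hq hw
    rw [appLE_top_top, appLE_top_top] at hw
    apply ext_of_isAffine
    rw [← cancel_epi (Scheme.ΓSpecIso B).inv]
    ext1
    refine AdjoinRoot.ringHom_ext ?_ hw
    have h1 : ∀ (q : T ⟶ Spec B) (e : ⊤ ≤ (q ≫ h) ⁻¹ᵁ W) a,
        q.appTop ((Scheme.ΓSpecIso B).inv (AdjoinRoot.of P a)) = (q ≫ h).appLE W ⊤ e a := by
      intro q e a
      rw [← happ', ← Scheme.Hom.appLE_comp_appLE q h W ⊤ ⊤ le (RootStack.le_preimage_top q ⊤),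
        appLE_top_top]
      rfl
    have h2 : ∀ q : T ⟶ Spec B, ⊤ ≤ (q ≫ h) ⁻¹ᵁ W := fun q y _ => le trivial
    ext a
    refine (h1 q (h2 q) a).trans (Eq.trans ?_ (h1 q' (h2 q') a).symm)
    simp only [hq]
  · intro O x hx hO
    have hint : (AdjoinRoot.of P).IsIntegral := by
      have : Module.Finite Γ(S, W) (AdjoinRoot P) := (AdjoinRoot.powerBasis' hmonic).finite
      exact (Algebra.IsIntegral.of_finite Γ(S, W) (AdjoinRoot P)).1
    have hcl := PrimeSpectrum.isClosedMap_comap_of_isIntegral _ hint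
    have hZ := hcl _ O.isOpen.isClosed_compl
    let Z : (Spec Γ(S, W)).Opens :=
      ⟨(PrimeSpectrum.comap (AdjoinRoot.of P) '' (O : Set (Spec B))ᶜ)ᶜ, hZ.isOpen_compl⟩
    refine ⟨hW.fromSpec ''ᵁ Z, ?_, ?_⟩
    · have : x ∈ Set.range hW.fromSpec := by
        rw [hW.range_fromSpec]
        exact hx
      obtain ⟨p, rfl⟩ := this
      refine ⟨p, ?_, rfl⟩
      rintro ⟨y, hy, hyp⟩
      exact hy (hO y (congrArg hW.fromSpec hyp))
    · rintro y ⟨p, hp, hpy⟩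
      have : p = Spec.map φ y := hW.fromSpec.isOpenEmbedding.injective hpy
      by_contra hy
      exact hp ⟨y, hy, this.symm⟩

end AlgebraicGeometry

/-! ### The atlas of the root stack -/

namespace AlgebraicGeometry.RootStack
open Scheme.Modules

variable {X : Scheme.{u}} {L : X.Modules} {s : Γ(L, ⊤)} {r : ℕ}
  {ξ η ζ : RootStack L s r} {U : X.Opens} {ℓ : Γ(L, U)}

lemma IsTriv.unit_smul {W : ξ.S.Opens} {hW : W ≤ ξ.f ⁻¹ᵁ U} {m : Γ(ξ.M, W)} {c d : Γ(ξ.S, W)}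
    (H : IsTriv ℓ ξ hW m c d) {z z' : Γ(ξ.S, W)} (hz : z * z' = 1) :
    IsTriv ℓ ξ hW (z • m) (z' * c) (z ^ r * d) where
  isGen := H.isGen.unit_smul (IsUnit.of_mul_eq_one _ hz)
  t_eq := by
    rw [H.t_eq, ← mul_smul]
    congr 1
    linear_combination (-c) * hz
  φ_eq := by
    rw [tprod_smul ξ.M (fun _ => z) (fun _ => m), Hom.app_smul, H.φ_eq, ← mul_smul,
      Finset.prod_const, Finset.card_univ, Fintype.card_fin]

/-- Two trivialisations of the same object which differ by the factor `z`: the functions `c` and `d`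
change by `z⁻¹` and `z ^ r`. -/
lemma IsTriv.compare (hℓ : IsGen ℓ) {W : ξ.S.Opens} {hW : W ≤ ξ.f ⁻¹ᵁ U} {m m' : Γ(ξ.M, W)}
    {c d c' d' : Γ(ξ.S, W)} (H : IsTriv ℓ ξ hW m c d) (H' : IsTriv ℓ ξ hW m' c' d')
    {z : Γ(ξ.S, W)} (hz : m = z • m') : c' = z * c ∧ d = z ^ r * d' := by
  constructor
  · apply H'.isGen.smul_inj
    rw [← H'.t_eq, H.t_eq, hz, ← mul_smul, mul_comm]
  · apply (hℓ.pullLE ξ.f hW).smul_inj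
    rw [← H.φ_eq, hz, tprod_smul ξ.M (fun _ => z) (fun _ => m'), Hom.app_smul, H'.φ_eq, ← mul_smul,
      Finset.prod_const, Finset.card_univ, Fintype.card_fin]

lemma preimage_le_of_hom (a : ζ ⟶ ξ) {W : ξ.S.Opens} {V : X.Opens} (hW : W ≤ ξ.f ⁻¹ᵁ V)
    (e : ⊤ ≤ base a ⁻¹ᵁ W) : ⊤ ≤ ζ.f ⁻¹ᵁ V := by
  rw [preimage_f_eq a]
  exact e.trans ((base a).preimage_mono hW)

/-- The objects `(f, 𝒪, a, φ)`, in a form which keeps their construction opaque. -/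
lemma exists_object (hℓ : IsGen ℓ) {s₀ : Γ(X, U)} (hs₀ : L.res le_top s = s₀ • ℓ)
    {S : Scheme.{u}} (f : S ⟶ X) (hf : ⊤ ≤ f ⁻¹ᵁ U) (a b : Γ(S, ⊤)) (hb : IsUnit b)
    (hab : b * a ^ r = f.appLE U ⊤ hf s₀)
    (Q : ∀ S : Scheme.{u}, (S ⟶ X) → Γ(S, ⊤) → Γ(S, ⊤) → Prop) (hQ : Q S f a b) :
    ∃ (ζ : RootStack L s r) (hζ : ⊤ ≤ ζ.f ⁻¹ᵁ U) (μ : Γ(ζ.M, ⊤)) (a b : Γ(ζ.S, ⊤)),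
      IsTriv ℓ ζ hζ μ a b ∧ Q ζ.S ζ.f a b :=
  ⟨_, _, _, _, _, isTriv_ofFunctions hℓ hs₀ f hf a b hb hab, hQ⟩

section Universal

variable {ξ₀ : RootStack L s r} {s₀ : Γ(X, U)} {T : Γ(ξ₀.S, ⊤)} {e₀ : Γ(ξ₀.M, ⊤)}

/-- An atlas of the root stack over `U`: the object over the cyclic cover
`Spec A[T] / (T ^ r - s₀)` of `U = Spec A` given by the section `T` of the trivial sheaf. -/
structure IsAtlas (ℓ : Γ(L, U)) (s₀ : Γ(X, U)) (ξ₀ : RootStack L s r) (T : Γ(ξ₀.S, ⊤))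
    (e₀ : Γ(ξ₀.M, ⊤)) : Prop where
  isGen : IsGen ℓ
  s_eq : L.res le_top s = s₀ • ℓ
  isCyclicCover : IsCyclicCover ξ₀.f s₀ r T
  isTriv : IsTriv ℓ ξ₀ isCyclicCover.le e₀ T 1

lemma exists_isAtlas (hr : 1 ≤ r) (hU : IsAffineOpen U) (hℓ : IsGen ℓ)
    (hs₀ : L.res le_top s = s₀ • ℓ) :
    ∃ (ξ₀ : RootStack L s r) (T : _) (e₀ : _), IsAtlas ℓ s₀ ξ₀ T e₀ := by
  obtain ⟨S, f, T, h⟩ := exists_isCyclicCover hU s₀ hr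
  exact ⟨ofFunctions hℓ hs₀ f h.le T 1 isUnit_one ((one_mul _).trans h.pow_eq), T, strEquiv S ⊤ 1,
    hℓ, hs₀, h, isTriv_ofFunctions hℓ hs₀ f h.le T 1 isUnit_one ((one_mul _).trans h.pow_eq)⟩

/-- The fibre product over the root stack of the atlas `ξ₀` and of the trivialised object `ξ` is
the cyclic cover `w ^ r = d` of `W`; the trivialisations of the two pullbacks differ by `w`. -/
def IsCover (e₀ : Γ(ξ₀.M, ⊤)) {W : ξ.S.Opens} (m : Γ(ξ.M, W)) (d : Γ(ξ.S, W))
    {ξ' : RootStack L s r} (a' : ξ' ⟶ ξ) (b' : ξ' ⟶ ξ₀) (w : Γ(ξ'.S, ⊤)) : Prop :=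
  IsCyclicCover (base a') d r w ∧ IsUnit w ∧
    ∀ (h : ⊤ ≤ base a' ⁻¹ᵁ W) (h' : ⊤ ≤ base b' ⁻¹ᵁ ⊤), tautPull a' h m = w • tautPull b' h' e₀

/-- Over the cyclic cover `w ^ r = d` of `W` the trivialisation `w⁻¹ m` has
`φ ((w⁻¹ m)^{⊗ r}) = f^* ℓ`, so that the object is pulled back from the atlas along `T ↦ w c`. -/
lemma IsAtlas.exists_isCover (hr : 1 ≤ r) (A : IsAtlas ℓ s₀ ξ₀ T e₀) {W : ξ.S.Opens}
    {hW : W ≤ ξ.f ⁻¹ᵁ U} (hWa : IsAffineOpen W) {m : Γ(ξ.M, W)} {c d : Γ(ξ.S, W)}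
    (H : IsTriv ℓ ξ hW m c d) :
    ∃ (ξ' : RootStack L s r) (a' : ξ' ⟶ ξ) (b' : ξ' ⟶ ξ₀) (w : _), IsCover e₀ m d a' b' w := by
  obtain ⟨S', h, w, C⟩ := exists_isCyclicCover hWa d hr
  have hd : IsUnit (h.appLE W ⊤ C.le d) := (H.isUnit A.isGen).map _
  have hf : ⊤ ≤ (h ≫ ξ.f) ⁻¹ᵁ U := C.le.trans (h.preimage_mono hW)
  have hrel : h.appLE W ⊤ C.le d * h.appLE W ⊤ C.le c ^ r = (h ≫ ξ.f).appLE U ⊤ hf s₀ := by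
    rw [← map_pow, ← map_mul, H.rel A.isGen A.s_eq, appLE_appLE]
  obtain ⟨ξ', hf, μ, _, _, H', h, w, C, hξ', rfl, rfl⟩ := exists_object A.isGen A.s_eq
    (h ≫ ξ.f) hf _ _ hd hrel
    (fun S f x y => ∃ (h : S ⟶ ξ.S) (w : Γ(S, ⊤)) (C : IsCyclicCover h d r w),
      h ≫ ξ.f = f ∧ x = h.appLE W ⊤ C.le c ∧ y = h.appLE W ⊤ C.le d)
    ⟨h, w, C, rfl, rfl, rfl⟩
  have hrel := H'.rel A.isGen A.s_eq
  have hw : IsUnit w := by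
    have hd := H'.isUnit A.isGen
    rw [← C.pow_eq] at hd
    exact (isUnit_pow_iff (by omega)).mp hd
  obtain ⟨w', hw'⟩ := hw.exists_left_inv
  obtain ⟨a', ha', ham⟩ := exists_hom H h hξ' C.le H'
  obtain ⟨q, hq, hqT⟩ := A.isCyclicCover.exists_lift ξ'.f hf (w * h.appLE W ⊤ C.le c) (by
    rw [mul_pow, C.pow_eq, hrel])
  have H'' := H'.unit_smul hw'
  have h1 : w' ^ r * h.appLE W ⊤ C.le d = 1 := by
    rw [← C.pow_eq, ← mul_pow, hw', one_pow]
  rw [h1, ← hqT, ← map_one (q.appLE ⊤ ⊤ (le_preimage_top q ⊤)).hom] at H''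
  obtain ⟨b', hb', hbm⟩ := exists_hom A.isTriv q hq (le_preimage_top q ⊤) H''
  subst ha'
  refine ⟨ξ', a', b', w, C, hw, fun _ _ => ?_⟩
  rw [ham, hbm, ← mul_smul, mul_comm, hw', one_smul]

/-- The universal property of the fibre product: arrows `a` to `ξ` and `b` to `ξ₀` factor through
the cyclic cover, by the ratio of the inverse images of `m` and of `e₀`, which is an `r`-th root
of `d`. -/
lemma IsAtlas.exists_factor (hr : 1 ≤ r) (A : IsAtlas ℓ s₀ ξ₀ T e₀) {W : ξ.S.Opens}
    {hW : W ≤ ξ.f ⁻¹ᵁ U} {m : Γ(ξ.M, W)} {c d : Γ(ξ.S, W)}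
    (H : IsTriv ℓ ξ hW m c d) {ξ' : RootStack L s r} {a' : ξ' ⟶ ξ} {b' : ξ' ⟶ ξ₀} {w : Γ(ξ'.S, ⊤)}
    (C : IsCover e₀ m d a' b' w) (a : ζ ⟶ ξ) (b : ζ ⟶ ξ₀) (e : ⊤ ≤ base a ⁻¹ᵁ W) :
    ∃ g : ζ ⟶ ξ', g ≫ a' = a ∧ g ≫ b' = b := by
  have hC := C.1
  have hζ := preimage_le_of_hom a hW e
  have hξ' := preimage_le_of_hom a' hW hC.le
  have Hb := A.isTriv.pull b hζ (le_preimage_top _ _)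
  have Ha := H.pull a hζ e
  obtain ⟨z, hz⟩ := Hb.isGen.exists_smul le_rfl (tautPull a e m)
  rw [res_self] at hz
  obtain ⟨h1, h2⟩ := Ha.compare A.isGen Hb hz
  rw [map_one, mul_one] at h2
  have hzu : IsUnit z := by
    have := Ha.isUnit A.isGen
    rw [h2] at this
    exact (isUnit_pow_iff (by omega)).mp this
  obtain ⟨q, hq, hqw⟩ := hC.exists_lift (base a) e z h2.symm
  have Ha' := H.pull a' hξ' hC.le
  have Hb' := A.isTriv.pull b' hξ' (le_preimage_top _ _)
  have h3 := (Ha'.compare A.isGen Hb' (C.2.2 _ _)).1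
  have key : ∀ (x : Γ(ξ.S, W)), q.appLE ⊤ ⊤ (le_preimage_top _ _)
      ((base a').appLE W ⊤ hC.le x) = (base a).appLE W ⊤ e x := by
    intro x
    have e' : ⊤ ≤ (q ≫ base a') ⁻¹ᵁ W := by rw [hq]; exact e
    refine (appLE_appLE q (base a') _ hC.le e' x).trans ?_
    simp only [hq]
  rw [← key, ← key] at Ha
  obtain ⟨g, hg, hgm⟩ := exists_hom Ha' q (by rw [← base_f a', ← Category.assoc, hq, base_f])
    (le_preimage_top _ _) Ha
  have hga : g ≫ a' = a := by
    have hb : base (g ≫ a') = base a := by rw [base_comp, hg, hq]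
    have e' : ⊤ ≤ base (g ≫ a') ⁻¹ᵁ W := by rw [hb]; exact e
    refine hom_ext_of_isGen hb H.isGen e' e ?_
    rw [← tautPull_tautPull g a' (le_preimage_top _ _) hC.le, hgm]
  refine ⟨g, hga, ?_⟩
  have hb : base (g ≫ b') = base b := by
    apply A.isCyclicCover.hom_ext
    · rw [base_f, base_f]
    · rw [h1, ← key, ← hqw, ← map_mul, ← h3]
      refine (appLE_appLE (base g) (base b') (le_preimage_top _ _)
        (le_preimage_top _ _) _ _).symm.trans ?_
      simp only [hg]
  refine hom_ext_of_isGen hb A.isTriv.isGen (le_preimage_top _ _) (le_preimage_top _ _) ?_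
  have h4 : z • tautPull (g ≫ b') (le_preimage_top _ ⊤) e₀ =
      z • tautPull b (le_preimage_top _ ⊤) e₀ := by
    rw [← hz, ← hgm (le_preimage_top _ _), C.2.2 hC.le (le_preimage_top _ _), tautPull_smul,
      tautPull_tautPull g b' _ _ (le_preimage_top _ _)]
    simp only [hg, hqw]
  obtain ⟨z', hz'⟩ := hzu.exists_left_inv
  have h5 := congrArg (z' • ·) h4
  simpa only [← mul_smul, hz', one_smul] using h5

end Universal

end AlgebraicGeometry.RootStack

/-! ### Weight decompositions -/

namespace AlgebraicGeometry.RootStack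
open Scheme.Modules

variable {X : Scheme.{u}} {L : X.Modules} {s : Γ(L, ⊤)} {r : ℕ}
  {ξ η ζ ξ₀ : RootStack L s r} {U : X.Opens} {ℓ : Γ(L, U)}
  (F : StackVect (toScheme L s r))

/-- The value `F ξ`, as a sheaf of modules on the scheme `ξ.S`. -/
def sheaf (ξ : RootStack L s r) : ξ.S.Modules := F.obj ξ

lemma isLocallyFree_sheaf (ξ : RootStack L s r) : (sheaf F ξ).IsLocallyFree := F.isLocallyFree ξ

/-- The inverse image of sections of `F` under an arrow of the root stack. -/
def sheafPull (a : ξ ⟶ η) {V : η.S.Opens} {W : ξ.S.Opens} (h : W ≤ base a ⁻¹ᵁ V) :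
    Γ(sheaf F η, V) →+ Γ(sheaf F ξ, W) := F.pull a h

lemma sheafPull_smul (a : ξ ⟶ η) {V : η.S.Opens} {W : ξ.S.Opens} (h : W ≤ base a ⁻¹ᵁ V)
    (c : Γ(η.S, V)) (x : Γ(sheaf F η, V)) :
    sheafPull F a h (c • x) = (base a).appLE V W h c • sheafPull F a h x :=
  F.pull_smul a h c x

lemma sheafPull_res (a : ξ ⟶ η) {V V' : η.S.Opens} {W : ξ.S.Opens} (h : W ≤ base a ⁻¹ᵁ V')
    (h' : V' ≤ V) (x : Γ(sheaf F η, V)) :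
    sheafPull F a h ((sheaf F η).res h' x) =
      sheafPull F a (h.trans ((base a).preimage_mono h')) x :=
  F.pull_res a h h' x

lemma sheafPull_sheafPull (a : ξ ⟶ η) (b : η ⟶ ζ) {V : ζ.S.Opens} {V' : η.S.Opens}
    {W : ξ.S.Opens} (h : W ≤ base a ⁻¹ᵁ V') (h' : V' ≤ base b ⁻¹ᵁ V)
    (h'' : W ≤ base (a ≫ b) ⁻¹ᵁ V) (x : Γ(sheaf F ζ, V)) :
    sheafPull F a h (sheafPull F b h' x) = sheafPull F (a ≫ b) h'' x :=
  F.pull_pull a b h h' h'' x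

lemma sheafPull_id {V W : ξ.S.Opens} (h : W ≤ V) (h' : W ≤ base (𝟙 ξ) ⁻¹ᵁ V)
    (x : Γ(sheaf F ξ, V)) : sheafPull F (𝟙 ξ) h' x = (sheaf F ξ).res h x :=
  F.pull_id h h' x

lemma isFrame_sheafPull {ι : Type*} [Fintype ι] (a : ξ ⟶ η) {V : η.S.Opens} {W : ξ.S.Opens}
    (h : W ≤ base a ⁻¹ᵁ V) {τ : ι → Γ(sheaf F η, V)} (hτ : IsFrame τ) :
    IsFrame (fun i => sheafPull F a h (τ i)) :=
  F.isFrame_pull a h hτ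

/-- Over a cyclic cover `w ^ r = d`, a locally free sheaf pulled back from the base has the
sections `∑ i < r, w ^ i • a'^* σ i`, for unique sections `σ i` on the base. -/
lemma bijective_sum_pow_smul_pull {W : ξ.S.Opens} {d : Γ(ξ.S, W)} {ξ' : RootStack L s r}
    {a' : ξ' ⟶ ξ} {w : Γ(ξ'.S, ⊤)} (C : IsCyclicCover (base a') d r w) {ι : Type*} [Fintype ι]
    {τ : ι → Γ(sheaf F ξ, W)} (hτ : IsFrame τ) :
    Function.Bijective fun σ : Fin r → Γ(sheaf F ξ, W) =>
      (∑ i : Fin r, w ^ (i : ℕ) • sheafPull F a' C.le (σ i) : Γ(sheaf F ξ', (⊤ : ξ'.S.Opens))) := by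
  have hτ' := isFrame_sheafPull F a' C.le hτ
  have key : ∀ k : Fin r → ι → Γ(ξ.S, W),
      (∑ i : Fin r, w ^ (i : ℕ) • sheafPull F a' C.le (∑ j, k i j • τ j) :
        Γ(sheaf F ξ', (⊤ : ξ'.S.Opens))) =
      ∑ j, (∑ i : Fin r, w ^ (i : ℕ) * (base a').appLE W ⊤ C.le (k i j)) •
        (sheaf F ξ').res le_rfl (sheafPull F a' C.le (τ j)) := by
    intro k
    simp only [map_sum, sheafPull_smul F, Finset.smul_sum, Finset.sum_smul, res_self, ← mul_smul]
    exact Finset.sum_comm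
  have hexp : ∀ σ : Fin r → Γ(sheaf F ξ, W), ∃ k : Fin r → ι → Γ(ξ.S, W),
      σ = fun i => ∑ j, k i j • τ j := by
    intro σ
    refine ⟨fun i => hτ.coord le_rfl (σ i), funext fun i => ?_⟩
    have := hτ.sum_coord le_rfl (σ i)
    simpa only [res_self] using this.symm
  constructor
  · intro σ σ' h
    obtain ⟨k, rfl⟩ := hexp σ
    obtain ⟨k', rfl⟩ := hexp σ'
    simp only [key] at h
    have h1 := hτ'.ext le_rfl h
    have h2 : k = k' := by
      funext i j
      exact congrFun (C.bijective.1 (congrFun h1 j)) i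
    rw [h2]
  · intro y
    choose k hk using fun j => C.bijective.2 (hτ'.coord le_rfl y j)
    refine ⟨fun i => ∑ j, k j i • τ j, ?_⟩
    refine (key fun i j => k j i).trans ?_
    simp only at hk
    simp only [hk]
    exact hτ'.sum_coord le_rfl y

variable {s₀ : Γ(X, U)} {T : Γ(ξ₀.S, ⊤)} {e₀ : Γ(ξ₀.M, ⊤)}

/-- The decomposition `n = ∑ i < r, z ^ i σ i` of a section `n` of `F ξ₀` over the atlas into its
components for the action of the group of `r`-th roots of unity, expressed on an arbitrary object
`ξ` with a generator `m` of its invertible sheaf: `z` is the ratio of `m` and `e₀`. -/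
def IsWeightDecomposition (e₀ : Γ(ξ₀.M, ⊤)) (n : Γ(sheaf F ξ₀, (⊤ : ξ₀.S.Opens))) {W : ξ.S.Opens}
    (m : Γ(ξ.M, W)) (σ : Fin r → Γ(sheaf F ξ, W)) : Prop :=
  ∀ (ζ : RootStack L s r) (a : ζ ⟶ ξ) (b : ζ ⟶ ξ₀) (e : ⊤ ≤ base a ⁻¹ᵁ W) (z : Γ(ζ.S, ⊤)),
    tautPull a e m = z • tautPull b (le_preimage_top (base b) ⊤) e₀ →
      sheafPull F b (le_preimage_top (base b) ⊤) n =
        (∑ i : Fin r, z ^ (i : ℕ) • sheafPull F a e (σ i) : Γ(sheaf F ζ, (⊤ : ζ.S.Opens)))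

namespace IsWeightDecomposition

variable {F} {n : Γ(sheaf F ξ₀, (⊤ : ξ₀.S.Opens))} {W : ξ.S.Opens} {m : Γ(ξ.M, W)}
  {σ σ' : Fin r → Γ(sheaf F ξ, W)}

lemma res (h : IsWeightDecomposition F e₀ n m σ) {W' : ξ.S.Opens} (hW : W' ≤ W) :
    IsWeightDecomposition F e₀ n (ξ.M.res hW m) fun i => (sheaf F ξ).res hW (σ i) := by
  intro ζ a b e z hz
  rw [tautPull_res] at hz
  refine (h ζ a b _ z hz).trans ?_
  simp only [sheafPull_res F]

lemma pull (h : IsWeightDecomposition F e₀ n m σ) (a : η ⟶ ξ) {V : η.S.Opens}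
    (hV : V ≤ base a ⁻¹ᵁ W) :
    IsWeightDecomposition F e₀ n (tautPull a hV m) fun i => sheafPull F a hV (σ i) := by
  intro ζ a' b e z hz
  have e' : ⊤ ≤ base (a' ≫ a) ⁻¹ᵁ W := e.trans ((base a').preimage_mono hV)
  rw [tautPull_tautPull a' a e hV e'] at hz
  refine (h ζ (a' ≫ a) b e' z hz).trans ?_
  refine Finset.sum_congr rfl fun i _ => congrArg _ ?_
  exact (sheafPull_sheafPull F a' a e hV e' _).symm

/-- Multiplying the generator by a unit `z` multiplies the component of weight `i` by `z⁻¹ ^ i`; the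
line that it spans does not change. -/
lemma unit_smul (h : IsWeightDecomposition F e₀ n m σ) {z z' : Γ(ξ.S, W)} (hz : z * z' = 1) :
    IsWeightDecomposition F e₀ n (z • m) fun i => z' ^ (i : ℕ) • σ i := by
  intro ζ a b e y hy
  have h1 : tautPull a e m =
      ((base a).appLE W ⊤ e z' * y) • tautPull b (le_preimage_top (base b) ⊤) e₀ := by
    rw [mul_smul, ← hy, tautPull_smul, ← mul_smul, ← map_mul, mul_comm, hz, map_one, one_smul]
  refine (h ζ a b e _ h1).trans ?_
  refine Finset.sum_congr rfl fun i _ => ?_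
  rw [sheafPull_smul F, ← mul_smul, mul_pow, mul_comm, map_pow]

/-- The components are unique, because on the fibre product with the atlas they are the coefficients
of the powers of `w`. -/
lemma unique (hr : 1 ≤ r) (A : IsAtlas ℓ s₀ ξ₀ T e₀) (hW : W ≤ ξ.f ⁻¹ᵁ U) (hm : IsGen m)
    (h : IsWeightDecomposition F e₀ n m σ) (h' : IsWeightDecomposition F e₀ n m σ') :
    σ = σ' := by
  suffices H : ∀ p ∈ W, ∃ W' : ξ.S.Opens, p ∈ W' ∧ ∃ hW' : W' ≤ W,
      ∀ i, (sheaf F ξ).res hW' (σ i) = (sheaf F ξ).res hW' (σ' i) by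
    funext i
    apply sec_ext
    intro p hp
    obtain ⟨W', hp', hW', hσ⟩ := H p hp
    exact ⟨W', hp', hW', hσ i⟩
  intro p hp
  obtain ⟨O, hpO, k, τ, hτ⟩ := (isLocallyFree_sheaf F ξ).exists_isFrame p
  obtain ⟨W', hW'a, hpW', hW'⟩ := exists_isAffineOpen_mem_and_subset (U := O ⊓ W) ⟨hpO, hp⟩
  have hW'W : W' ≤ W := fun q hq => (hW' hq).2
  refine ⟨W', hpW', hW'W, ?_⟩
  obtain ⟨c, d, H⟩ := exists_isTriv A.isGen (hW'W.trans hW) (hm.res hW'W)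
  obtain ⟨ξ', a', b', w, C⟩ := A.exists_isCover hr hW'a H
  have hτ' := hτ.res (fun q hq => (hW' hq).1 : W' ≤ O)
  have h1 := h.res hW'W ξ' a' b' C.1.le w (C.2.2 _ _)
  have h2 := h'.res hW'W ξ' a' b' C.1.le w (C.2.2 _ _)
  exact congrFun ((bijective_sum_pow_smul_pull F C.1 hτ').1 (h1.symm.trans h2))

end IsWeightDecomposition

/-- Components exist: the inverse image of `n` on the fibre product with the atlas is a sum
`∑ i < r, w ^ i σ i`, and every pair of arrows to `ξ` and to the atlas factors through this fibre
product. -/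
lemma exists_isWeightDecomposition (hr : 1 ≤ r) (A : IsAtlas ℓ s₀ ξ₀ T e₀)
    (n : Γ(sheaf F ξ₀, (⊤ : ξ₀.S.Opens))) {W : ξ.S.Opens} (hWa : IsAffineOpen W)
    (hW : W ≤ ξ.f ⁻¹ᵁ U) {m : Γ(ξ.M, W)} (hm : IsGen m) {ι : Type*} [Fintype ι]
    {τ : ι → Γ(sheaf F ξ, W)} (hτ : IsFrame τ) :
    ∃ σ, IsWeightDecomposition F e₀ n m σ := by
  obtain ⟨c, d, H⟩ := exists_isTriv A.isGen hW hm
  obtain ⟨ξ', a', b', w, C⟩ := A.exists_isCover hr hWa H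
  obtain ⟨σ, hσ⟩ := (bijective_sum_pow_smul_pull F C.1 hτ).2
    (sheafPull F b' (le_preimage_top (base b') ⊤) n)
  refine ⟨σ, fun ζ a b e z hz => ?_⟩
  obtain ⟨g, rfl, rfl⟩ := A.exists_factor hr H C a b e
  have h1 : z = (base g).appLE ⊤ ⊤ (le_preimage_top (base g) ⊤) w := by
    apply (isGen_tautPull (g ≫ b') (le_preimage_top (base (g ≫ b')) ⊤) A.isTriv.isGen).smul_inj
    rw [← hz, ← tautPull_tautPull g b' (le_preimage_top (base g) ⊤)
      (le_preimage_top (base b') ⊤), ← tautPull_smul, ← C.2.2 C.1.le, tautPull_tautPull]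
  rw [← sheafPull_sheafPull F g b' (le_preimage_top (base g) ⊤) (le_preimage_top (base b') ⊤),
    ← hσ, map_sum]
  refine Finset.sum_congr rfl fun i _ => ?_
  rw [sheafPull_smul F, h1, map_pow]
  congr 1
  exact sheafPull_sheafPull F g a' (le_preimage_top (base g) ⊤) C.1.le e (σ i)

/-- On the atlas itself, the section is the sum of its components. -/
lemma IsWeightDecomposition.sum_eq {n : Γ(sheaf F ξ₀, (⊤ : ξ₀.S.Opens))}
    {σ : Fin r → Γ(sheaf F ξ₀, (⊤ : ξ₀.S.Opens))} (h : IsWeightDecomposition F e₀ n e₀ σ) :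
    n = ∑ i, σ i := by
  have := h ξ₀ (𝟙 ξ₀) (𝟙 ξ₀) (le_preimage_top (base (𝟙 ξ₀)) ⊤) 1 (one_smul _ _).symm
  simp only [sheafPull_id F le_rfl, res_self, one_pow, one_smul] at this
  exact this

end AlgebraicGeometry.RootStack

/-! ### Homogeneous frames over the atlas -/

namespace AlgebraicGeometry
open Scheme.Modules

namespace IsCyclicCover

variable {S S' : Scheme.{u}} {h : S' ⟶ S} {W : S.Opens} {v : Γ(S, W)} {r : ℕ} {w : Γ(S', ⊤)}

/-- Over a zero `x` of `v` the cyclic cover has the point `w = 0`, with values in the residue field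
of `x`. -/
lemma exists_preimage_eq (C : IsCyclicCover h v r w) (hr : 1 ≤ r) {x : S} (hx : x ∈ W)
    (hxv : x ∉ S.basicOpen v) : ∃ y, h y = x := by
  let g := S.fromSpecResidueField x
  have hg : ∀ t, g t = x := S.fromSpecResidueField_apply x
  have e : ⊤ ≤ g ⁻¹ᵁ W := by
    intro t _
    change g t ∈ W
    rwa [hg]
  have h0 : g.appLE W ⊤ e v = 0 := by
    rw [← basicOpen_eq_bot_iff, Scheme.basicOpen_appLE, eq_bot_iff]
    rintro t ⟨-, ht⟩
    have ht : g t ∈ S.basicOpen v := ht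
    rw [hg] at ht
    exact hxv ht
  obtain ⟨q, hq, -⟩ := C.exists_lift g e 0 (by rw [h0, zero_pow (by omega)])
  let t : Spec (S.residueField x) := Nonempty.some inferInstance
  refine ⟨q t, ?_⟩
  change (q ≫ h) t = x
  rw [hq]
  exact hg t

/-- Over a zero of `v` the cyclic cover has at most one point: the function `w` vanishes there, so
that the value of a function `∑ i < r, w ^ i k i` is that of `k 0`. -/
lemma eq_of_apply_eq (C : IsCyclicCover h v r w) (hr : 1 ≤ r) {y y' : S'} (hy : h y = h y')
    (hyv : h y ∉ S.basicOpen v) : y = y' := by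
  have := C.isAffine
  have hw : ∀ y : S', h y ∉ S.basicOpen v →
      S'.evaluation ⊤ y (TopologicalSpace.Opens.mem_top y) w = 0 := by
    intro y hy
    rw [Scheme.evaluation_eq_zero_iff_notMem_basicOpen]
    intro hyw
    apply hy
    rw [← S'.basicOpen_pow w (n := r) (by omega), C.pow_eq, Scheme.basicOpen_appLE] at hyw
    exact hyw.2
  have hmem : ∀ y : S', h y ∉ S.basicOpen v → ∀ k : Fin r → Γ(S, W),
      y ∈ S'.basicOpen (∑ i : Fin r, w ^ (i : ℕ) * h.appLE W ⊤ C.le (k i)) ↔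
        h y ∈ S.basicOpen (k ⟨0, hr⟩) := by
    intro y hy k
    rw [← Scheme.evaluation_ne_zero_iff_mem_basicOpen _ y (TopologicalSpace.Opens.mem_top y),
      map_sum,
      Finset.sum_eq_single ⟨0, hr⟩]
    · rw [pow_zero, one_mul, Scheme.evaluation_ne_zero_iff_mem_basicOpen, Scheme.basicOpen_appLE]
      exact and_iff_right trivial
    · intro i _ hi
      have : (i : ℕ) ≠ 0 := fun h0 => hi (Fin.ext h0)
      rw [map_mul, map_pow, hw y hy, zero_pow this, zero_mul]
    · simp
  have key : ∀ c : Γ(S', ⊤), y ∈ S'.basicOpen c ↔ y' ∈ S'.basicOpen c := by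
    intro c
    obtain ⟨k, rfl⟩ := C.bijective.2 c
    exact (hmem y hyv k).trans ((iff_of_eq (by rw [hy])).trans (hmem y' (hy ▸ hyv) k).symm)
  refine ((isBasis_basicOpen S').inseparable_iff.mpr ?_).eq
  rintro _ ⟨_, ⟨c, rfl⟩, rfl⟩
  exact key c

end IsCyclicCover

/-- A spanning family of vectors of `K ^ ι` has a nonzero maximal minor. -/
lemma exists_det_ne_zero {K : Type*} [Field K] {ι κ : Type*} [Fintype ι] [DecidableEq ι]
    (v : κ → ι → K) (hv : Submodule.span K (Set.range v) = ⊤) :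
    ∃ f : ι → κ, (Matrix.of fun k => v (f k)).det ≠ 0 := by
  obtain ⟨κ', a, -, hsp, hli⟩ := exists_linearIndependent' K v
  let b : Module.Basis κ' K (ι → K) := .mk hli (by rw [hsp, hv])
  let e := b.indexEquiv (Pi.basisFun K ι)
  refine ⟨a ∘ e.symm, ?_⟩
  rw [← isUnit_iff_ne_zero, ← Matrix.isUnit_iff_isUnit_det,
    ← Matrix.linearIndependent_rows_iff_isUnit]
  exact hli.comp e.symm e.symm.injective

namespace RootStack

variable {X : Scheme.{u}} {L : X.Modules} {s : Γ(L, ⊤)} {r : ℕ}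
  {ξ η ζ ξ₀ : RootStack L s r} {U : X.Opens} {ℓ : Γ(L, U)}
  (F : StackVect (toScheme L s r))
  {s₀ : Γ(X, U)} {T : Γ(ξ₀.S, ⊤)} {e₀ : Γ(ξ₀.M, ⊤)}

lemma IsTriv.of_res {U' : X.Opens} {h : U' ≤ U} {W : ξ.S.Opens} {hW : W ≤ ξ.f ⁻¹ᵁ U'}
    {m : Γ(ξ.M, W)} {c d : Γ(ξ.S, W)} (H : IsTriv (L.res h ℓ) ξ hW m c d) :
    IsTriv ℓ ξ (hW.trans (ξ.f.preimage_mono h)) m c d where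
  isGen := H.isGen
  t_eq := H.t_eq
  φ_eq := by rw [H.φ_eq, pullLE_res]

/-- After shrinking the base around a zero `x` of the section, `F` has a frame over the atlas,
because the atlas has a single point over `x`. -/
lemma exists_isAtlas_isFrame (hr : 1 ≤ r) (hU : IsAffineOpen U) (hℓ : IsGen ℓ)
    (hs₀ : L.res le_top s = s₀ • ℓ) {x : X} (hxU : x ∈ U) (hx : x ∉ X.basicOpen s₀) :
    ∃ (U : X.Opens) (ℓ : Γ(L, U)) (s₀ : Γ(X, U)) (ξ₀ : RootStack L s r) (T : _) (e₀ : _),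
      x ∈ U ∧ x ∉ X.basicOpen s₀ ∧ IsAtlas ℓ s₀ ξ₀ T e₀ ∧
      ∃ (k : ℕ) (β : Fin k → Γ(sheaf F ξ₀, (⊤ : ξ₀.S.Opens))), IsFrame β := by
  obtain ⟨ξ₀, T, e₀, A⟩ := exists_isAtlas (r := r) hr hU hℓ hs₀
  obtain ⟨y, rfl⟩ := A.isCyclicCover.exists_preimage_eq hr hxU hx
  obtain ⟨O, hyO, k, β, hβ⟩ := (isLocallyFree_sheaf F ξ₀).exists_isFrame y
  obtain ⟨U₁, hxU₁, hU₁⟩ := A.isCyclicCover.exists_preimage_le O _ hxU fun y' hy' => by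
    rwa [← A.isCyclicCover.eq_of_apply_eq hr hy'.symm hx]
  obtain ⟨U₂, hU₂a, hxU₂, hU₂⟩ := exists_isAffineOpen_mem_and_subset (U := U₁ ⊓ U) ⟨hxU₁, hxU⟩
  have hU₂U : U₂ ≤ U := fun q hq => (hU₂ hq).2
  have hs₁ : L.res le_top s = fres hU₂U s₀ • L.res hU₂U ℓ := by
    rw [← res_smul, ← hs₀, res_res]
  obtain ⟨ξ₁, T₁, e₁, A₁⟩ := exists_isAtlas (r := r) hr hU₂a (hℓ.res hU₂U) hs₁
  have e : ⊤ ≤ ξ₁.f ⁻¹ᵁ U := A₁.isCyclicCover.le.trans (ξ₁.f.preimage_mono hU₂U)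
  obtain ⟨q, hq, hqT⟩ := A.isCyclicCover.exists_lift ξ₁.f e T₁ (by
    rw [A₁.isCyclicCover.pow_eq, appLE_fres])
  have H : IsTriv ℓ ξ₁ e e₁ T₁ 1 := A₁.isTriv.of_res
  rw [← hqT, ← map_one (q.appLE ⊤ ⊤ (le_preimage_top q ⊤)).hom] at H
  obtain ⟨a, ha, -⟩ := exists_hom A.isTriv q hq (le_preimage_top q ⊤) H
  have hle : ⊤ ≤ base a ⁻¹ᵁ O := by
    refine le_trans ?_ ((base a).preimage_mono hU₁)
    rw [← preimage_f_eq]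
    exact A₁.isCyclicCover.le.trans (ξ₁.f.preimage_mono fun q hq => (hU₂ hq).1)
  refine ⟨U₂, L.res hU₂U ℓ, fres hU₂U s₀, ξ₁, T₁, e₁, hxU₂, ?_, A₁, k, _,
    isFrame_sheafPull F a hle hβ⟩
  intro h
  exact hx (by
    have : X.basicOpen (fres hU₂U s₀) ≤ X.basicOpen s₀ := by
      have := X.basicOpen_res s₀ (homOfLE hU₂U).op
      exact this.le.trans inf_le_right
    exact this h)

/-- Near a zero `x` of the section, the homogeneous components of the members of a frame contain
a frame: they generate `F` at the only point of the atlas over `x`. -/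
lemma IsAtlas.exists_isFrame_component (hr : 1 ≤ r) (A : IsAtlas ℓ s₀ ξ₀ T e₀) {x : X}
    (hxU : x ∈ U) (hx : x ∉ X.basicOpen s₀) {k : ℕ}
    {β : Fin k → Γ(sheaf F ξ₀, (⊤ : ξ₀.S.Opens))} (hβ : IsFrame β)
    {σ : Fin k → Fin r → Γ(sheaf F ξ₀, (⊤ : ξ₀.S.Opens))}
    (hσ : ∀ j, β j = ∑ i, σ j i) :
    ∃ (f : Fin k → Fin k × Fin r) (U' : X.Opens), x ∈ U' ∧ U' ≤ U ∧
      IsFrame fun l => (sheaf F ξ₀).res (le_top : ξ₀.f ⁻¹ᵁ U' ≤ ⊤) (σ (f l).1 (f l).2) := by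
  obtain ⟨y, rfl⟩ := A.isCyclicCover.exists_preimage_eq hr hxU hx
  let D : Fin k × Fin r → Fin k → Γ(ξ₀.S, ⊤) := fun p => hβ.coord le_rfl (σ p.1 p.2)
  have hD : ∀ p, ∑ l, D p l • β l = σ p.1 p.2 := by
    intro p
    have := hβ.sum_coord le_rfl (σ p.1 p.2)
    simpa only [res_self] using this
  have hsum : ∀ j, ∑ i, D (j, i) = Pi.single j 1 := by
    intro j
    apply hβ.ext le_rfl
    simp only [res_self, Finset.sum_apply, Finset.sum_smul]
    rw [Finset.sum_comm]
    simp only [hD, ← hσ]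
    simp [Pi.single_apply]
  let ev := (ξ₀.S.evaluation ⊤ y (TopologicalSpace.Opens.mem_top y)).hom
  let v : Fin k × Fin r → Fin k → ξ₀.S.residueField y := fun p l => ev (D p l)
  have hv : Submodule.span (ξ₀.S.residueField y) (Set.range v) = ⊤ := by
    rw [eq_top_iff, ← (Pi.basisFun (ξ₀.S.residueField y) (Fin k)).span_eq, Submodule.span_le]
    rintro _ ⟨j, rfl⟩
    have : Pi.basisFun (ξ₀.S.residueField y) (Fin k) j = ∑ i, v (j, i) := by
      funext l
      have := congrArg ev (congrFun (hsum j) l)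
      rw [Finset.sum_apply, map_sum] at this
      rw [Finset.sum_apply]
      refine Eq.trans ?_ this.symm
      simp [Pi.single_apply]
    rw [this]
    exact Submodule.sum_mem _ fun i _ => Submodule.subset_span ⟨_, rfl⟩
  obtain ⟨f, hf⟩ := exists_det_ne_zero v hv
  let Δ : Matrix (Fin k) (Fin k) Γ(ξ₀.S, ⊤) := .of fun l => D (f l)
  have hΔ : y ∈ ξ₀.S.basicOpen Δ.det := by
    rw [← Scheme.evaluation_ne_zero_iff_mem_basicOpen _ y (TopologicalSpace.Opens.mem_top y)]
    have := RingHom.map_det ev Δ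
    exact fun h => hf (this.symm.trans h)
  obtain ⟨U₁, hxU₁, hU₁⟩ := A.isCyclicCover.exists_preimage_le (ξ₀.S.basicOpen Δ.det) _ hxU
    fun y' hy' => by rwa [← A.isCyclicCover.eq_of_apply_eq hr hy'.symm hx]
  have hO := (hβ.res (le_top : ξ₀.S.basicOpen Δ.det ≤ ⊤)).of_isUnit_det
    (σ := fun l => (sheaf F ξ₀).res le_top (σ (f l).1 (f l).2))
    (Δ.map (fres le_top)) (by
      intro l
      rw [← hD (f l), map_sum]
      simp only [res_smul]
      rfl) (by
      have := RingHom.map_det (fres (le_top : ξ₀.S.basicOpen Δ.det ≤ ⊤)) Δ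
      refine this ▸ ?_
      exact RingedSpace.isUnit_res_basicOpen _ Δ.det)
  refine ⟨f, U₁ ⊓ U, ⟨hxU₁, hxU⟩, inf_le_right, ?_⟩
  have h1 := hO.res ((ξ₀.f.preimage_mono inf_le_left).trans hU₁ : ξ₀.f ⁻¹ᵁ (U₁ ⊓ U) ≤ _)
  simpa only [res_res] using h1

end RootStack

end AlgebraicGeometry

/-! ### Homogeneous frames on all objects -/

namespace AlgebraicGeometry
open Scheme.Modules

/-- A section which generates locally is a generator. -/
lemma Scheme.Modules.isGen_of_local {X : Scheme.{u}} {M : X.Modules} {W : X.Opens} {m : Γ(M, W)}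
    (h : ∀ p ∈ W, ∃ V : X.Opens, p ∈ V ∧ ∃ hV : V ≤ W, IsGen (M.res hV m)) : IsGen m := by
  have hinj : ∀ (V : X.Opens) (hV : V ≤ W),
      Function.Injective fun c : Γ(X, V) => c • M.res hV m := by
    intro V hV c c' hc
    apply fun_ext
    intro p hp
    obtain ⟨V₁, hpV₁, hV₁, hm⟩ := h p (hV hp)
    refine ⟨V₁ ⊓ V, ⟨hpV₁, hp⟩, inf_le_right, ?_⟩
    apply (hm.res (inf_le_left : V₁ ⊓ V ≤ V₁)).smul_inj
    have h1 := congrArg (M.res (inf_le_right : V₁ ⊓ V ≤ V)) hc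
    simpa only [res_smul, res_res] using h1
  refine isGen_of_bijective fun V hV => ⟨hinj V hV, fun x => ?_⟩
  obtain ⟨y, hy⟩ := exists_section_of_local (structureSheaf X) (V := V)
    (fun V' hV' y => (strEquiv X V').symm y • M.res (hV'.trans hV) m = M.res hV' x)
    (by
      intro p hp
      obtain ⟨V₁, hpV₁, hV₁, hm⟩ := h p (hV hp)
      obtain ⟨c, hc⟩ := hm.exists_smul (inf_le_left : V₁ ⊓ V ≤ V₁) (M.res inf_le_right x)
      refine ⟨V₁ ⊓ V, ⟨hpV₁, hp⟩, inf_le_right, strEquiv X _ c, ?_⟩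
      rw [AddEquiv.symm_apply_apply, hc, res_res])
    (fun V₁ h₁ V₂ h₂ y hy => by
      obtain ⟨c, rfl⟩ := (strEquiv X V₁).surjective y
      rw [AddEquiv.symm_apply_apply] at hy
      rw [res_strEquiv, AddEquiv.symm_apply_apply, ← res_res h₁ h₂, ← hy, res_smul, res_res])
    (fun V₁ h₁ y y' hy hy' => (strEquiv X V₁).symm.injective (hinj V₁ _ (hy.trans hy'.symm)))
  refine ⟨(strEquiv X V).symm y, sec_ext _ fun p hp => ?_⟩
  obtain ⟨V₁, hpV₁, hV₁, h1⟩ := hy p hp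
  refine ⟨V₁, hpV₁, hV₁, ?_⟩
  obtain ⟨c, rfl⟩ := (strEquiv X V).surjective y
  rw [res_strEquiv, AddEquiv.symm_apply_apply] at h1
  rw [AddEquiv.symm_apply_apply, res_smul, res_res, h1]

namespace RootStack

variable {X : Scheme.{u}} {L : X.Modules} {s : Γ(L, ⊤)} {r : ℕ}
  {ξ η ζ ξ₀ : RootStack L s r} {U : X.Opens} {ℓ : Γ(L, U)}
  (F : StackVect (toScheme L s r))
  {s₀ : Γ(X, U)} {T : Γ(ξ₀.S, ⊤)} {e₀ : Γ(ξ₀.M, ⊤)}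

variable {F} in
/-- If suitable components of sections on the atlas form a frame of `F ξ₀`, then the corresponding
components on any object `ξ` form a frame of `F ξ`. They do so on the fibre product of `ξ` with the
atlas, where they agree with the components on the atlas up to units, and being a basis descends
along the cyclic cover `w ^ r = d`. -/
lemma IsAtlas.isFrame_of_isWeightDecomposition (hr : 1 ≤ r) (A : IsAtlas ℓ s₀ ξ₀ T e₀)
    {ι κ : Type*} [Fintype ι] {n : κ → Γ(sheaf F ξ₀, (⊤ : ξ₀.S.Opens))}
    {ν : κ → Fin r → Γ(sheaf F ξ₀, (⊤ : ξ₀.S.Opens))}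
    (hν : ∀ j, IsWeightDecomposition F e₀ (n j) e₀ (ν j)) {f : ι → κ × Fin r} {U' : X.Opens}
    (hU' : U' ≤ U)
    (hf : IsFrame fun l => (sheaf F ξ₀).res (le_top : ξ₀.f ⁻¹ᵁ U' ≤ ⊤) (ν (f l).1 (f l).2))
    {W : ξ.S.Opens} (hWa : IsAffineOpen W) (hW : W ≤ ξ.f ⁻¹ᵁ U') {m : Γ(ξ.M, W)} (hm : IsGen m)
    {μ : Type*} [Fintype μ] {τ : μ → Γ(sheaf F ξ, W)} (hτ : IsFrame τ)
    {σ : κ → Fin r → Γ(sheaf F ξ, W)}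
    (hσ : ∀ j, IsWeightDecomposition F e₀ (n j) m (σ j)) :
    IsFrame fun l => σ (f l).1 (f l).2 := by
  have hWU := hW.trans (ξ.f.preimage_mono hU')
  obtain ⟨c, d, H⟩ := exists_isTriv A.isGen hWU hm
  obtain ⟨ξ', a', b', w, C⟩ := A.exists_isCover hr hWa H
  obtain ⟨w', hw'⟩ := C.2.1.exists_right_inv
  have hle : ⊤ ≤ base a' ⁻¹ᵁ W := C.1.le
  have hb' : ⊤ ≤ base b' ⁻¹ᵁ (ξ₀.f ⁻¹ᵁ U') := by
    rw [← preimage_f_eq]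
    exact preimage_le_of_hom a' hW hle
  have hξ' := preimage_le_of_hom a' hWU hle
  -- over the cover the components of the two decompositions agree up to powers of `w`
  have h1 : ∀ j i, sheafPull F a' hle (σ j i) =
      w' ^ (i : ℕ) • sheafPull F b' (le_preimage_top (base b') ⊤) (ν j i) := by
    intro j i
    have h2 := (hσ j).pull a' hle
    have h3 := ((hν j).pull b' (le_preimage_top (base b') ⊤)).unit_smul hw'
    rw [← C.2.2 hle] at h3
    exact congrFun (h2.unique hr A hξ' (isGen_tautPull a' hle hm) h3) i
  have hframe : IsFrame fun l => sheafPull F a' hle (σ (f l).1 (f l).2) := by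
    simp only [h1]
    have h4 := isFrame_sheafPull F b' hb' hf
    simp only [sheafPull_res] at h4
    exact h4.unit_smul fun l => (IsUnit.of_mul_eq_one_right _ hw').pow _
  have hexp := bijective_sum_pow_smul_pull F C.1 hτ
  have key : ∀ k : ι → Γ(ξ.S, W), sheafPull F a' hle (∑ l, k l • σ (f l).1 (f l).2) =
      ∑ l, (base a').appLE W ⊤ hle (k l) •
        (sheaf F ξ').res le_rfl (sheafPull F a' hle (σ (f l).1 (f l).2)) := by
    intro k
    simp only [map_sum, sheafPull_smul F, res_self]
  have h0 : ∀ y : Γ(sheaf F ξ, W),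
      (∑ i : Fin r, w ^ (i : ℕ) • sheafPull F a' hle ((Pi.single ⟨0, hr⟩ y : Fin r → _) i) :
        Γ(sheaf F ξ', (⊤ : ξ'.S.Opens))) = sheafPull F a' hle y := by
    intro y
    rw [Finset.sum_eq_single ⟨0, hr⟩]
    · rw [pow_zero, one_smul, Pi.single_eq_same]
    · intro i _ hi
      rw [Pi.single_eq_of_ne hi, map_zero, smul_zero]
    · simp
  -- coordinates on the base are recovered as coefficients of `w ^ 0` on the cover
  refine hτ.of_bijective ⟨fun k k' hk => ?_, fun y => ?_⟩
  · have h5 := congrArg (sheafPull F a' hle) hk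
    simp only [key] at h5
    have h6 := hframe.ext le_rfl h5
    funext l
    have h7 : ∀ x : Γ(ξ.S, W), (∑ i : Fin r, w ^ (i : ℕ) *
        (base a').appLE W ⊤ hle ((Pi.single ⟨0, hr⟩ x : Fin r → _) i) : Γ(ξ'.S, ⊤)) =
          (base a').appLE W ⊤ hle x := by
      intro x
      rw [Finset.sum_eq_single ⟨0, hr⟩]
      · rw [pow_zero, one_mul, Pi.single_eq_same]
      · intro i _ hi
        rw [Pi.single_eq_of_ne hi, map_zero, mul_zero]
      · simp
    have h8 := C.1.bijective.1 ((h7 (k l)).trans ((congrFun h6 l).trans (h7 (k' l)).symm))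
    simpa only [Pi.single_eq_same] using congrFun h8 ⟨0, hr⟩
  · -- the coefficient of `w ^ 0` of the coordinates of the pullback of `y`
    choose k hk using fun l => C.1.bijective.2 (hframe.coord le_rfl (sheafPull F a' hle y) l)
    refine ⟨fun l => k l ⟨0, hr⟩, ?_⟩
    have h5 : (∑ i : Fin r, w ^ (i : ℕ) • sheafPull F a' hle (∑ l, k l i • σ (f l).1 (f l).2) :
        Γ(sheaf F ξ', (⊤ : ξ'.S.Opens))) = sheafPull F a' hle y := by
      refine Eq.trans ?_ (hframe.sum_coord le_rfl (sheafPull F a' hle y))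
      simp only at hk
      simp only [key, ← hk, Finset.smul_sum, Finset.sum_smul, ← mul_smul]
      exact Finset.sum_comm
    have h6 := hexp.1 (h5.trans (h0 y).symm)
    have h7 := congrFun h6 ⟨0, hr⟩
    rw [Pi.single_eq_same] at h7
    exact h7

/-- Frame systems on an open substack, in terms of the sheaves on the root stack. -/
def frameSystemMk {P : ObjectProperty (RootStack L s r)} {ι : Type*} [Fintype ι]
    (frames : ∀ (ξ : RootStack L s r) (W : ξ.S.Opens), Set (ι → Γ(sheaf F ξ, W)))
    (isFrame : ∀ (ξ) (W : ξ.S.Opens) (τ : ι → Γ(sheaf F ξ, W)), P ξ → τ ∈ frames ξ W → IsFrame τ)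
    (exists_mem : ∀ ξ, P ξ → ∀ x : ξ.S, ∃ W : ξ.S.Opens, x ∈ W ∧ (frames ξ W).Nonempty)
    (exists_smul : ∀ (ξ) (W : ξ.S.Opens) (τ τ' : ι → Γ(sheaf F ξ, W)), P ξ →
      τ ∈ frames ξ W → τ' ∈ frames ξ W →
      ∀ i, ∃ c : Γ(ξ.S, W), τ' i = c • τ i)
    (pull_mem : ∀ {ξ η : RootStack L s r} (a : ξ ⟶ η) {V : η.S.Opens} {W : ξ.S.Opens}
      (h : W ≤ base a ⁻¹ᵁ V) (τ : ι → Γ(sheaf F η, V)), τ ∈ frames η V →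
        (fun i => sheafPull F a h (τ i)) ∈ frames ξ W) :
    StackVect.FrameSystem (F.restrict P) ι where
  frames ξ W := frames ξ.obj W
  isFrame {ξ W τ} h := isFrame ξ.obj W τ ξ.property h
  exists_mem ξ x := exists_mem ξ.obj ξ.property x
  exists_smul {ξ W τ τ'} h h' i := exists_smul ξ.obj W τ τ' ξ.property h h' i
  pull_mem a _ _ h τ hτ := pull_mem a.hom h τ hτ

end RootStack

end AlgebraicGeometry

/-! ### Frame systems on the root stack -/

namespace AlgebraicGeometry
open Scheme.Modules

namespace RootStack

variable {X : Scheme.{u}} {L : X.Modules} {s : Γ(L, ⊤)} {r : ℕ}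
  {ξ η ζ ξ₀ : RootStack L s r} {U : X.Opens} {ℓ : Γ(L, U)}
  (F : StackVect (toScheme L s r))
  {s₀ : Γ(X, U)} {T : Γ(ξ₀.S, ⊤)} {e₀ : Γ(ξ₀.M, ⊤)}

/-- Where the section vanishes at `x`, the frames consist of homogeneous components of the
members of a frame over the atlas. -/
lemma exists_frameSystem_of_notMem (hr : 1 ≤ r) (hU : IsAffineOpen U) (hℓ : IsGen ℓ)
    (hs₀ : L.res le_top s = s₀ • ℓ) {x : X} (hxU : x ∈ U) (hx : x ∉ X.basicOpen s₀) :
    ∃ U' : X.Opens, x ∈ U' ∧ ∃ k : ℕ,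
      Nonempty (StackVect.FrameSystem (F.restrict (preimage L s r U')) (Fin k)) := by
  obtain ⟨U, ℓ, s₀, ξ₀, T, e₀, hxU, hx, A, k, β, hβ⟩ :=
    exists_isAtlas_isFrame F hr hU hℓ hs₀ hxU hx
  have : IsAffine ξ₀.S := A.isCyclicCover.isAffine
  choose ν hν using fun j => exists_isWeightDecomposition F hr A (β j) (isAffineOpen_top ξ₀.S)
    A.isCyclicCover.le A.isTriv.isGen hβ
  obtain ⟨f, U', hxU', hU'U, hf⟩ := A.exists_isFrame_component F hr hxU hx hβ
    fun j => (hν j).sum_eq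
  refine ⟨U', hxU', k, ⟨frameSystemMk F
    (fun ξ W => {τ | IsFrame τ ∧ ∃ m : Γ(ξ.M, W), IsGen m ∧
      ∃ σ : Fin k → Fin r → Γ(sheaf F ξ, W),
        (∀ j, IsWeightDecomposition F e₀ (β j) m (σ j)) ∧ ∀ l, τ l = σ (f l).1 (f l).2})
    (fun _ _ _ _ h => h.1) ?_ ?_ ?_⟩⟩
  · intro ξ hξ p
    obtain ⟨O, hpO, n, τ, hτ⟩ := (isLocallyFree_sheaf F ξ).exists_isFrame p
    obtain ⟨O', hpO', m, hm⟩ := ξ.isInvertible.exists_isGen p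
    obtain ⟨W, hWa, hpW, hW⟩ := exists_isAffineOpen_mem_and_subset (U := O ⊓ O') ⟨hpO, hpO'⟩
    have hWO : W ≤ O := fun q hq => (hW hq).1
    have hWO' : W ≤ O' := fun q hq => (hW hq).2
    have hWU' : W ≤ ξ.f ⁻¹ᵁ U' := hξ.symm ▸ le_top
    choose σ hσ using fun j => exists_isWeightDecomposition F hr A (β j) hWa
      (hWU'.trans (ξ.f.preimage_mono hU'U)) (hm.res hWO') (hτ.res hWO)
    exact ⟨W, hpW, _, A.isFrame_of_isWeightDecomposition hr hν hU'U hf hWa hWU' (hm.res hWO')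
      (hτ.res hWO) hσ, _, hm.res hWO', σ, hσ, fun _ => rfl⟩
  -- two generators differ by a unit, hence the components of weight `i` by its `i`-th power
  · rintro ξ W τ τ' hξ ⟨-, m, hm, σ, hσ, hτ⟩ ⟨-, m', hm', σ', hσ', hτ'⟩ l
    have hWU' : W ≤ ξ.f ⁻¹ᵁ U' := hξ.symm ▸ le_top
    obtain ⟨z, hz⟩ := hm.exists_smul le_rfl m'
    rw [res_self] at hz
    rw [hz] at hm'
    obtain ⟨z', hzz'⟩ := (hm.isUnit hm').exists_right_inv
    have h1 := (hσ (f l).1).unit_smul hzz'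
    rw [← hz] at h1 hm'
    refine ⟨z' ^ ((f l).2 : ℕ), ?_⟩
    rw [hτ, hτ', (hσ' (f l).1).unique hr A (hWU'.trans (ξ.f.preimage_mono hU'U)) hm' h1]
  · rintro ξ η a V W h τ ⟨hτ, m, hm, σ, hσ, hτσ⟩
    exact ⟨isFrame_sheafPull F a h hτ, _, isGen_tautPull a h hm, _, fun j => (hσ j).pull a h,
      fun l => congrArg _ (hτσ l)⟩

/-- Where the section generates `L`, it generates the invertible sheaf of every object. -/
lemma isGen_t (hr : 1 ≤ r) (hℓ : IsGen ℓ) (hs₀ : L.res le_top s = s₀ • ℓ) (hu : IsUnit s₀)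
    (hξ : ⊤ ≤ ξ.f ⁻¹ᵁ U) : IsGen ξ.t := by
  apply isGen_of_local
  intro p _
  obtain ⟨O, hpO, m, hm⟩ := ξ.isInvertible.exists_isGen p
  obtain ⟨c, d, H⟩ := exists_isTriv hℓ (le_top.trans hξ) hm
  have h1 : IsUnit (d * c ^ r) := by
    rw [H.rel hℓ hs₀]
    exact hu.map _
  refine ⟨O, hpO, le_top, ?_⟩
  rw [H.t_eq]
  exact hm.unit_smul ((isUnit_pow_iff (by omega)).mp (isUnit_of_mul_isUnit_right h1))

/-- Where the section does not vanish, the root stack is the base scheme: its object `η` over an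
open subscheme is terminal, and the frames are the inverse images of a frame of `F η`. -/
lemma exists_frameSystem_of_isUnit (hr : 1 ≤ r) (hℓ : IsGen ℓ)
    (hs₀ : L.res le_top s = s₀ • ℓ) (hu : IsUnit s₀) {x : X} (hxU : x ∈ U) :
    ∃ U' : X.Opens, x ∈ U' ∧ ∃ k : ℕ,
      Nonempty (StackVect.FrameSystem (F.restrict (preimage L s r U')) (Fin k)) := by
  have hUι : ⊤ ≤ U.ι ⁻¹ᵁ U := fun y _ => y.2
  obtain ⟨η, hη, e, _, b, H, hoi, hrange, rfl⟩ := exists_object (r := r) hℓ hs₀ U.ι hUι 1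
    (U.ι.appLE U ⊤ hUι s₀) (hu.map _) (by rw [one_pow, mul_one])
    (fun S f a b => IsOpenImmersion f ∧ Set.range f = U ∧ a = 1)
    ⟨inferInstance, Scheme.Opens.range_ι U, rfl⟩
  obtain ⟨y, rfl⟩ : ∃ y, η.f y = x := by
    have : x ∈ Set.range η.f := by
      rw [hrange]
      exact hxU
    exact this
  have hb := H.rel hℓ hs₀
  rw [one_pow, mul_one] at hb
  have ht := H.t_eq
  rw [res_self, one_smul] at ht
  -- on an object over `U` the section `t` is a generator, to which an arrow to `η` pulls `e` back
  have hhom : ∀ ξ : RootStack L s r, ⊤ ≤ ξ.f ⁻¹ᵁ U → Nonempty (ξ ⟶ η) := by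
    intro ξ hξ
    have hle : Set.range ξ.f ⊆ Set.range η.f := by
      rw [hrange]
      rintro _ ⟨p, rfl⟩
      exact hξ (TopologicalSpace.Opens.mem_top p)
    let q := IsOpenImmersion.lift η.f ξ.f hle
    have hq : q ≫ η.f = ξ.f := IsOpenImmersion.lift_fac _ _ _
    have hgen := isGen_t hr hℓ hs₀ hu hξ
    obtain ⟨c, d, Hξ⟩ := exists_isTriv hℓ hξ hgen
    have hc : c = 1 := by
      apply hgen.smul_inj
      rw [← Hξ.t_eq, res_self, one_smul]
    subst hc
    have hd := Hξ.rel hℓ hs₀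
    have e' : ⊤ ≤ (q ≫ η.f) ⁻¹ᵁ U := by rw [hq]; exact hξ
    have hd' : d = q.appLE ⊤ ⊤ (le_preimage_top q ⊤) b := by
      rw [one_pow, mul_one] at hd
      rw [hd, hb]
      refine Eq.trans ?_ (appLE_appLE q η.f (le_preimage_top q ⊤) hη e' s₀).symm
      simp only [hq]
    rw [hd', ← map_one (q.appLE ⊤ ⊤ (le_preimage_top q ⊤)).hom] at Hξ
    obtain ⟨a, -⟩ := exists_hom H q hq (le_preimage_top q ⊤) Hξ
    exact ⟨a⟩
  have hsub : ∀ (ξ : RootStack L s r) (a a' : ξ ⟶ η), a = a' := by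
    intro ξ a a'
    have hb : base a = base a' := by
      rw [← cancel_mono η.f]
      exact (base_f a).trans (base_f a').symm
    refine hom_ext_of_isGen hb H.isGen (le_preimage_top _ _) (le_preimage_top _ _) ?_
    rw [← ht]
    exact (tautPull_t a).trans (tautPull_t a').symm
  obtain ⟨O, hyO, k, β, hβ⟩ := (isLocallyFree_sheaf F η).exists_isFrame y
  refine ⟨η.f ''ᵁ O, ⟨y, hyO, rfl⟩, k, ⟨frameSystemMk F
    (fun ξ W => {τ | ∃ (a : ξ ⟶ η) (h : W ≤ base a ⁻¹ᵁ O), τ = fun l => sheafPull F a h (β l)})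
    ?_ ?_ ?_ ?_⟩⟩
  · rintro ξ W _ - ⟨a, h, rfl⟩
    exact isFrame_sheafPull F a h hβ
  · intro ξ hξ p
    have hξU : ⊤ ≤ ξ.f ⁻¹ᵁ U := by
      rw [← show _ = ⊤ from hξ]
      rintro p ⟨q, -, hq⟩
      have h1 : η.f q ∈ U := hη (TopologicalSpace.Opens.mem_top q)
      have h2 : η.f q = ξ.f p := hq
      rw [h2] at h1
      exact h1
    obtain ⟨a⟩ := hhom ξ hξU
    have h : ⊤ ≤ base a ⁻¹ᵁ O := by
      rw [← η.f.preimage_image_eq O, ← preimage_f_eq]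
      exact hξ.ge
    exact ⟨⊤, TopologicalSpace.Opens.mem_top p, _, a, h, rfl⟩
  · rintro ξ W _ _ - ⟨a, h, rfl⟩ ⟨a', h', rfl⟩ i
    obtain rfl := hsub ξ a a'
    exact ⟨1, (one_smul _ _).symm⟩
  · rintro ξ ζ a V W h _ ⟨a', h', rfl⟩
    exact ⟨a ≫ a', h.trans ((base a).preimage_mono h'), funext fun l =>
      sheafPull_sheafPull F a a' h h' _ _⟩

end RootStack

end AlgebraicGeometry

end

theorem mainTheorem7 (r : ℕ) (hr : 1 ≤ r) (X : Scheme.{u}) [AlgebraicGeometry.IsNoetherian X]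
    (hX : IsUnit (r : Γ(X, ⊤))) (L : X.Modules) (hL : L.IsInvertible)
    (s : Γ(L, ⊤)) (hs : Scheme.Modules.IsRegularSection s)
    (F : StackVect (RootStack.toScheme L s r)) (x : X) :
    ∃ U : X.Opens, x ∈ U ∧
      ∃ (n : ℕ) (G : Fin n → StackVect ((RootStack.preimage L s r U).ι ⋙ RootStack.toScheme L s r)),
        (∀ i, (G i).IsInvertible) ∧ (F.restrict (RootStack.preimage L s r U)).IsDirectSum G := by
  suffices h : ∃ U : X.Opens, x ∈ U ∧ ∃ k : ℕ, Nonempty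
      (StackVect.FrameSystem (F.restrict (RootStack.preimage L s r U)) (Fin k)) by
    obtain ⟨U, hxU, k, ⟨S⟩⟩ := h
    exact ⟨U, hxU, k, S.exists_isDirectSum⟩
  obtain ⟨O, hxO, ℓ, hℓ⟩ := hL.exists_isGen x
  obtain ⟨U, hU, hxU, hUO⟩ := exists_isAffineOpen_mem_and_subset hxO
  have hℓU := hℓ.res hUO
  obtain ⟨s₀, hs₀⟩ := hℓU.exists_smul le_rfl (L.res le_top s)
  rw [Scheme.Modules.res_self] at hs₀
  by_cases hx : x ∈ X.basicOpen s₀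
  · have hle : X.basicOpen s₀ ≤ U := X.basicOpen_le s₀
    refine RootStack.exists_frameSystem_of_isUnit F hr (hℓU.res hle)
      (s₀ := Scheme.Modules.fres hle s₀) ?_ (RingedSpace.isUnit_res_basicOpen _ s₀) hx
    rw [← Scheme.Modules.res_smul, ← hs₀, Scheme.Modules.res_res]
  · exact RootStack.exists_frameSystem_of_notMem F hr hU hℓU hs₀ hxU hx
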